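/- **Notation.** Let $N=\mathbb Z^2$, $M=\mathrm{Hom}(N,\mathbb Z)\cong\mathbb Z^2$ and $T^\vee=M_{\mathbb R}/M$, with the standard orientation. An oriented line on $T^\vee$ is the image of a line in $M_{\mathbb R}$ together with a primitive tangent vector $m\in M$ (its slope); the lines of slope $m$ are parametrized by their position in $S^1=\mathbb R/\mathbb Z$. A finite set of oriented lines is *simple* if no three of them meet in a point. Its cells and their edges are taken in the universal cover $M_{\mathbb R}$. A cell is *white* (*black*) if on each of its edges the orientation of the line agrees with (is opposite to) the boundary orientation of the cell, and *colored* if it is white or black. The arrangement is *admissible* if every edge bounds a colored cell. The edges of a convex lattice polygon $\Delta\subset N_{\mathbb R}$ are the boundary segments between consecutive lattice points. Let $\mathfrak U(\Delta)$ be the space of simple arrangements whose slopes are, with multiplicity, the primitive outward normals of the edges of $\Delta$; its topology comes from the positions of the lines, which form a subset of a real torus. For an admissible arrangement $\mathcal A$, let $\mathfrak D(\mathcal A)$ be the bicolored graph on $T^\vee$ whose white (black) nodes are the centers of gravity of the white (black) cells, and in which a white and a black cell that share a vertex are joined by a straight segment. The *linear Hanany–Vegh algorithm* takes a set $\mathfrak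 V$ containing exactly one element of each path component of $\mathfrak U(\Delta)$ and outputs $\{\mathfrak D(\mathcal A)\mid \mathcal A\in\mathfrak V\text{ admissible}\}$. A *dimer model* is a bicolored graph on $T^\vee$ (finite sets of black and white nodes; finitely many edges, each joining a black and a white node, with pairwise disjoint interiors that are embedded and contain no nodes) all of whose faces are simply connected. Its *dual quiver* has the faces as vertices and the edges as arrows, an arrow crossing its edge with the white node on the right. The *McKay quiver* of a finite group $A\subset SL_3(\mathbb C)$ has the irreducible representations of $A$ as vertices, and the number of arrows from $\sigma$ to $\tau$ is the multiplicity of $\tau$ in $\sigma\otimes\rho_{\mathrm{Nat}}^\vee$. **Theorem 1.2.** Let $\Delta$ be a lattice triangle with vertices $v_1,v_2,v_3\in N$ in counterclockwise order, and let $$A=\{\mathrm{diag}(t_1,t_2,t_3)\in SL_3(\mathbb C)\mid t_1^{v_1}t_2^{v_2}t_3^{v_3}=1\text{ in }N\otimes\mathbb C^\times\}.$$ Then for every choice of the representatives $\mathfrak V$, the output of the linear Hanany–Vegh algorithm on $\Delta$ consists of exactly one graph $G$, and 1. $G$ is a dimer model; 2. $G$ is a hexagonal tiling of $T^\vee$: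 its edges are straight segments, three edges meet in every node, and every face lifts to the interior of a convex hexagon whose sides are edges of the lifted graph; 3. $G$ is dual to the McKay quiver of $A$ drawn on the torus. That is, let $M_1=\mathbb Z^2$ and $\psi\colon M\to M_1$, $\psi(m)=(\langle v_1-v_3,m\rangle,\langle v_2-v_3,m\rangle)$, and let $\epsilon_1=(1,0)$, $\epsilon_2=(0,1)$, $\epsilon_3=(-1,-1)$. Consider the periodic quiver with vertex set $M_1$ and arrows $x_a,y_a,z_a$ from $a$ to $a-\epsilon_1,a-\epsilon_2,a-\epsilon_3$ respectively. The faces and edges of the lift of $G$ to $M_{\mathbb R}$ correspond bijectively to the vertices and arrows of this quiver, compatibly with sources and targets; the white (black) nodes correspond bijectively to its $3$-cycles that run through arrows of types $x,z,y$ (types $x,y,z$) in this order, where the edges at a node are dual to the arrows of its cycle; and translation by $m\in M$ corresponds to translation by $\psi(m)$. Moreover, the dual quiver of $G$ is isomorphic to the McKay quiver of $A$, by an isomorphism that sends a face with label $a=(a_1,a_2)\in M_1$ to the character $\pi_1^{a_1}\pi_2^{a_2}$, where $\pi_i$ denotes the $i$-th diagonal entry. -/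

import Mathlib

noncomputable section

namespace HananyVegh

open CategoryTheory Topology

/-! ### The torus -/

/-- The lattices `N = ℤ²` and `M = Hom(N, ℤ) = ℤ²`. -/
abbrev Lat := Fin 2 → ℤ

/-- The plane `M_ℝ = ℝ²`, also used for `N_ℝ`, with its standard orientation. -/
abbrev Plane := Fin 2 → ℝ

/-- The torus `T^∨ = M_ℝ / M = (ℝ/ℤ)²`. -/
abbrev Torus := UnitAddTorus (Fin 2)

/-- The inclusion of the lattice into the plane. -/
def toPlane (m : Lat) : Plane := fun i => (m i : ℝ)

/-- The projection `π : M_ℝ → T^∨`. -/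
def proj (x : Plane) : Torus := fun i => ((x i : ℝ) : UnitAddCircle)

/-- The oriented area `m ∧ x`; it is positive iff `x` points to the left of `m`. -/
def cross (m : Lat) (x : Plane) : ℝ := (m 0 : ℝ) * x 1 - (m 1 : ℝ) * x 0

/-- Rotation by `90°` counterclockwise. -/
def rotLeft (x : Plane) : Plane := ![-x 1, x 0]

/-- Primitive lattice vectors. -/
def Primitive (m : Lat) : Prop := IsCoprime (m 0) (m 1)

/-! ### Oriented lines and arrangements -/

/-- An oriented line on the torus is given by its slope, a primitive vector `m`, and its position
in `S¹ = ℝ/ℤ`. -/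
@[ext] structure OrientedLine where
  slope : Lat
  primitive : Primitive slope
  pos : UnitAddCircle

/-- The underlying subset of the torus: the image of a line `{x | m ∧ x = c}` in the plane,
where `c` is a real number whose class modulo `ℤ` is the position of the line. -/
def OrientedLine.carrier (L : OrientedLine) : Set Torus :=
  {p | L.slope 0 • p 1 - L.slope 1 • p 0 = L.pos}

/-- The lines in the plane that are mapped onto the line `L` are the lines
`L.lift c = {x | m ∧ x = c}` for the real numbers `c` with class `L.pos`. -/
def OrientedLine.lift (L : OrientedLine) (c : ℝ) : Set Plane := {x | cross L.slope x = c}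

/-- An arrangement is simple if no three of its lines meet in a point. -/
def IsSimple (A : Set OrientedLine) : Prop :=
  ∀ L₁ ∈ A, ∀ L₂ ∈ A, ∀ L₃ ∈ A, L₁ ≠ L₂ → L₁ ≠ L₃ → L₂ ≠ L₃ →
    L₁.carrier ∩ L₂.carrier ∩ L₃.carrier = ∅

/-- The union of the lines of an arrangement, pulled back to the plane. -/
def planeUnion (A : Set OrientedLine) : Set Plane := {x | ∃ L ∈ A, proj x ∈ L.carrier}

/-- The cells of the arrangement, on the universal cover `M_ℝ` of the torus. -/
def IsCell (A : Set OrientedLine) (C : Set Plane) : Prop :=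
  ∃ x, x ∉ planeUnion A ∧ C = connectedComponentIn (planeUnion A)ᶜ x

/-- `e` is the edge of the cell `C` on the lifted line `L.lift c`. (Cells are convex, so that the
intersection of the boundary of `C` with a line is connected.) -/
def IsCellEdge (A : Set OrientedLine) (C : Set Plane) (L : OrientedLine) (c : ℝ)
    (e : Set Plane) : Prop :=
  L ∈ A ∧ (c : UnitAddCircle) = L.pos ∧ e = frontier C ∩ L.lift c ∧ e.Nontrivial

/-- A cell is white if the orientation of the line and the boundary orientation of the cell agree
on each of its edges, that is, if the cell lies to the left of the line. -/
def IsWhite (A : Set OrientedLine) (C : Set Plane) : Prop :=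
  IsCell A C ∧ ∀ L c e, IsCellEdge A C L c e → ∀ x ∈ C, c < cross L.slope x

/-- A cell is black if the orientation of the line and the boundary orientation of the cell are
opposite on each of its edges, that is, if the cell lies to the right of the line. -/
def IsBlack (A : Set OrientedLine) (C : Set Plane) : Prop :=
  IsCell A C ∧ ∀ L c e, IsCellEdge A C L c e → ∀ x ∈ C, cross L.slope x < c

/-- An arrangement is admissible if every edge bounds a colored cell. -/
def IsAdmissible (A : Set OrientedLine) : Prop :=
  ∀ C L c e, IsCell A C → IsCellEdge A C L c e →
    ∃ C', (IsWhite A C' ∨ IsBlack A C') ∧ IsCellEdge A C' L c e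

/-- The vertices of an arrangement, on the universal cover. -/
def IsVertex (A : Set OrientedLine) (x : Plane) : Prop :=
  ∃ L ∈ A, ∃ L' ∈ A, L ≠ L' ∧ proj x ∈ L.carrier ∧ proj x ∈ L'.carrier

/-! ### Bicolored graphs on the torus -/

/-- A bicolored graph on the torus: black nodes, white nodes, and edges, which are continuous
maps from the unit interval. Edges are parametrized from their white to their black end. -/
@[ext] structure BicoloredGraph where
  white : Set Torus
  black : Set Torus
  edges : Set C(unitInterval, Torus)

namespace BicoloredGraph

variable (G : BicoloredGraph)

/-- The conditions on nodes and edges in the definition of a bicolored graph on the torus. -/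
structure IsGraph : Prop where
  finite_white : G.white.Finite
  finite_black : G.black.Finite
  finite_edges : G.edges.Finite
  disjoint : Disjoint G.white G.black
  start_mem : ∀ e ∈ G.edges, e 0 ∈ G.white
  end_mem : ∀ e ∈ G.edges, e 1 ∈ G.black
  interior_notMem : ∀ e ∈ G.edges, ∀ t ∈ Set.Ioo (0 : unitInterval) 1,
    e t ∉ G.white ∪ G.black
  interior_inj : ∀ e ∈ G.edges, ∀ e' ∈ G.edges, ∀ t ∈ Set.Ioo (0 : unitInterval) 1,
    ∀ t' ∈ Set.Ioo (0 : unitInterval) 1, e t = e' t' → e = e' ∧ t = t'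

/-- The union of the images of the edges. -/
def support : Set Torus := ⋃ e ∈ G.edges, Set.range e

/-- The faces: connected components of the complement of the edges. -/
def faces : Set (Set Torus) :=
  {F | ∃ p, p ∉ G.support ∧ F = connectedComponentIn G.supportᶜ p}

/-- A dimer model is a bicolored graph on the torus with simply connected faces. -/
def IsDimerModel : Prop := G.IsGraph ∧ ∀ F ∈ G.faces, SimplyConnectedSpace F

/-- The straight line segment from `w` to `b`, projected to the torus. -/
def segmentPath (w b : Plane) : C(unitInterval, Torus) where
  toFun t := proj (AffineMap.lineMap w b (t : ℝ))
  continuous_toFun := by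
    refine continuous_pi fun i => ?_
    refine (AddCircle.continuous_mk' (1 : ℝ)).comp ?_
    simp only [AffineMap.lineMap_apply, vsub_eq_sub, vadd_eq_add, Pi.add_apply, Pi.smul_apply]
    fun_prop

/-- The nodes of the pulled-back graph on the plane. -/
def planeWhite : Set Plane := proj ⁻¹' G.white

/-- The nodes of the pulled-back graph on the plane. -/
def planeBlack : Set Plane := proj ⁻¹' G.black

/-- The straight edges of the pulled-back graph on the plane, as pairs of a white and a black
end point. -/
def planeEdges : Set (Plane × Plane) := {q | segmentPath q.1 q.2 ∈ G.edges}

/-- The faces of the pulled-back graph on the plane. -/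
def planeFaces : Set (Set Plane) :=
  {F | ∃ x, x ∉ proj ⁻¹' G.support ∧ F = connectedComponentIn (proj ⁻¹' G.support)ᶜ x}

/-- A (straight) hexagonal tiling of the torus: on the universal cover every edge is a line
segment, three edges meet in every node, and every face is the interior of a convex hexagon whose
six sides are edges of the graph. -/
structure IsHexagonalTiling : Prop where
  straight : ∀ e ∈ G.edges, ∃ w b, e = segmentPath w b
  white_degree : ∀ w ∈ G.planeWhite, {q ∈ G.planeEdges | q.1 = w}.ncard = 3
  black_degree : ∀ b ∈ G.planeBlack, {q ∈ G.planeEdges | q.2 = b}.ncard = 3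
  hexagon : ∀ F ∈ G.planeFaces, ∃ p : Fin 6 → Plane, ConvexIndependent ℝ p ∧
    F = interior (convexHull ℝ (Set.range p)) ∧
    ∀ k, (p k, p (k + 1)) ∈ G.planeEdges ∨ (p (k + 1), p k) ∈ G.planeEdges

/-- The dual arrow of the straight edge from the white node `w` to the black node `b` crosses this
edge with the white node on its right, so its direction is that of `w - b` rotated
counterclockwise. The face `F` in the plane is its target. -/
def IsPlaneTarget (q : Plane × Plane) (F : Set Plane) : Prop :=
  ∀ᶠ ε : ℝ in 𝓝[>] 0, midpoint ℝ q.1 q.2 + ε • rotLeft (q.1 - q.2) ∈ F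

/-- The face `F` in the plane is the source of the dual arrow of an edge. -/
def IsPlaneSource (q : Plane × Plane) (F : Set Plane) : Prop :=
  ∀ᶠ ε : ℝ in 𝓝[>] 0, midpoint ℝ q.1 q.2 - ε • rotLeft (q.1 - q.2) ∈ F

/-- The face `F` on the torus is the target of the dual arrow of the edge `e`. -/
def IsTarget (e : C(unitInterval, Torus)) (F : Set Torus) : Prop :=
  ∃ w b, e = segmentPath w b ∧ IsPlaneTarget (w, b) (proj ⁻¹' F)

/-- The face `F` on the torus is the source of the dual arrow of the edge `e`. -/
def IsSource (e : C(unitInterval, Torus)) (F : Set Torus) : Prop :=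
  ∃ w b, e = segmentPath w b ∧ IsPlaneSource (w, b) (proj ⁻¹' F)

end BicoloredGraph

/-! ### The linear Hanany–Vegh algorithm -/

/-- The center of gravity of a cell. -/
def centroid (C : Set Plane) : Plane := ⨍ x in C, x ∂MeasureTheory.volume

/-- The graph `𝔇(A)` of an arrangement: the nodes are the centers of gravity of the colored cells,
and a white and a black cell that share a vertex are connected by a straight line segment. -/
def dimer (A : Set OrientedLine) : BicoloredGraph where
  white := {p | ∃ C, IsWhite A C ∧ p = proj (centroid C)}
  black := {p | ∃ C, IsBlack A C ∧ p = proj (centroid C)}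
  edges := {e | ∃ C C' x, IsWhite A C ∧ IsBlack A C' ∧ IsVertex A x ∧
    x ∈ frontier C ∧ x ∈ frontier C' ∧
    e = BicoloredGraph.segmentPath (centroid C) (centroid C')}

/-- An edge of a lattice polygon `Δ`: a segment in its boundary between consecutive lattice
points `P` and `P + d`, with `Δ` to its left. -/
@[ext] structure PolygonEdge (Δ : Set Plane) where
  start : Lat
  dir : Lat
  primitive : Primitive dir
  start_mem : toPlane start ∈ Δ
  end_mem : toPlane (start + dir) ∈ Δ
  left : ∀ x ∈ Δ, 0 ≤ cross dir (x - toPlane start)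

variable {Δ : Set Plane}

/-- The primitive outward normal vector of an edge. -/
def PolygonEdge.normal (e : PolygonEdge Δ) : Lat := ![e.dir 1, -e.dir 0]

theorem PolygonEdge.primitive_normal (e : PolygonEdge Δ) : Primitive e.normal := by
  have h := e.primitive
  unfold Primitive at h ⊢
  simpa [PolygonEdge.normal] using h.symm.neg_right

/-- The oriented line with the outward normal of `e` as slope and with position `c`. -/
def PolygonEdge.line (e : PolygonEdge Δ) (c : UnitAddCircle) : OrientedLine :=
  ⟨e.normal, e.primitive_normal, c⟩

/-- `𝔘(Δ)`: the simple oriented line arrangements associated with `Δ`, that is, sets of oriented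
lines whose slopes are, with multiplicities, the outward normals of the edges of `Δ`. -/
structure SimpleArrangement (Δ : Set Plane) where
  lines : Set OrientedLine
  associated : ∃ L : PolygonEdge Δ ≃ lines, ∀ e, (L e).1.slope = e.normal
  simple : IsSimple lines

/-- The points of the torus `(S¹)ⁿ`, where `n` is the number of edges of `Δ`, that are the
positions of distinct lines that form a simple arrangement. -/
def SimplePosition (Δ : Set Plane) : Type :=
  {c : PolygonEdge Δ → UnitAddCircle //
    Function.Injective (fun e : PolygonEdge Δ => e.line (c e)) ∧
      IsSimple (Set.range fun e : PolygonEdge Δ => e.line (c e))}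

instance : TopologicalSpace (SimplePosition Δ) := instTopologicalSpaceSubtype

/-- The arrangement with given positions of the lines. -/
def SimplePosition.arrangement (c : SimplePosition Δ) : SimpleArrangement Δ where
  lines := Set.range fun e : PolygonEdge Δ => e.line (c.1 e)
  associated := ⟨Equiv.ofInjective _ c.2.1, fun _ => rfl⟩
  simple := c.2.2

/-- The space of arrangements is topologized by the positions of the lines. -/
instance : TopologicalSpace (SimpleArrangement Δ) :=
  TopologicalSpace.coinduced SimplePosition.arrangement inferInstance

/-- `V ⊆ 𝔘(Δ)` represents `π₀(𝔘(Δ))`: it has exactly one element in each path component. -/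
def IsRepresentative (V : Set (SimpleArrangement Δ)) : Prop :=
  Function.Bijective fun A : V => (Quotient.mk _ A.1 : ZerothHomotopy (SimpleArrangement Δ))

/-- The output of the linear Hanany–Vegh algorithm: the graphs of the admissible arrangements
among the representatives. -/
def output (V : Set (SimpleArrangement Δ)) : Set BicoloredGraph :=
  {G | ∃ A ∈ V, IsAdmissible A.lines ∧ G = dimer A.lines}

/-! ### McKay quivers -/

section McKay

variable {n : ℕ} (H : Subgroup (Matrix.SpecialLinearGroup (Fin n) ℂ))

/-- The natural representation of a group of matrices. -/
def naturalRep : Representation ℂ H (Fin n → ℂ) where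
  toFun g := Matrix.toLin' g.1.1
  map_one' := by simp; rfl
  map_mul' g h := by simp [Matrix.toLin'_mul]; rfl

/-- Isomorphism of irreducible representations. -/
def irrSetoid : Setoid {X : FDRep ℂ H // Simple X} where
  r X Y := Nonempty (X.1 ≅ Y.1)
  iseqv := ⟨fun _ => ⟨Iso.refl _⟩, fun ⟨i⟩ => ⟨i.symm⟩, fun ⟨i⟩ ⟨j⟩ => ⟨i.trans j⟩⟩

/-- The set of (isomorphism classes of) irreducible representations. -/
def Irr : Type 1 := Quotient (irrSetoid H)

variable {H}

/-- An irreducible representation in a given class. -/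
def Irr.rep (σ : Irr H) : FDRep ℂ H := (Quotient.out (s := irrSetoid H) σ).1

/-- The multiplicity of `τ` in the tensor product of `σ` with the dual of the natural
representation. -/
def mckayNumber (σ τ : Irr H) : ℕ :=
  Module.finrank ℂ
    (τ.rep ⟶ MonoidalCategoryStruct.tensorObj σ.rep (FDRep.of (naturalRep H).dual))

variable (H)

/-- The arrows of the McKay quiver, whose set of vertices is `Irr H`. -/
structure McKayArrow where
  source : Irr H
  target : Irr H
  index : Fin (mckayNumber source target)

end McKay

/-! ### The abelian group of a triangle, and duality -/

/-- The finite abelian group of diagonal matrices `diag(t₀, t₁, t₂)` of determinant `1` with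
`t₀ ^ v₀ * t₁ ^ v₁ * t₂ ^ v₂ = 1` in `N ⊗ ℂˣ = (ℂˣ)²`. -/
def triangleGroup (v : Fin 3 → Lat) : Subgroup (Matrix.SpecialLinearGroup (Fin 3) ℂ) where
  carrier := {g | ∃ t : Fin 3 → ℂˣ, g.1 = Matrix.diagonal (fun i => (t i : ℂ)) ∧
    ∀ k, ∏ i, t i ^ v i k = 1}
  one_mem' := ⟨1, by simp, by simp⟩
  mul_mem' := by
    rintro g h ⟨t, hg, ht⟩ ⟨u, hh, hu⟩
    refine ⟨t * u, ?_, fun k => ?_⟩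
    · rw [Matrix.SpecialLinearGroup.coe_mul, hg, hh, Matrix.diagonal_mul_diagonal]
      simp
    · simp [mul_zpow, Finset.prod_mul_distrib, ht k, hu k]
  inv_mem' := by
    rintro g ⟨t, hg, ht⟩
    refine ⟨t⁻¹, ?_, fun k => ?_⟩
    · have h : g.1 * (Matrix.diagonal fun i => ((t⁻¹ i : ℂˣ) : ℂ)) = 1 := by
        rw [hg, Matrix.diagonal_mul_diagonal]
        simp
      have h' : (g⁻¹).1 * g.1 = 1 := by
        rw [← Matrix.SpecialLinearGroup.coe_mul]
        simp
      calc (g⁻¹).1 = (g⁻¹).1 * (g.1 * (Matrix.diagonal fun i => ((t⁻¹ i : ℂˣ) : ℂ))) := by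
            rw [h, mul_one]
        _ = _ := by rw [← mul_assoc, h', one_mul]
    · simp [ht k]

/-- The character `π_i`: the `i`-th diagonal entry. -/
def coordChar (v : Fin 3 → Lat) (i : Fin 3) : triangleGroup v →* ℂˣ :=
  MonoidHom.toHomUnits
    { toFun := fun g => g.1.1 i i
      map_one' := by simp
      map_mul' := by
        rintro ⟨g, t, hg, -⟩ ⟨h, u, hh, -⟩
        simp [hg, hh] }

/-- The one-dimensional representation of a character. -/
def charRep {H : Type} [Group H] (χ : H →* ℂˣ) : FDRep ℂ H :=
  FDRep.of (V := ℂ)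
    ((algebraMap ℂ (Module.End ℂ ℂ)).toMonoidHom.comp ((Units.coeHom ℂ).comp χ))

/-- The character `π₀ ^ a₀ * π₁ ^ a₁` of the triangle group, for `a` in `M₁ = ℤ²`. -/
def latChar (v : Fin 3 → Lat) (a : Lat) : triangleGroup v →* ℂˣ :=
  coordChar v 0 ^ a 0 * coordChar v 1 ^ a 1

/-- The map `ψ : M → M₁`, adjoint to the map `N₁ → N` with the columns `v₀ - v₂`, `v₁ - v₂`. -/
def psi (v : Fin 3 → Lat) (m : Lat) : Lat :=
  ![∑ j, (v 0 j - v 2 j) * m j, ∑ j, (v 1 j - v 2 j) * m j]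

/-- The elements of `M₁` that stand for the characters `π₀`, `π₁`, `π₂ = π₀⁻¹ * π₁⁻¹`. -/
def step : Fin 3 → Lat := ![![1, 0], ![0, 1], ![-1, -1]]

/-- `G` is dual to the McKay quiver of the group of the triangle `v`, drawn on the torus.

The McKay quiver on the torus is the quotient by `ψ(M)` of the infinite quiver in the plane whose
vertices are the elements `a` of `M₁`, standing for characters, with three arrows
`x_a, y_a, z_a = (a, 0), (a, 1), (a, 2)` from `a` to `a - step i` (that is, from `ρ` to
`ρ ⊗ π_i^∨`). Its complementary regions are triangles, with boundary cycles `x, z, y` (clockwise,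
these are dual to white nodes) and `x, y, z` (counterclockwise, these are dual to black nodes).

`face` to `target` say that the pull-back of `G` to the plane is dual to this infinite quiver,
compatibly with the translations by `M`; `iso` says that the quiver whose vertices are the faces
of `G` and whose arrows are the edges of `G`, crossed with the white node on the right, is
isomorphic to the McKay quiver, the character of a face being the one given by its label. -/
def IsDualToMcKayQuiver (v : Fin 3 → Lat) (G : BicoloredGraph) : Prop :=
  ∃ (face : Lat → Set Plane) (edge : Lat × Fin 3 → Plane × Plane) (white black : Lat → Plane),
    -- bijections onto the faces, edges and nodes of the graph in the plane
    (Function.Injective face ∧ Set.range face = G.planeFaces) ∧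
    (Function.Injective edge ∧ Set.range edge = G.planeEdges) ∧
    (Function.Injective white ∧ Set.range white = G.planeWhite) ∧
    (Function.Injective black ∧ Set.range black = G.planeBlack) ∧
    -- equivariance
    (∀ a m, face (a + psi v m) = (fun x => x + toPlane m) '' face a) ∧
    (∀ a i m, edge (a + psi v m, i) = edge (a, i) + (toPlane m, toPlane m)) ∧
    (∀ a m, white (a + psi v m) = white a + toPlane m) ∧
    (∀ a m, black (a + psi v m) = black a + toPlane m) ∧
    -- sources and targets of the arrows
    (∀ a i, BicoloredGraph.IsPlaneSource (edge (a, i)) (face a) ∧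
      BicoloredGraph.IsPlaneTarget (edge (a, i)) (face (a - step i))) ∧
    -- the cycles of arrows around the nodes
    (∀ a, (edge (a, 0)).1 = white a ∧ (edge (a - step 0, 2)).1 = white a ∧
      (edge (a - step 0 - step 2, 1)).1 = white a) ∧
    (∀ a, (edge (a, 0)).2 = black a ∧ (edge (a - step 0, 1)).2 = black a ∧
      (edge (a - step 0 - step 1, 2)).2 = black a) ∧
    -- the isomorphism with the McKay quiver
    ∃ (φ : G.faces ≃ Irr (triangleGroup v)) (η : G.edges ≃ McKayArrow (triangleGroup v)),
      (∀ e : G.edges, BicoloredGraph.IsSource e.1 (φ.symm (η e).source).1 ∧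
        BicoloredGraph.IsTarget e.1 (φ.symm (η e).target).1) ∧
      ∀ a (F : G.faces), proj '' face a ⊆ F.1 →
        Nonempty ((φ F).rep ≅ charRep (latChar v a))

end HananyVegh

end

noncomputable section

namespace HananyVegh

open CategoryTheory Topology

section

/-! ### Connected components of disjoint unions of open sets -/

section Components

variable {X ι : Type*} [TopologicalSpace X] {F : ι → Set X} {U : Set X}

/-! Pairing with the three sides of the triangle gives functions `coord v i` with sum zero. They
identify M_ℝ with the plane y₀ + y₁ + y₂ = 0 in ℝ³, and `pt v` is the projection of ℝ³ along
(1,1,1). A line of the i-th family is a level set of `coord v i`, so an arrangement is a grid in ℝ³: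
three increasing sequences `u i`, quasi-periodic with period `mult v i`. Its cells are the sections
of the boxes of the grid by the plane. The sign of `height u a` tells on which side of the plane the
grid node a lies, and simplicity means that no node lies on it (`isSimple_gridLines_iff`).

A cell is a white triangle if its box has only the lowest corner a below the plane, and black if
only the highest corner is above. Admissibility propagates whiteness from a to a + e_l − e_m
(`height_pos_of_isAdmissible`, `exists_heightCut`). Hence the plane separates the nodes of index sum
at most H from those of sum at least H + 1; this is `HeightCut`, and it conversely implies
admissibility. After reindexing, H = 0. A colored triangle has an affine symmetry of order three, so
its center of gravity is the projection of the corner that is cut off. The output graph is therefore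
the projection of the grid edges that run from index sum 0 to index sum 1 (`dimer_gridLines`). Its
faces are the shadows of the boxes with lowest corner of index sum −1, and these hexagons fill the
complement of the edges (`mem_hexFace_or_onEdge`).

There is exactly one admissible component. Grids with cut 0 are closed under convex combinations, so
any two admissible arrangements are joined (`joined_of_isAdmissible`). By periodicity a cut amounts
to finitely many strict inequalities, so admissibility is open and closed
(`isClopen_setOf_isAdmissible`). An evenly spaced grid is admissible (`exists_isAdmissible`).

For the McKay quiver, faces in the plane are labelled by M₁ via `boxIndex`, and translation by m
becomes translation by ψ(m). The quotient M₁/ψ(M) is the set of characters of A (`latChar_eq_iff`,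
`exists_iso_charRep`), and orthogonality of characters identifies the arrows (`mckayNumber_eq`). -/

theorem connectedComponentIn_eq_of_disjoint_open (hU : U = ⋃ i, F i) (ho : ∀ i, IsOpen (F i))
    (hc : ∀ i, IsPreconnected (F i)) (hd : ∀ i j, (F i ∩ F j).Nonempty → F i = F j)
    {i : ι} {x : X} (hx : x ∈ F i) : connectedComponentIn U x = F i := by
  have hsub : F i ⊆ U := hU ▸ Set.subset_iUnion F i
  refine Set.Subset.antisymm ?_ ((hc i).subset_connectedComponentIn hx hsub)
  -- Members of the family may coincide, as torus faces do for translated indices. `V` collects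
  -- those that differ from `F i` as sets, so that it is disjoint from `F i`.
  set V : Set X := ⋃ j ∈ {j | F j ≠ F i}, F j
  have hV : IsOpen V := isOpen_biUnion fun j _ => ho j
  have hdis : Disjoint (F i) V := by
    rw [Set.disjoint_left]
    intro y hy hyV
    obtain ⟨j, hj, hyj⟩ := Set.mem_iUnion₂.1 hyV
    exact hj (hd j i ⟨y, hyj, hy⟩)
  have hcov : connectedComponentIn U x ⊆ F i ∪ V := by
    intro y hy
    have hyU := connectedComponentIn_subset U x hy
    rw [hU] at hyU
    obtain ⟨j, hj⟩ := Set.mem_iUnion.1 hyU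
    by_cases h : F j = F i
    · exact Or.inl (h ▸ hj)
    · exact Or.inr (Set.mem_iUnion₂.2 ⟨j, h, hj⟩)
  exact isPreconnected_connectedComponentIn.subset_left_of_subset_union (ho i) hV hdis hcov
    ⟨x, mem_connectedComponentIn (hsub hx), hx⟩

theorem setOf_connectedComponentIn_eq_range (hU : U = ⋃ i, F i) (ho : ∀ i, IsOpen (F i))
    (hc : ∀ i, IsPreconnected (F i)) (hd : ∀ i j, (F i ∩ F j).Nonempty → F i = F j)
    (hne : ∀ i, (F i).Nonempty) :
    {C | ∃ x, x ∈ U ∧ C = connectedComponentIn U x} = Set.range F := by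
  ext C
  constructor
  · rintro ⟨x, hx, rfl⟩
    rw [hU] at hx
    obtain ⟨i, hi⟩ := Set.mem_iUnion.1 hx
    exact ⟨i, (connectedComponentIn_eq_of_disjoint_open hU ho hc hd hi).symm⟩
  · rintro ⟨i, rfl⟩
    obtain ⟨x, hx⟩ := hne i
    refine ⟨x, hU ▸ Set.mem_iUnion.2 ⟨i, hx⟩, ?_⟩
    exact (connectedComponentIn_eq_of_disjoint_open hU ho hc hd hx).symm

end Components

/-! ### The projection to the torus -/

theorem coe_unitAddCircle_eq_iff {x y : ℝ} :
    (x : UnitAddCircle) = (y : UnitAddCircle) ↔ ∃ n : ℤ, y = x + n := by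
  rw [eq_comm, ← sub_eq_zero, ← AddCircle.coe_sub, AddCircle.coe_eq_zero_iff]
  refine exists_congr fun n => ?_
  rw [zsmul_eq_mul, mul_one]
  constructor <;> intro h <;> linarith

theorem proj_eq_proj_iff {x x' : Plane} : proj x = proj x' ↔ ∃ m : Lat, x' = x + toPlane m := by
  constructor
  · intro h
    choose m hm using fun i => coe_unitAddCircle_eq_iff.1 (congrFun h i)
    exact ⟨m, funext hm⟩
  · rintro ⟨m, rfl⟩
    exact funext fun i => coe_unitAddCircle_eq_iff.2 ⟨m i, rfl⟩

theorem proj_add_toPlane (x : Plane) (m : Lat) : proj (x + toPlane m) = proj x :=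
  (proj_eq_proj_iff.2 ⟨m, rfl⟩).symm

theorem continuous_proj : Continuous proj :=
  continuous_pi fun i => (AddCircle.continuous_mk' (1 : ℝ)).comp (continuous_apply i)

theorem isOpenMap_proj : IsOpenMap proj := by
  have h : IsOpenMap (Pi.map (fun (_ : Fin 2) (x : ℝ) => (x : UnitAddCircle))) :=
    IsOpenMap.piMap (fun _ => QuotientAddGroup.isOpenMap_coe)
      (Filter.Eventually.of_forall fun _ => QuotientAddGroup.mk_surjective)
  exact h

theorem proj_surjective : Function.Surjective proj := by
  intro p
  choose x hx using fun i => QuotientAddGroup.mk_surjective (p i)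
  exact ⟨x, funext hx⟩

theorem toPlane_injective : Function.Injective toPlane := fun m m' h =>
  funext fun i => by simpa [toPlane] using congrFun h i

/-- A nonconstant affine function cannot have only integer values on an interval. This makes the
lattice translation between two lifts of one path independent of time. -/
theorem int_affine_const {f₀ f₁ : ℝ} (h : ∀ t ∈ Set.Icc (0 : ℝ) 1, ∃ n : ℤ, f₀ + t * (f₁ - f₀) = n) :
    f₀ = f₁ := by
  obtain ⟨a, ha⟩ := h 0 (by simp)
  obtain ⟨b, hb⟩ := h 1 (by simp)
  have ha' : f₀ = a := by linarith
  have hb' : f₁ = b := by linarith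
  by_contra hne
  have hab : b - a ≠ 0 := by
    intro h0
    apply hne
    rw [ha', hb']
    congr 1
    omega
  have h1 : (1 : ℝ) ≤ |(b : ℝ) - a| := by
    have := Int.one_le_abs hab
    exact_mod_cast this
  -- At this time the function has moved by exactly one half.
  obtain ⟨n, hn⟩ := h (1 / (2 * |(b : ℝ) - a|)) ⟨by positivity, by
    rw [div_le_one (by linarith)]; linarith⟩
  rw [ha', hb'] at hn
  have hab' : (b : ℝ) - a ≠ 0 := by exact_mod_cast hab
  have h2 : 2 * (n - a) = 1 ∨ 2 * (n - a) = -1 := by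
    rcases abs_cases ((b : ℝ) - a) with ⟨hc, -⟩ | ⟨hc, -⟩
    · left
      rw [hc] at hn
      have : (2 : ℝ) * (n - a) = 1 := by rw [← hn]; field_simp; ring
      exact_mod_cast this
    · right
      rw [hc] at hn
      have : (2 : ℝ) * (n - a) = -1 := by rw [← hn]; field_simp; ring
      exact_mod_cast this
  omega

theorem segmentPath_apply (w b : Plane) (t : unitInterval) :
    BicoloredGraph.segmentPath w b t = proj (AffineMap.lineMap w b (t : ℝ)) := rfl

theorem segmentPath_eq_iff {w b w' b' : Plane} :
    BicoloredGraph.segmentPath w b = BicoloredGraph.segmentPath w' b' ↔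
      ∃ m : Lat, w' = w + toPlane m ∧ b' = b + toPlane m := by
  constructor
  · intro h
    have h0 := DFunLike.congr_fun h 0
    simp only [segmentPath_apply, Set.Icc.coe_zero, AffineMap.lineMap_apply_zero] at h0
    obtain ⟨m, hm⟩ := proj_eq_proj_iff.1 h0
    refine ⟨m, hm, ?_⟩
    have key : ∀ i, w' i - w i = b' i - b i := by
      intro i
      apply int_affine_const
      intro t ht
      have h1 := DFunLike.congr_fun h ⟨t, ht⟩
      simp only [segmentPath_apply] at h1
      obtain ⟨k, hk⟩ := proj_eq_proj_iff.1 h1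
      refine ⟨k i, ?_⟩
      have := congrFun hk i
      simp [AffineMap.lineMap_apply, toPlane] at this
      linarith
    ext i
    have := key i
    simp [hm] at this ⊢
    linarith
  · rintro ⟨m, rfl, rfl⟩
    ext1 t
    rw [segmentPath_apply, segmentPath_apply, proj_eq_proj_iff]
    refine ⟨m, ?_⟩
    ext i
    simp [AffineMap.lineMap_apply]
    ring

/-! ### Coordinates adapted to a triangle -/

/-- The side of the triangle opposite to the vertex `v i`. -/
def side (v : Fin 3 → Lat) (i : Fin 3) : Lat := v (i + 2) - v (i + 1)

/-- Twice the oriented area of the triangle. -/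
def dblArea (v : Fin 3 → Lat) : ℤ :=
  (v 1 0 - v 0 0) * (v 2 1 - v 0 1) - (v 1 1 - v 0 1) * (v 2 0 - v 0 0)

/-- The pairing of `N` and `M`. -/
def pairing (n m : Lat) : ℤ := n 0 * m 0 + n 1 * m 1

/-- The pairing with the `i`-th side of the triangle, as a function on the plane. -/
def coord (v : Fin 3 → Lat) (i : Fin 3) : Plane →ₗ[ℝ] ℝ :=
  (side v i 0 : ℝ) • LinearMap.proj 0 + (side v i 1 : ℝ) • LinearMap.proj 1

/-- The point of the plane whose coordinates are `y i - (∑ j, y j) / 3`. -/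
def pt (v : Fin 3 → Lat) : (Fin 3 → ℝ) →ₗ[ℝ] Plane :=
  LinearMap.pi ![∑ i, (((side v (i + 1) 1 - side v (i + 2) 1 : ℤ) : ℝ) / (3 * dblArea v)) •
      LinearMap.proj i,
    ∑ i, (((side v (i + 2) 0 - side v (i + 1) 0 : ℤ) : ℝ) / (3 * dblArea v)) • LinearMap.proj i]

section Coord

variable {v : Fin 3 → Lat}

theorem coord_apply (i : Fin 3) (x : Plane) :
    coord v i x = (side v i 0 : ℝ) * x 0 + (side v i 1 : ℝ) * x 1 := by
  simp [coord]

theorem continuous_coord (i : Fin 3) : Continuous (coord v i) :=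
  (coord v i).continuous_of_finiteDimensional

theorem continuous_pt : Continuous (pt v) := (pt v).continuous_of_finiteDimensional

theorem sum_side (v : Fin 3 → Lat) (j : Fin 2) : ∑ i, side v i j = 0 := by
  simp [side, Fin.sum_univ_three]
  ring

theorem sum_coord (x : Plane) : ∑ i, coord v i x = 0 := by
  have h0 := sum_side v 0
  have h1 := sum_side v 1
  simp only [coord_apply, Finset.sum_add_distrib, ← Finset.sum_mul]
  rw_mod_cast [h0, h1]
  simp

theorem sum_pairing (m : Lat) : ∑ i, pairing (side v i) m = 0 := by
  have h0 := sum_side v 0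
  have h1 := sum_side v 1
  simp only [pairing, Finset.sum_add_distrib, ← Finset.sum_mul]
  simp [h0, h1]

theorem coord_toPlane (i : Fin 3) (m : Lat) : coord v i (toPlane m) = pairing (side v i) m := by
  simp [coord_apply, pairing, toPlane]

theorem coord_pt (hv : 0 < dblArea v) (i : Fin 3) (y : Fin 3 → ℝ) :
    coord v i (pt v y) = y i - (∑ j, y j) / 3 := by
  have hD : ((dblArea v : ℤ) : ℝ) ≠ 0 := by exact_mod_cast hv.ne'
  simp only [coord_apply, pt, LinearMap.pi_apply, Fin.sum_univ_three]
  have e : (((dblArea v : ℤ) : ℝ)) = ((v 1 0 - v 0 0) * (v 2 1 - v 0 1) -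
      (v 1 1 - v 0 1) * (v 2 0 - v 0 0)) := by simp [dblArea]
  fin_cases i <;> simp [side] <;> field_simp <;> rw [e] <;> ring

/-- The sides 1 and 2 have determinant `dblArea v`, so these two coordinates already determine the
point, by Cramer's rule. -/
theorem plane_ext (hv : 0 < dblArea v) {x x' : Plane} (h : ∀ i, coord v i x = coord v i x') :
    x = x' := by
  have hD : ((dblArea v : ℤ) : ℝ) ≠ 0 := by exact_mod_cast hv.ne'
  have e : (((dblArea v : ℤ) : ℝ)) = ((v 1 0 - v 0 0) * (v 2 1 - v 0 1) -
      (v 1 1 - v 0 1) * (v 2 0 - v 0 0)) := by simp [dblArea]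
  have h1 := h 1
  have h2 := h 2
  simp [coord_apply, side] at h1 h2
  ext j
  apply mul_left_cancel₀ hD
  rw [e]
  fin_cases j
  · change _ * x 0 = _ * x' 0
    linear_combination ((v 1 1 : ℝ) - v 0 1) * h1 - ((v 0 1 : ℝ) - v 2 1) * h2
  · change _ * x 1 = _ * x' 1
    linear_combination ((v 0 0 : ℝ) - v 2 0) * h2 - ((v 1 0 : ℝ) - v 0 0) * h1

/-- The kernel of `pt v` is spanned by (1,1,1), and `t` measures how far y lies along the fibre over
x. Most arguments below compare two such parameters, called times. -/
theorem pt_eq_iff (hv : 0 < dblArea v) {y : Fin 3 → ℝ} {x : Plane} :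
    pt v y = x ↔ ∃ t, ∀ i, coord v i x + t = y i := by
  constructor
  · rintro rfl
    exact ⟨(∑ j, y j) / 3, fun i => by rw [coord_pt hv]; ring⟩
  · rintro ⟨t, ht⟩
    refine plane_ext hv fun i => ?_
    have hs : ∑ j, y j = 3 * t := by
      simp only [← ht, Finset.sum_add_distrib, sum_coord]
      simp
    rw [coord_pt hv, hs, ← ht]
    ring

theorem pt_coord_add (hv : 0 < dblArea v) (x : Plane) (t : ℝ) :
    pt v (fun i => coord v i x + t) = x := (pt_eq_iff hv).2 ⟨t, fun _ => rfl⟩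

theorem coord_pt_of_sum_eq_zero (hv : 0 < dblArea v) {y : Fin 3 → ℝ} (hy : ∑ i, y i = 0)
    (i : Fin 3) : coord v i (pt v y) = y i := by rw [coord_pt hv, hy]; simp

/-- Each coordinate is nonzero on the oriented direction transverse to the two others. -/
theorem side_ne_zero (hv : 0 < dblArea v) (i : Fin 3) : side v i ≠ 0 := by
  intro h
  have h0 := congrFun h 0
  have h1 := congrFun h 1
  apply hv.ne'
  unfold dblArea
  fin_cases i <;> simp [side, sub_eq_zero] at h0 h1 <;> simp [h0, h1] <;> ring

end Coord

end

section

/-! ### Grids -/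

/-- The number of primitive segments in the side opposite to `v i`. -/
def mult (v : Fin 3 → Lat) (i : Fin 3) : ℕ := Int.gcd (side v i 0) (side v i 1)

/-- Three increasing sequences, where the `i`-th one lists the values of `coord v i` on the lines of
the `i`-th family of an arrangement. -/
structure IsGrid (v : Fin 3 → Lat) (u : Fin 3 → ℤ → ℝ) : Prop where
  mono : ∀ i, StrictMono (u i)
  periodic : ∀ i a, u i (a + mult v i) = u i a + mult v i

theorem sum_add_two_le {a c : Fin 3 → ℤ} {i : Fin 3} (h : ∀ j ≠ i, c j + 1 ≤ a j)
    (hi : c i ≤ a i) : ∑ j, c j + 2 ≤ ∑ j, a j := by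
  simp only [Fin.sum_univ_three]
  have h0 := h 0
  have h1 := h 1
  have h2 := h 2
  fin_cases i <;> simp at h0 h1 h2 hi <;> omega

theorem eq_of_le_of_sum_eq {a c : Fin 3 → ℤ} (h : ∀ j, a j ≤ c j) (hs : ∑ j, a j = ∑ j, c j) :
    a = c :=
  funext fun j => ((Finset.sum_eq_sum_iff_of_le fun j _ => h j).1 hs) j (Finset.mem_univ j)

theorem sum_add_single (a : Fin 3 → ℤ) (i : Fin 3) (n : ℤ) :
    ∑ j, (a + (Pi.single i n : Fin 3 → ℤ)) j = ∑ j, a j + n := by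
  simp [Finset.sum_add_distrib]

/-- The translation of index triples that corresponds to `m`. -/
def shift (v : Fin 3 → Lat) (m : Lat) : Fin 3 → ℤ := fun i => pairing (side v i) m

theorem sum_shift (v : Fin 3 → Lat) (m : Lat) : ∑ i, shift v m i = 0 := sum_pairing m

variable {v : Fin 3 → Lat} {u : Fin 3 → ℤ → ℝ}

theorem mult_pos (hv : 0 < dblArea v) (i : Fin 3) : 0 < mult v i := by
  refine Nat.pos_of_ne_zero fun h => side_ne_zero hv i ?_
  obtain ⟨h0, h1⟩ := Int.gcd_eq_zero_iff.1 h
  ext j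
  fin_cases j
  exacts [h0, h1]

namespace IsGrid

theorem periodic_mul (h : IsGrid v u) (i : Fin 3) (a n : ℤ) :
    u i (a + n * mult v i) = u i a + n * mult v i := by
  induction n using Int.induction_on with
  | zero => simp
  | succ n ih =>
    rw [add_mul, one_mul, ← add_assoc, h.periodic, ih]
    push_cast
    ring
  | pred n ih =>
    have := h.periodic i (a + (-(n : ℤ) - 1) * mult v i)
    rw [add_assoc, show (-(n : ℤ) - 1) * (mult v i : ℤ) + mult v i = -(n : ℤ) * mult v i by ring,
      ih] at this
    push_cast at this ⊢
    linarith

/-- The pairing of a side with a lattice vector is divisible by `mult v i`, so translation by M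
changes index and value by the same integer. -/
theorem add_shift (h : IsGrid v u) (i : Fin 3) (a : ℤ) (m : Lat) :
    u i (a + shift v m i) = u i a + shift v m i := by
  have hd : (mult v i : ℤ) ∣ shift v m i :=
    dvd_add ((Int.gcd_dvd_left ..).mul_right _) ((Int.gcd_dvd_right ..).mul_right _)
  obtain ⟨n, hn⟩ := hd
  rw [hn, mul_comm, h.periodic_mul]
  push_cast
  ring

end IsGrid

/-- The point of the plane associated with a point of the grid. -/
def node (v : Fin 3 → Lat) (u : Fin 3 → ℤ → ℝ) (a : Fin 3 → ℤ) : Plane :=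
  pt v fun i => u i (a i)

theorem node_eq_iff (hv : 0 < dblArea v) {a : Fin 3 → ℤ} {x : Plane} :
    node v u a = x ↔ ∃ t, ∀ i, coord v i x + t = u i (a i) := pt_eq_iff hv

theorem coord_node (hv : 0 < dblArea v) (a : Fin 3 → ℤ) (i : Fin 3) :
    coord v i (node v u a) = u i (a i) - (∑ j, u j (a j)) / 3 := coord_pt hv i _

theorem node_add_shift (hv : 0 < dblArea v) (h : IsGrid v u) (a : Fin 3 → ℤ) (m : Lat) :
    node v u (a + shift v m) = node v u a + toPlane m := by
  obtain ⟨t, ht⟩ := (node_eq_iff hv).1 (rfl : node v u a = _)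
  refine (node_eq_iff hv).2 ⟨t, fun i => ?_⟩
  rw [map_add, coord_toPlane, Pi.add_apply, h.add_shift, ← ht]
  simp [shift]
  ring

/-- The open hexagonal face, the projection of a box of the grid. -/
def hexFace (v : Fin 3 → Lat) (u : Fin 3 → ℤ → ℝ) (c : Fin 3 → ℤ) : Set Plane :=
  {x | ∃ t : ℝ, ∀ i, u i (c i) < coord v i x + t ∧ coord v i x + t < u i (c i + 1)}

/-- The point `x`, moved by `t` in the direction of projection, is on the edge of the grid from `a`
in direction `i`. -/
def OnEdge (v : Fin 3 → Lat) (u : Fin 3 → ℤ → ℝ) (a : Fin 3 → ℤ) (i : Fin 3) (x : Plane)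
    (t : ℝ) : Prop :=
  (∀ j ≠ i, coord v j x + t = u j (a j)) ∧ u i (a i) ≤ coord v i x + t ∧
    coord v i x + t ≤ u i (a i + 1)

/-! ### Shadows of nodes, edges and boxes, compared along the fibres of the projection -/

theorem le_of_time_le (hm : ∀ i, StrictMono (u i)) {x : Plane} {t t' : ℝ} (ht : t ≤ t') {i : Fin 3}
    {a a' : ℤ} (h : u i a ≤ coord v i x + t) (h' : coord v i x + t' < u i (a' + 1)) : a ≤ a' :=
  Int.lt_add_one_iff.1 ((hm i).lt_iff_lt.1 (by linarith))

theorem lt_of_time_lt (hm : ∀ i, StrictMono (u i)) {x : Plane} {t t' : ℝ} (ht : t < t') {i : Fin 3}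
    {a a' : ℤ} (h : u i a ≤ coord v i x + t) (h' : coord v i x + t' ≤ u i a') : a < a' :=
  (hm i).lt_iff_lt.1 (by linarith)

/-- If two nodes lie over one point at different times, all three indices increase strictly from the
earlier to the later one, and the index sums differ by at least 3. -/
theorem node_injOn (hv : 0 < dblArea v) (hm : ∀ i, StrictMono (u i)) {a a' : Fin 3 → ℤ}
    (hs : |∑ i, a i - ∑ i, a' i| < 3) (h : node v u a = node v u a') : a = a' := by
  obtain ⟨t, ht⟩ := (node_eq_iff hv).1 h
  obtain ⟨t', ht'⟩ := (node_eq_iff hv).1 (rfl : node v u a' = _)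
  rw [abs_lt, Fin.sum_univ_three, Fin.sum_univ_three] at hs
  rcases lt_trichotomy t t' with h1 | h1 | h1
  · have := fun i => lt_of_time_lt hm h1 (ht i).ge (ht' i).le
    have h0 := this 0; have h2 := this 1; have h3 := this 2
    omega
  · subst h1
    exact funext fun i => (hm i).injective (by rw [← ht, ← ht'])
  · have := fun i => lt_of_time_lt hm h1 (ht' i).ge (ht i).le
    have h0 := this 0; have h2 := this 1; have h3 := this 2
    omega

/-- Of two boxes met by one fibre, the later one has indices at least as large; equal sums then
force equality. -/
theorem hexFace_eq_of_inter (hm : ∀ i, StrictMono (u i)) {c c' : Fin 3 → ℤ}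
    (hs : ∑ i, c i = ∑ i, c' i) (h : (hexFace v u c ∩ hexFace v u c').Nonempty) : c = c' := by
  obtain ⟨x, ⟨t, ht⟩, ⟨t', ht'⟩⟩ := h
  rcases le_total t t' with h1 | h1
  · exact eq_of_le_of_sum_eq (fun i => le_of_time_le hm h1 (ht i).1.le (ht' i).2) hs
  · exact (eq_of_le_of_sum_eq (fun i => le_of_time_le hm h1 (ht' i).1.le (ht i).2) hs.symm).symm

/-- A box met before the edge has index sum at most that of a minus 2, and a box met at the same
time or later has at least the sum of a. The sum −1 falls in the gap. -/
theorem hexFace_disjoint_edge (hm : ∀ i, StrictMono (u i)) {a c : Fin 3 → ℤ} {i : Fin 3}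
    (ha : ∑ i, a i = 0) (hc : ∑ i, c i = -1) {x : Plane} {t : ℝ} (he : OnEdge v u a i x t) :
    x ∉ hexFace v u c := by
  rintro ⟨t', ht'⟩
  rcases lt_or_ge t' t with h1 | h1
  · have := sum_add_two_le (c := c) (a := a) (i := i)
      (fun j hj => lt_of_time_lt hm h1 (ht' j).1.le (he.1 j hj).le)
      (Int.lt_add_one_iff.1 (lt_of_time_lt hm h1 (ht' i).1.le he.2.2))
    omega
  · have h2 : ∀ j, a j ≤ c j := by
      intro j
      by_cases hj : j = i
      · subst hj
        exact le_of_time_le hm h1 he.2.1 (ht' j).2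
      · exact le_of_time_le hm h1 (he.1 j hj).ge (ht' j).2
    have := Finset.sum_le_sum fun j (_ : j ∈ Finset.univ) => h2 j
    omega

theorem exists_time_lineMap (hv : 0 < dblArea v) (u : Fin 3 → ℤ → ℝ) (a : Fin 3 → ℤ) (i : Fin 3)
    (s : ℝ) : ∃ t, (∀ j ≠ i, coord v j (AffineMap.lineMap (node v u a)
        (node v u (a + Pi.single i 1)) s) + t = u j (a j)) ∧
      coord v i (AffineMap.lineMap (node v u a) (node v u (a + Pi.single i 1)) s) + t =
        u i (a i) + s * (u i (a i + 1) - u i (a i)) := by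
  have h : AffineMap.lineMap (node v u a) (node v u (a + Pi.single i 1)) s =
      pt v (AffineMap.lineMap (fun j => u j (a j)) (fun j => u j ((a + (Pi.single i 1 : Fin 3 → ℤ)) j)) s) := by
    simp [node, AffineMap.lineMap_apply]
  obtain ⟨t, ht⟩ := (pt_eq_iff hv).1 h.symm
  refine ⟨t, fun j hj => ?_, ?_⟩
  · rw [ht]; simp [AffineMap.lineMap_apply, hj]
  · rw [ht]; simp [AffineMap.lineMap_apply]; ring

theorem lineMap_eq_of_time (hv : 0 < dblArea v) {a : Fin 3 → ℤ} {i : Fin 3}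
    {s t : ℝ} {x : Plane} (h : ∀ j ≠ i, coord v j x + t = u j (a j))
    (hi : coord v i x + t = u i (a i) + s * (u i (a i + 1) - u i (a i))) :
    AffineMap.lineMap (node v u a) (node v u (a + Pi.single i 1)) s = x := by
  have h' : AffineMap.lineMap (node v u a) (node v u (a + Pi.single i 1)) s =
      pt v (AffineMap.lineMap (fun j => u j (a j)) (fun j => u j ((a + (Pi.single i 1 : Fin 3 → ℤ)) j)) s) := by
    simp [node, AffineMap.lineMap_apply]
  rw [h', pt_eq_iff hv]
  refine ⟨t, fun j => ?_⟩
  by_cases hj : j = i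
  · subst hj; rw [hi]; simp [AffineMap.lineMap_apply]; ring
  · rw [h j hj]; simp [AffineMap.lineMap_apply, hj]

theorem exists_lineMap_iff (hv : 0 < dblArea v) (hm : ∀ i, StrictMono (u i)) {a : Fin 3 → ℤ}
    {i : Fin 3} {x : Plane} :
    (∃ s ∈ Set.Icc (0 : ℝ) 1,
      AffineMap.lineMap (node v u a) (node v u (a + Pi.single i 1)) s = x) ↔
      ∃ t, OnEdge v u a i x t := by
  have hw : 0 < u i (a i + 1) - u i (a i) := sub_pos.2 (hm i (lt_add_one _))
  constructor
  · rintro ⟨s, hs, rfl⟩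
    obtain ⟨t, h, hi⟩ := exists_time_lineMap hv u a i s
    refine ⟨t, h, ?_, ?_⟩ <;> rw [hi] <;> nlinarith [hs.1, hs.2]
  · rintro ⟨t, h, h1, h2⟩
    refine ⟨(coord v i x + t - u i (a i)) / (u i (a i + 1) - u i (a i)),
      ⟨div_nonneg (by linarith) hw.le, (div_le_one hw).2 (by linarith)⟩,
      lineMap_eq_of_time hv h ?_⟩
    rw [div_mul_cancel₀ _ hw.ne']
    ring

/-- At an interior point of an edge, rounding the coordinates down returns the starting node. The
comparison used for boxes then shows that the starting nodes agree. -/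
theorem edge_interior_inj (hv : 0 < dblArea v) (hm : ∀ i, StrictMono (u i)) {a a' : Fin 3 → ℤ}
    (hs : ∑ i, a i = ∑ i, a' i) {i i' : Fin 3} {s s' : ℝ} (h : s ∈ Set.Ioo (0 : ℝ) 1)
    (h' : s' ∈ Set.Ioo (0 : ℝ) 1)
    (he : AffineMap.lineMap (node v u a) (node v u (a + Pi.single i 1)) s =
      (AffineMap.lineMap (node v u a') (node v u (a' + Pi.single i' 1)) s' : Plane)) :
    a = a' ∧ i = i' ∧ s = s' := by
  obtain ⟨t, h1, h2⟩ := exists_time_lineMap hv u a i s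
  obtain ⟨t', h1', h2'⟩ := exists_time_lineMap hv u a' i' s'
  rw [he] at h1 h2
  generalize (AffineMap.lineMap (node v u a') (node v u (a' + Pi.single i' 1)) s' : Plane) = x at *
  have hw : ∀ i b, 0 < u i (b + 1) - u i b := fun i b => sub_pos.2 (hm i (lt_add_one _))
  have hlo : ∀ {a : Fin 3 → ℤ} {i : Fin 3} {s t : ℝ}, s ∈ Set.Ioo (0 : ℝ) 1 →
      (∀ j ≠ i, coord v j x + t = u j (a j)) →
      coord v i x + t = u i (a i) + s * (u i (a i + 1) - u i (a i)) →
      ∀ j, u j (a j) ≤ coord v j x + t ∧ coord v j x + t < u j (a j + 1) := by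
    intro a i s t h h1 h2 j
    by_cases hj : j = i
    · subst hj
      rw [h2]
      constructor <;> nlinarith [h.1, h.2, hw j (a j)]
    · rw [h1 j hj]
      exact ⟨le_rfl, by linarith [hw j (a j)]⟩
  have ha : a = a' := by
    rcases le_total t t' with ht | ht
    · exact eq_of_le_of_sum_eq (fun j => le_of_time_le hm ht (hlo h h1 h2 j).1
        (hlo h' h1' h2' j).2) hs
    · exact (eq_of_le_of_sum_eq (fun j => le_of_time_le hm ht (hlo h' h1' h2' j).1
        (hlo h h1 h2 j).2) hs.symm).symm
  subst ha
  -- Both edges are constant in a third direction k, which equates the two times.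
  obtain ⟨k, hk, hk'⟩ : ∃ k, k ≠ i ∧ k ≠ i' := by
    clear * -
    revert i i'
    decide
  have ht : t = t' := by linarith [h1 k hk, h1' k hk']
  subst ht
  have hi : i = i' := by
    by_contra hne
    have := h1' i hne
    rw [h2] at this
    nlinarith [hw i (a i), h.1]
  subst hi
  refine ⟨rfl, rfl, ?_⟩
  rw [h2] at h2'
  exact mul_right_cancel₀ (hw i (a i)).ne' (by linarith)

/-- A node met later than the edge point exceeds a in all three indices, too much for the allowed
sums. One met no later is at most a entrywise, hence equal to a, and then the parameter would be
zero. -/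
theorem edge_interior_ne_node (hv : 0 < dblArea v) (hm : ∀ i, StrictMono (u i)) {a b : Fin 3 → ℤ}
    (hs : ∑ i, b i = ∑ i, a i ∨ ∑ i, b i = ∑ i, a i + 1) {i : Fin 3} {s : ℝ}
    (h : s ∈ Set.Ioo (0 : ℝ) 1) :
    AffineMap.lineMap (node v u a) (node v u (a + Pi.single i 1)) s ≠ node v u b := by
  intro he
  obtain ⟨t, h1, h2⟩ := exists_time_lineMap hv u a i s
  obtain ⟨t', ht'⟩ := (node_eq_iff hv).1 he.symm
  generalize (AffineMap.lineMap (node v u a) (node v u (a + Pi.single i 1)) s : Plane) = x at *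
  have hw : 0 < u i (a i + 1) - u i (a i) := sub_pos.2 (hm i (lt_add_one _))
  have hlo : ∀ j, u j (a j) ≤ coord v j x + t ∧ coord v j x + t < u j (a j + 1) := by
    intro j
    by_cases hj : j = i
    · subst hj
      rw [h2]
      constructor <;> nlinarith [h.1, h.2]
    · rw [h1 j hj]
      exact ⟨le_rfl, hm j (lt_add_one _)⟩
  rcases lt_or_ge t t' with ht | ht
  · have := fun j => lt_of_time_lt hm ht (hlo j).1 (ht' j).le
    have h0 := this 0; have h3 := this 1; have h4 := this 2
    simp only [Fin.sum_univ_three] at hs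
    omega
  · have hle : ∀ j, b j ≤ a j := fun j => le_of_time_le hm ht (ht' j).ge (hlo j).2
    have hsum := Finset.sum_le_sum fun j (_ : j ∈ Finset.univ) => hle j
    have hba : b = a := eq_of_le_of_sum_eq hle (by omega)
    subst hba
    obtain ⟨k, hk⟩ : ∃ k, k ≠ i := exists_ne i
    have := h1 k hk
    have h5 := ht' k
    have h6 := ht' i
    have : t = t' := by linarith
    subst this
    nlinarith [h.1]

/-! ### The faces cover the complement of the edges -/

theorem exists_floor (h : IsGrid v u) (hv : 0 < dblArea v) (i : Fin 3) (s : ℝ) :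
    ∃ a, u i a ≤ s ∧ s < u i (a + 1) := by
  have hk : (0 : ℝ) < mult v i := by exact_mod_cast mult_pos hv i
  have hlow : ∃ n : ℤ, u i (n * mult v i) ≤ s := by
    obtain ⟨n, hn⟩ := exists_int_lt ((s - u i 0) / mult v i)
    refine ⟨n, ?_⟩
    have := h.periodic_mul i 0 n
    rw [zero_add] at this
    rw [lt_div_iff₀ hk] at hn
    rw [this]
    linarith
  have hup : ∃ n : ℤ, s < u i (n * mult v i) := by
    obtain ⟨n, hn⟩ := exists_int_gt ((s - u i 0) / mult v i)
    refine ⟨n, ?_⟩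
    have := h.periodic_mul i 0 n
    rw [zero_add] at this
    rw [div_lt_iff₀ hk] at hn
    rw [this]
    linarith
  obtain ⟨p, hp⟩ := hlow
  obtain ⟨q, hq⟩ := hup
  obtain ⟨a, ha, hmax⟩ := Int.exists_greatest_of_bdd (P := fun a => u i a ≤ s)
    ⟨q * mult v i, fun z hz => ((h.mono i).lt_iff_lt.1 (hz.trans_lt hq)).le⟩ ⟨_, hp⟩
  refine ⟨a, ha, ?_⟩
  by_contra hcon
  have := hmax (a + 1) (not_lt.1 hcon)
  omega

theorem exists_ceil (h : IsGrid v u) (hv : 0 < dblArea v) (i : Fin 3) (s : ℝ) :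
    ∃ a, u i a < s ∧ s ≤ u i (a + 1) := by
  obtain ⟨a, h1, h2⟩ := exists_floor h hv i s
  rcases h1.lt_or_eq with h3 | h3
  · exact ⟨a, h3, h2.le⟩
  · refine ⟨a - 1, ?_, ?_⟩
    · rw [← h3]; exact h.mono i (by omega)
    · rw [sub_add_cancel]; exact h3.ge

theorem exists_pos_le {f : Fin 3 → ℝ} (hf : ∀ i, 0 < f i) : ∃ δ > 0, ∀ i, δ ≤ f i := by
  refine ⟨min (f 0) (min (f 1) (f 2)), by simp [hf], fun i => ?_⟩
  fin_cases i <;> simp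

theorem exists_le_sum_eq {n : Fin 3 → ℤ} {s : ℤ} (h : s ≤ ∑ i, n i) :
    ∃ a : Fin 3 → ℤ, (∀ i, a i ≤ n i) ∧ ∑ i, a i = s := by
  refine ⟨n + Pi.single 0 (s - ∑ i, n i), fun i => ?_, ?_⟩
  · by_cases hi : i = 0
    · subst hi; simpa using h
    · simp [hi]
  · rw [sum_add_single]; ring

/-- Move the lift of x along (1,1,1) to the first time at which it dominates a node of index sum 0.
There it has reached the staircase formed by these nodes: either it has just left an open box of
index sum −1, or it lies on an edge. -/
theorem mem_hexFace_or_onEdge (h : IsGrid v u) (hv : 0 < dblArea v) (x : Plane) :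
    (∃ c, ∑ i, c i = -1 ∧ x ∈ hexFace v u c) ∨
      ∃ a i t, ∑ i, a i = 0 ∧ OnEdge v u a i x t := by
  set T : Set ℝ := {t | ∃ a : Fin 3 → ℤ, ∑ i, a i = 0 ∧ ∀ i, u i (a i) ≤ coord v i x + t}
  have hTne : T.Nonempty := by
    refine ⟨∑ i, |coord v i x - u i 0|, 0, by simp, fun i => ?_⟩
    have h1 := Finset.single_le_sum (f := fun i => |coord v i x - u i 0|)
      (fun _ _ => abs_nonneg _) (Finset.mem_univ i)
    have h2 := neg_abs_le (coord v i x - u i 0)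
    simp only [Pi.zero_apply] at h1 ⊢
    linarith
  have hTbdd : BddBelow T := by
    refine ⟨-∑ i, |coord v i x - u i 0|, ?_⟩
    rintro t ⟨a, ha, hat⟩
    obtain ⟨i, hi⟩ : ∃ i, 0 ≤ a i := by
      by_contra hcon
      push Not at hcon
      have h0 := hcon 0; have h1 := hcon 1; have h2 := hcon 2
      rw [Fin.sum_univ_three] at ha
      omega
    have h1 := Finset.single_le_sum (f := fun i => |coord v i x - u i 0|)
      (fun _ _ => abs_nonneg _) (Finset.mem_univ i)
    have h2 := le_abs_self (coord v i x - u i 0)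
    have h3 := (h.mono i).monotone hi
    have h4 := hat i
    linarith
  set t := sInf T
  -- At time t, `n` rounds the coordinates down and `m` rounds them strictly down. They differ, by
  -- one, exactly where a coordinate is a grid value. The times just after t give a sum of `n` that
  -- is at least 0, and those just before give a sum of `m` that is at most −1.
  choose n hn1 hn2 using fun i => exists_floor h hv i (coord v i x + t)
  choose m hm1 hm2 using fun i => exists_ceil h hv i (coord v i x + t)
  have hn : 0 ≤ ∑ i, n i := by
    obtain ⟨δ, hδ, hδn⟩ := exists_pos_le (f := fun i => u i (n i + 1) - (coord v i x + t))
      fun i => sub_pos.2 (hn2 i)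
    obtain ⟨t', ⟨a, ha, hat⟩, ht'⟩ := exists_lt_of_csInf_lt hTne (lt_add_of_pos_right t hδ)
    rw [← ha]
    refine Finset.sum_le_sum fun i _ => ?_
    have := hδn i
    exact Int.lt_add_one_iff.1 ((h.mono i).lt_iff_lt.1 (by linarith [hat i]))
  have hm : ∑ i, m i ≤ -1 := by
    by_contra hcon
    obtain ⟨a, ham, ha⟩ := exists_le_sum_eq (n := m) (s := 0) (by omega)
    obtain ⟨δ, hδ, hδm⟩ := exists_pos_le (f := fun i => coord v i x + t - u i (m i))
      fun i => sub_pos.2 (hm1 i)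
    have hmem : t - δ ∈ T := ⟨a, ha, fun i => by
      have h1 := hδm i
      have h2 := (h.mono i).monotone (ham i)
      linarith⟩
    have := csInf_le hTbdd hmem
    change t ≤ t - δ at this
    linarith
  have hjump : ∀ i, (n i = m i) ∨ (n i = m i + 1 ∧ coord v i x + t = u i (n i)) := by
    intro i
    have h1 : m i < n i + 1 := (h.mono i).lt_iff_lt.1 ((hm1 i).trans (hn2 i))
    have h2 : n i ≤ m i + 1 := (h.mono i).le_iff_le.1 ((hn1 i).trans (hm2 i))
    rcases eq_or_ne (n i) (m i) with h3 | h3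
    · exact Or.inl h3
    · have h4 : n i = m i + 1 := by omega
      exact Or.inr ⟨h4, le_antisymm (h4 ▸ hm2 i) (hn1 i)⟩
  -- If `m` has sum −1, then slightly earlier the lift is in the open box `m`. Otherwise the sums
  -- differ by at least 2, so at least two coordinates are grid values.
  rcases hm.lt_or_eq with hlt | heq
  · right
    by_cases hn0 : ∑ i, n i = 0
    · have : ∃ i, ∀ j ≠ i, coord v j x + t = u j (n j) := by
        simp only [Fin.sum_univ_three] at hlt hn0
        by_contra! hcon
        obtain ⟨j, -, hj⟩ := hcon 0
        obtain ⟨k, hkj, hk⟩ := hcon j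
        have hj' := (hjump j).resolve_right fun hh => hj hh.2
        have hk' := (hjump k).resolve_right fun hh => hk hh.2
        have h0 := (hjump 0).imp id And.left
        have h1 := (hjump 1).imp id And.left
        have h2 := (hjump 2).imp id And.left
        fin_cases j <;> fin_cases k <;> simp at hkj hj' hk' <;> omega
      obtain ⟨i, hi⟩ := this
      exact ⟨n, i, t, hn0, hi, hn1 i, (hn2 i).le⟩
    · have hall : ∀ i, n i = m i + 1 ∧ coord v i x + t = u i (n i) := by
        have h0 := (hjump 0).imp id And.left
        have h1 := (hjump 1).imp id And.left
        have h2 := (hjump 2).imp id And.left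
        simp only [Fin.sum_univ_three] at hlt hn0 hn
        intro i
        refine (hjump i).resolve_left fun hi => ?_
        fin_cases i <;> simp at hi <;> omega
      -- All three coordinates are grid values: the lift is a node of index sum 1, the black end of
      -- an edge. Direction 0 is an arbitrary choice.
      by_cases hn1' : ∑ i, n i = 1
      · refine ⟨n + Pi.single 0 (-1), 0, t, by rw [sum_add_single]; omega, ?_, ?_, ?_⟩
        · intro j hj
          rw [(hall j).2]
          simp [hj]
        · rw [(hall 0).2]
          exact (h.mono 0).monotone (by simp)
        · rw [(hall 0).2]
          exact (h.mono 0).monotone (by simp)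
      · have h0 := (hall 0).1
        have h1 := (hall 1).1
        have h2 := (hall 2).1
        simp only [Fin.sum_univ_three] at hlt hn0 hn hn1'
        omega
  · left
    obtain ⟨δ, hδ, hδm⟩ := exists_pos_le (f := fun i => coord v i x + t - u i (m i))
      fun i => sub_pos.2 (hm1 i)
    refine ⟨m, heq, t - δ / 2, fun i => ?_⟩
    have h1 := hδm i
    have h2 := hm2 i
    constructor <;> linarith

end

section

/-! ### The hexagonal graph of a grid -/

/-- The hexagonal graph on the torus obtained by projecting a grid. -/
def tilingGraph (v : Fin 3 → Lat) (u : Fin 3 → ℤ → ℝ) : BicoloredGraph where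
  white := {p | ∃ a, ∑ i, a i = 0 ∧ p = proj (node v u a)}
  black := {p | ∃ b, ∑ i, b i = 1 ∧ p = proj (node v u b)}
  edges := {e | ∃ a i, ∑ j, a j = 0 ∧
    e = BicoloredGraph.segmentPath (node v u a) (node v u (a + Pi.single i 1))}

variable {v : Fin 3 → Lat} {u : Fin 3 → ℤ → ℝ}

theorem sum_add_shift (a : Fin 3 → ℤ) (m : Lat) : ∑ i, (a + shift v m) i = ∑ i, a i := by
  simp [Finset.sum_add_distrib, sum_shift]

theorem shift_injective (hv : 0 < dblArea v) : Function.Injective (shift v) := by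
  intro m m' h
  refine toPlane_injective (plane_ext hv fun i => ?_)
  rw [coord_toPlane, coord_toPlane]
  exact congrArg _ (congrFun h i)

theorem OnEdge.add_shift (h : IsGrid v u) {a : Fin 3 → ℤ} {i : Fin 3} {x : Plane} {t : ℝ}
    (he : OnEdge v u a i x t) (m : Lat) :
    OnEdge v u (a + shift v m) i (x + toPlane m) t := by
  have hc : ∀ j, coord v j (x + toPlane m) + t = coord v j x + t + shift v m j := fun j => by
    rw [map_add, coord_toPlane]; simp [shift]; ring
  refine ⟨fun j hj => ?_, ?_, ?_⟩
  · rw [hc, he.1 j hj, Pi.add_apply, h.add_shift]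
  · rw [hc, Pi.add_apply, h.add_shift]
    linarith [he.2.1]
  · rw [hc, Pi.add_apply, add_right_comm (a i), h.add_shift]
    linarith [he.2.2]

theorem mem_hexFace_add_shift (h : IsGrid v u) {c : Fin 3 → ℤ} {x : Plane} (m : Lat) :
    x + toPlane m ∈ hexFace v u (c + shift v m) ↔ x ∈ hexFace v u c := by
  have hc : ∀ t j, coord v j (x + toPlane m) + t = coord v j x + t + shift v m j := fun t j => by
    rw [map_add, coord_toPlane]; simp [shift]; ring
  refine exists_congr fun t => forall_congr' fun i => ?_
  rw [hc, Pi.add_apply, h.add_shift, add_right_comm (c i), h.add_shift, add_lt_add_iff_right,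
    add_lt_add_iff_right]

theorem hexFace_add_shift (h : IsGrid v u) (c : Fin 3 → ℤ) (m : Lat) :
    hexFace v u (c + shift v m) = (fun x => x + toPlane m) '' hexFace v u c := by
  ext x
  constructor
  · intro hx
    refine ⟨x - toPlane m, ?_, sub_add_cancel _ _⟩
    rwa [← mem_hexFace_add_shift h m, sub_add_cancel]
  · rintro ⟨y, hy, rfl⟩
    exact (mem_hexFace_add_shift h m).2 hy

theorem hexFace_eq_image (hv : 0 < dblArea v) (c : Fin 3 → ℤ) :
    hexFace v u c = pt v '' Set.univ.pi fun i => Set.Ioo (u i (c i)) (u i (c i + 1)) := by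
  ext x
  constructor
  · rintro ⟨t, ht⟩
    exact ⟨fun i => coord v i x + t, fun i _ => ht i, pt_coord_add hv x t⟩
  · rintro ⟨y, hy, hx⟩
    obtain ⟨t, ht⟩ := (pt_eq_iff hv).1 hx
    exact ⟨t, fun i => by rw [ht]; exact hy i trivial⟩

theorem isOpen_hexFace (c : Fin 3 → ℤ) : IsOpen (hexFace v u c) := by
  have : hexFace v u c = ⋃ t : ℝ, ⋂ i,
      {x | u i (c i) < coord v i x + t ∧ coord v i x + t < u i (c i + 1)} := by
    ext x; simp [hexFace]
  rw [this]
  refine isOpen_iUnion fun t => isOpen_iInter_of_finite fun i => ?_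
  have hc := (continuous_coord (v := v) i).add_const t
  exact (isOpen_lt continuous_const hc).inter (isOpen_lt hc continuous_const)

theorem convex_hexFace (hv : 0 < dblArea v) (c : Fin 3 → ℤ) : Convex ℝ (hexFace v u c) := by
  rw [hexFace_eq_image hv]
  exact (convex_pi fun i _ => convex_Ioo _ _).is_linear_image (pt v).isLinear

theorem hexFace_nonempty (hv : 0 < dblArea v) (hm : ∀ i, StrictMono (u i)) (c : Fin 3 → ℤ) :
    (hexFace v u c).Nonempty := by
  rw [hexFace_eq_image hv]
  exact (Set.univ_pi_nonempty_iff.2 fun i => Set.nonempty_Ioo.2 (hm i (lt_add_one _))).image _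

/-- By the adjugate of the matrix of the sides 0 and 1, every multiple of `dblArea v` can be
subtracted from the entries 0 and 1. Hence there are finitely many nodes of given index sum modulo
translation. -/
theorem exists_shift_mem_Ico (hv : 0 < dblArea v) (a : Fin 3 → ℤ) :
    ∃ m, (a + shift v m) 0 ∈ Set.Ico 0 (dblArea v) ∧ (a + shift v m) 1 ∈ Set.Ico 0 (dblArea v) := by
  refine ⟨![-(side v 1 1) * (a 0 / dblArea v) + side v 0 1 * (a 1 / dblArea v),
    side v 1 0 * (a 0 / dblArea v) - side v 0 0 * (a 1 / dblArea v)], ?_⟩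
  have h0 := Int.emod_nonneg (a 0) hv.ne'
  have h0' := Int.emod_lt_of_pos (a 0) hv
  have h1 := Int.emod_nonneg (a 1) hv.ne'
  have h1' := Int.emod_lt_of_pos (a 1) hv
  rw [Int.emod_def] at h0 h0' h1 h1'
  have hD : dblArea v = side v 0 0 * side v 1 1 - side v 0 1 * side v 1 0 := by
    simp [dblArea, side]; ring
  constructor
  · rw [show (a + shift v _) 0 = a 0 - dblArea v * (a 0 / dblArea v) by
      simp [shift, pairing]; linear_combination (a 0 / dblArea v) * hD]
    exact ⟨h0, h0'⟩
  · rw [show (a + shift v _) 1 = a 1 - dblArea v * (a 1 / dblArea v) by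
      simp [shift, pairing]; linear_combination (a 1 / dblArea v) * hD]
    exact ⟨h1, h1'⟩

theorem finite_reduced (D s : ℤ) :
    {a : Fin 3 → ℤ | ∑ i, a i = s ∧ a 0 ∈ Set.Ico 0 D ∧ a 1 ∈ Set.Ico 0 D}.Finite := by
  refine (((Set.finite_Ico 0 D).prod (Set.finite_Ico 0 D)).image
    fun p : ℤ × ℤ => (![p.1, p.2, s - p.1 - p.2] : Fin 3 → ℤ)).subset ?_
  rintro a ⟨hs, h0, h1⟩
  refine ⟨(a 0, a 1), ⟨h0, h1⟩, ?_⟩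
  rw [Fin.sum_univ_three] at hs
  ext i
  fin_cases i
  · rfl
  · rfl
  · simp; omega

theorem finite_nodes (hv : 0 < dblArea v) (h : IsGrid v u) (s : ℤ) :
    {p | ∃ a, ∑ i, a i = s ∧ p = proj (node v u a)}.Finite := by
  refine ((finite_reduced (dblArea v) s).image fun a => proj (node v u a)).subset ?_
  rintro p ⟨a, ha, rfl⟩
  obtain ⟨m, hm⟩ := exists_shift_mem_Ico hv a
  exact ⟨_, ⟨(sum_add_shift a m).trans ha, hm⟩, by
    simp only [node_add_shift hv h, proj_add_toPlane]⟩

theorem segmentPath_add_shift (hv : 0 < dblArea v) (h : IsGrid v u) (a : Fin 3 → ℤ) (i : Fin 3)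
    (m : Lat) :
    BicoloredGraph.segmentPath (node v u (a + shift v m))
      (node v u (a + shift v m + Pi.single i 1)) =
    BicoloredGraph.segmentPath (node v u a) (node v u (a + Pi.single i 1)) := by
  rw [eq_comm, segmentPath_eq_iff]
  exact ⟨m, node_add_shift hv h a m, by rw [add_right_comm, node_add_shift hv h]⟩

theorem finite_edges (hv : 0 < dblArea v) (h : IsGrid v u) : (tilingGraph v u).edges.Finite := by
  refine (((finite_reduced (dblArea v) 0).prod (Set.finite_univ (α := Fin 3))).image fun p =>
    BicoloredGraph.segmentPath (node v u p.1) (node v u (p.1 + Pi.single p.2 1))).subset ?_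
  rintro e ⟨a, i, ha, rfl⟩
  obtain ⟨m, hm⟩ := exists_shift_mem_Ico hv a
  exact ⟨(_, i), ⟨⟨(sum_add_shift a m).trans ha, hm⟩, trivial⟩, segmentPath_add_shift hv h a i m⟩

/-! ### The graph and its faces on the torus -/

theorem proj_node_eq_iff (hv : 0 < dblArea v) (h : IsGrid v u) {a a' : Fin 3 → ℤ}
    (hs : |∑ i, a i - ∑ i, a' i| < 3) :
    proj (node v u a) = proj (node v u a') ↔ ∃ m, a' = a + shift v m := by
  rw [proj_eq_proj_iff]
  refine exists_congr fun m => ?_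
  rw [← node_add_shift hv h]
  refine ⟨fun he => node_injOn hv h.mono ?_ he, fun he => by rw [he]⟩
  rw [sum_add_shift, abs_sub_comm]
  exact hs

theorem lineMap_add_toPlane (w b : Plane) (m : Lat) (s : ℝ) :
    (AffineMap.lineMap w b s : Plane) + toPlane m =
      AffineMap.lineMap (w + toPlane m) (b + toPlane m) s := by
  ext i
  simp [AffineMap.lineMap_apply]
  ring

theorem isGraph_tilingGraph (hv : 0 < dblArea v) (h : IsGrid v u) :
    (tilingGraph v u).IsGraph where
  finite_white := finite_nodes hv h 0
  finite_black := finite_nodes hv h 1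
  finite_edges := finite_edges hv h
  disjoint := by
    rw [Set.disjoint_left]
    rintro p ⟨a, ha, rfl⟩ ⟨b, hb, hab⟩
    obtain ⟨m, rfl⟩ := (proj_node_eq_iff hv h (by rw [ha, hb]; decide)).1 hab
    rw [sum_add_shift] at hb
    omega
  start_mem := by
    rintro e ⟨a, i, ha, rfl⟩
    exact ⟨a, ha, by simp [segmentPath_apply]⟩
  end_mem := by
    rintro e ⟨a, i, ha, rfl⟩
    exact ⟨a + Pi.single i 1, by rw [sum_add_single, ha, zero_add], by simp [segmentPath_apply]⟩
  interior_notMem := by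
    rintro e ⟨a, i, ha, rfl⟩ t ht
    rintro (⟨b, hb, hab⟩ | ⟨b, hb, hab⟩) <;>
    · rw [segmentPath_apply, eq_comm, proj_eq_proj_iff] at hab
      obtain ⟨m, hm⟩ := hab
      rw [← node_add_shift hv h] at hm
      refine edge_interior_ne_node hv h.mono ?_ ht hm
      rw [sum_add_shift]
      omega
  interior_inj := by
    rintro e ⟨a, i, ha, rfl⟩ e' ⟨a', i', ha', rfl⟩ t ht t' ht' he
    rw [segmentPath_apply, segmentPath_apply, proj_eq_proj_iff] at he
    obtain ⟨m, hm⟩ := he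
    rw [lineMap_add_toPlane, ← node_add_shift hv h, ← node_add_shift hv h, add_right_comm] at hm
    obtain ⟨h1, h2, h3⟩ := edge_interior_inj hv h.mono (by rw [sum_add_shift, ha, ha']) ht' ht hm
    subst h1 h2
    exact ⟨(segmentPath_add_shift hv h _ _ _).symm, Subtype.ext h3.symm⟩

theorem preimage_support (hv : 0 < dblArea v) (h : IsGrid v u) :
    proj ⁻¹' (tilingGraph v u).support = {x | ∃ a i t, ∑ j, a j = 0 ∧ OnEdge v u a i x t} := by
  ext x
  simp only [BicoloredGraph.support, Set.mem_preimage, Set.mem_iUnion₂, Set.mem_range]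
  constructor
  · rintro ⟨e, ⟨a, i, ha, rfl⟩, s, hs⟩
    rw [segmentPath_apply, proj_eq_proj_iff] at hs
    obtain ⟨m, rfl⟩ := hs
    obtain ⟨t, ht⟩ := (exists_lineMap_iff hv h.mono).1 ⟨_, s.2, rfl⟩
    exact ⟨a + shift v m, i, t, by rw [sum_add_shift, ha], ht.add_shift h m⟩
  · rintro ⟨a, i, t, ha, ht⟩
    obtain ⟨s, hs, rfl⟩ := (exists_lineMap_iff hv h.mono).2 ⟨t, ht⟩
    exact ⟨_, ⟨a, i, ha, rfl⟩, ⟨s, hs⟩, rfl⟩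

theorem compl_preimage_support (hv : 0 < dblArea v) (h : IsGrid v u) :
    (proj ⁻¹' (tilingGraph v u).support)ᶜ =
      ⋃ c : {c : Fin 3 → ℤ // ∑ i, c i = -1}, hexFace v u c.1 := by
  ext x
  rw [preimage_support hv h, Set.mem_iUnion]
  constructor
  · intro hx
    obtain ⟨c, hc, hxc⟩ | hcon := mem_hexFace_or_onEdge h hv x
    · exact ⟨⟨c, hc⟩, hxc⟩
    · exact absurd hcon hx
  · rintro ⟨⟨c, hc⟩, hxc⟩ ⟨a, i, t, ha, he⟩
    exact hexFace_disjoint_edge h.mono ha hc he hxc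

theorem planeFaces_tilingGraph (hv : 0 < dblArea v) (h : IsGrid v u) :
    (tilingGraph v u).planeFaces =
      Set.range fun c : {c : Fin 3 → ℤ // ∑ i, c i = -1} => hexFace v u c.1 :=
  setOf_connectedComponentIn_eq_range (compl_preimage_support hv h) (fun c => isOpen_hexFace _)
    (fun c => (convex_hexFace hv _).isPreconnected)
    (fun c c' hcc => by rw [hexFace_eq_of_inter h.mono (c.2.trans c'.2.symm) hcc])
    (fun c => hexFace_nonempty hv h.mono _)

/-- The faces on the torus. -/
def torusFace (v : Fin 3 → Lat) (u : Fin 3 → ℤ → ℝ) (c : Fin 3 → ℤ) : Set Torus :=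
  proj '' hexFace v u c

theorem torusFace_add_shift (h : IsGrid v u) (c : Fin 3 → ℤ) (m : Lat) :
    torusFace v u (c + shift v m) = torusFace v u c := by
  rw [torusFace, hexFace_add_shift h, Set.image_image]
  simp [torusFace, proj_add_toPlane]

theorem exists_shift_of_torusFace_inter (h : IsGrid v u) {c c' : Fin 3 → ℤ}
    (hs : ∑ i, c i = ∑ i, c' i) (hi : (torusFace v u c ∩ torusFace v u c').Nonempty) :
    ∃ m, c' = c + shift v m := by
  obtain ⟨_, ⟨x, hx, rfl⟩, ⟨x', hx', he⟩⟩ := hi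
  obtain ⟨m, rfl⟩ := proj_eq_proj_iff.1 he.symm
  exact ⟨m, hexFace_eq_of_inter h.mono (by rw [sum_add_shift, hs])
    ⟨_, hx', (mem_hexFace_add_shift h m).2 hx⟩⟩

theorem faces_tilingGraph (hv : 0 < dblArea v) (h : IsGrid v u) :
    (tilingGraph v u).faces =
      Set.range fun c : {c : Fin 3 → ℤ // ∑ i, c i = -1} => torusFace v u c.1 := by
  refine setOf_connectedComponentIn_eq_range ?_ (fun c => isOpenMap_proj _ (isOpen_hexFace _))
    (fun c => (convex_hexFace hv _).isPreconnected.image _ continuous_proj.continuousOn)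
    (fun c c' hcc => ?_) (fun c => (hexFace_nonempty hv h.mono _).image _)
  · change (tilingGraph v u).supportᶜ = _
    rw [← Set.image_preimage_eq (tilingGraph v u).supportᶜ proj_surjective, Set.preimage_compl,
      compl_preimage_support hv h, Set.image_iUnion]
    rfl
  · obtain ⟨m, hm⟩ := exists_shift_of_torusFace_inter h (c.2.trans c'.2.symm) hcc
    rw [hm, torusFace_add_shift h]

/-- The hexagon is disjoint from its nontrivial lattice translates, so the open map `proj` restricts
to a homeomorphism from a convex set onto the face. -/
theorem simplyConnected_torusFace (hv : 0 < dblArea v) (h : IsGrid v u) (c : Fin 3 → ℤ) :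
    SimplyConnectedSpace (torusFace v u c) := by
  have hinj : Function.Injective fun x : hexFace v u c => proj x := by
    intro x x' he
    obtain ⟨m, hm⟩ := proj_eq_proj_iff.1 he
    have hx : (x : Plane) + toPlane m ∈ hexFace v u (c + shift v m) :=
      (mem_hexFace_add_shift h m).2 x.2
    rw [← hm] at hx
    have hc := hexFace_eq_of_inter h.mono (sum_add_shift c m).symm ⟨_, x'.2, hx⟩
    have h0 : shift v m = shift v 0 := by
      rw [left_eq_add.1 hc]
      ext i; simp [shift, pairing]
    rw [shift_injective hv h0] at hm
    exact Subtype.ext (by rw [hm]; ext i; simp [toPlane])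
  have hemb : IsOpenEmbedding fun x : hexFace v u c => proj x :=
    .of_continuous_injective_isOpenMap (continuous_proj.comp continuous_subtype_val) hinj
      (isOpenMap_proj.comp (isOpen_hexFace c).isOpenMap_subtype_val)
  have hr : Set.range (fun x : hexFace v u c => proj x) = torusFace v u c := by
    rw [torusFace, Set.image_eq_range]
  have : ContractibleSpace (hexFace v u c) :=
    (convex_hexFace hv c).contractibleSpace (hexFace_nonempty hv h.mono c)
  have e : hexFace v u c ≃ₜ torusFace v u c :=
    hemb.isEmbedding.toHomeomorph.trans (Homeomorph.setCongr hr)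
  have := e.symm.contractibleSpace
  infer_instance

theorem isDimerModel_tilingGraph (hv : 0 < dblArea v) (h : IsGrid v u) :
    (tilingGraph v u).IsDimerModel := by
  refine ⟨isGraph_tilingGraph hv h, fun F hF => ?_⟩
  rw [faces_tilingGraph hv h] at hF
  obtain ⟨c, rfl⟩ := hF
  exact simplyConnected_torusFace hv h c.1

end

section

variable {v : Fin 3 → Lat} {u : Fin 3 → ℤ → ℝ}

/-! ### The pull-back of the hexagonal graph to the plane -/

theorem preimage_nodes (hv : 0 < dblArea v) (h : IsGrid v u) (s : ℤ) :
    proj ⁻¹' {p | ∃ a, ∑ i, a i = s ∧ p = proj (node v u a)} =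
      {x | ∃ a, ∑ i, a i = s ∧ x = node v u a} := by
  ext x
  constructor
  · rintro ⟨a, ha, hx⟩
    obtain ⟨m, rfl⟩ := proj_eq_proj_iff.1 hx.symm
    exact ⟨a + shift v m, by rw [sum_add_shift, ha], (node_add_shift hv h a m).symm⟩
  · rintro ⟨a, ha, rfl⟩
    exact ⟨a, ha, rfl⟩

theorem planeEdges_tilingGraph (hv : 0 < dblArea v) (h : IsGrid v u) :
    (tilingGraph v u).planeEdges =
      {q | ∃ a i, ∑ j, a j = 0 ∧ q = (node v u a, node v u (a + Pi.single i 1))} := by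
  ext q
  constructor
  · rintro ⟨a, i, ha, hq⟩
    obtain ⟨m, h1, h2⟩ := segmentPath_eq_iff.1 hq.symm
    exact ⟨a + shift v m, i, by rw [sum_add_shift, ha], Prod.ext
      (h1.trans (node_add_shift hv h a m).symm)
      (h2.trans (by dsimp only; rw [add_right_comm, node_add_shift hv h]))⟩
  · rintro ⟨a, i, ha, rfl⟩
    exact ⟨a, i, ha, rfl⟩

theorem edge_pair_inj (hv : 0 < dblArea v) (hm : ∀ i, StrictMono (u i)) {a a' : Fin 3 → ℤ}
    {i i' : Fin 3} (hs : ∑ j, a j = ∑ j, a' j)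
    (he : (node v u a, node v u (a + Pi.single i 1)) =
      (node v u a', node v u (a' + Pi.single i' 1))) : a = a' ∧ i = i' := by
  obtain ⟨h1, h2⟩ := Prod.ext_iff.1 he
  have ha := node_injOn hv hm (by rw [hs, sub_self]; decide) h1
  subst ha
  refine ⟨rfl, ?_⟩
  have h3 := node_injOn hv hm (by rw [sum_add_single, sum_add_single, sub_self]; decide) h2
  have h4 := congrFun (add_left_cancel h3) i
  by_contra hne
  simp [hne] at h4

theorem ncard_white_edges (hv : 0 < dblArea v) (h : IsGrid v u) {a : Fin 3 → ℤ}
    (ha : ∑ j, a j = 0) :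
    {q ∈ (tilingGraph v u).planeEdges | q.1 = node v u a}.ncard = 3 := by
  have : {q ∈ (tilingGraph v u).planeEdges | q.1 = node v u a} =
      Set.range fun i => (node v u a, node v u (a + Pi.single i 1)) := by
    rw [planeEdges_tilingGraph hv h]
    ext q
    constructor
    · rintro ⟨⟨a', i, ha', rfl⟩, hq⟩
      have := node_injOn hv h.mono (by rw [ha', ha]; decide) hq
      subst this
      exact ⟨i, rfl⟩
    · rintro ⟨i, rfl⟩
      exact ⟨⟨a, i, ha, rfl⟩, rfl⟩
  rw [this, ← Set.image_univ, Set.ncard_image_of_injective _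
    fun i i' hi => (edge_pair_inj hv h.mono rfl hi).2]
  simp

theorem ncard_black_edges (hv : 0 < dblArea v) (h : IsGrid v u) {b : Fin 3 → ℤ}
    (hb : ∑ j, b j = 1) :
    {q ∈ (tilingGraph v u).planeEdges | q.2 = node v u b}.ncard = 3 := by
  have : {q ∈ (tilingGraph v u).planeEdges | q.2 = node v u b} =
      Set.range fun i => (node v u (b + Pi.single i (-1)), node v u b) := by
    rw [planeEdges_tilingGraph hv h]
    ext q
    constructor
    · rintro ⟨⟨a', i, ha', rfl⟩, hq⟩
      have := node_injOn hv h.mono (by rw [sum_add_single, ha', hb]; decide) hq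
      subst this
      exact ⟨i, by simp [add_assoc, ← Pi.single_add]⟩
    · rintro ⟨i, rfl⟩
      exact ⟨⟨b + Pi.single i (-1), i, by rw [sum_add_single, hb]; rfl,
        by simp [add_assoc, ← Pi.single_add]⟩, rfl⟩
  rw [this, ← Set.image_univ, Set.ncard_image_of_injective]
  · simp
  · intro i i' hi
    have h3 := node_injOn hv h.mono (by rw [sum_add_single, sum_add_single, sub_self]; decide)
      (congrArg Prod.fst hi)
    have h4 := congrFun (add_left_cancel h3) i
    by_contra hne
    simp [hne] at h4

/-! ### The hexagons -/

/-- The corners of a box that project to the vertices of its hexagonal shadow, in cyclic order. -/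
def hexCorner : Fin 6 → Fin 3 → ℤ :=
  ![![1, 0, 0], ![1, 1, 0], ![0, 1, 0], ![0, 1, 1], ![0, 0, 1], ![1, 0, 1]]

/-- With weights w(i+1) w(i+2) / S, each direction is raised by the same amount w₀ w₁ w₂ / S. The
combination thus differs from y by a multiple of (1,1,1), which `pt v` kills. Requiring only equal
signs of the w i covers steps up from the lowest corner of a box and steps down from the highest. -/
theorem pt_mem_convexHull (hv : 0 < dblArea v) (y w : Fin 3 → ℝ) (hw : ∀ i j, 0 < w i * w j) :
    pt v y ∈ convexHull ℝ (Set.range fun i => pt v (y + Pi.single i (w i))) := by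
  set S := w 1 * w 2 + w 2 * w 0 + w 0 * w 1
  have hS : 0 < S := by linarith [hw 1 2, hw 2 0, hw 0 1]
  have h1 : pt v y = ∑ i, (w (i + 1) * w (i + 2) / S) • pt v (y + Pi.single i (w i)) := by
    simp only [← map_smul, ← map_sum]
    rw [eq_comm, pt_eq_iff hv]
    refine ⟨(∑ j, y j) / 3 + w 0 * w 1 * w 2 / S, fun i => ?_⟩
    rw [coord_pt hv]
    fin_cases i <;> simp [Fin.sum_univ_three] <;> field_simp <;> ring
  rw [h1]
  refine (convex_convexHull ℝ _).sum_mem (fun i _ => div_nonneg (hw _ _).le hS.le) ?_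
    fun i _ => subset_convexHull ℝ _ ⟨i, rfl⟩
  rw [← Finset.sum_div, div_eq_one_iff_eq hS.ne', Fin.sum_univ_three]
  simp [S]

/-- Six of the eight corners of the box are in `hexCorner`. The lowest one projects into the
triangle of its neighbours 0, 2, 4, the highest one into that of 3, 5, 1. -/
theorem node_add_mem_convexHull (hv : 0 < dblArea v) (hm : ∀ i, StrictMono (u i))
    (c ε : Fin 3 → ℤ) (hε : ∀ i, ε i = 0 ∨ ε i = 1) :
    node v u (c + ε) ∈ convexHull ℝ (Set.range fun k => node v u (c + hexCorner k)) := by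
  have hsub : ∀ k, node v u (c + hexCorner k) ∈
      convexHull ℝ (Set.range fun k => node v u (c + hexCorner k)) :=
    fun k => subset_convexHull ℝ _ ⟨k, rfl⟩
  have hw : ∀ i, 0 < u i (c i + 1) - u i (c i) := fun i => sub_pos.2 (hm i (lt_add_one _))
  have e : ε = ![ε 0, ε 1, ε 2] := by ext i; fin_cases i <;> rfl
  rcases hε 0 with h0 | h0 <;> rcases hε 1 with h1 | h1 <;> rcases hε 2 with h2 | h2 <;>
    rw [e, h0, h1, h2]
  · have := pt_mem_convexHull hv (fun i => u i (c i)) (fun i => u i (c i + 1) - u i (c i))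
      fun i j => mul_pos (hw i) (hw j)
    refine convexHull_min ?_ (convex_convexHull ℝ _) (show node v u _ ∈ _ from ?_)
      (s := Set.range fun i =>
        pt v ((fun i => u i (c i)) + Pi.single i (u i (c i + 1) - u i (c i))))
    · rintro _ ⟨i, rfl⟩
      have : pt v ((fun i => u i (c i)) + Pi.single i (u i (c i + 1) - u i (c i))) =
          node v u (c + hexCorner (![0, 2, 4] i)) := by
        congr 1
        ext j
        fin_cases i <;> fin_cases j <;> simp [hexCorner]
      simp only [this]
      exact hsub _
    · convert this using 1
      congr 1
      ext j
      fin_cases j <;> simp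
  · exact hsub 4
  · exact hsub 2
  · exact hsub 3
  · exact hsub 0
  · exact hsub 5
  · exact hsub 1
  · have := pt_mem_convexHull hv (fun i => u i (c i + 1)) (fun i => u i (c i) - u i (c i + 1))
      fun i j => mul_pos_of_neg_of_neg (by linarith [hw i]) (by linarith [hw j])
    refine convexHull_min ?_ (convex_convexHull ℝ _) (show node v u _ ∈ _ from ?_)
      (s := Set.range fun i =>
        pt v ((fun i => u i (c i + 1)) + Pi.single i (u i (c i) - u i (c i + 1))))
    · rintro _ ⟨i, rfl⟩
      have : pt v ((fun i => u i (c i + 1)) + Pi.single i (u i (c i) - u i (c i + 1))) =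
          node v u (c + hexCorner (![3, 5, 1] i)) := by
        congr 1
        ext j
        fin_cases i <;> fin_cases j <;> simp [hexCorner]
      simp only [this]
      exact hsub _
    · convert this using 1
      congr 1
      ext j
      fin_cases j <;> simp

theorem hexFace_subset_convexHull (hv : 0 < dblArea v) (hm : ∀ i, StrictMono (u i))
    (c : Fin 3 → ℤ) :
    hexFace v u c ⊆ convexHull ℝ (Set.range fun k => node v u (c + hexCorner k)) := by
  have h1 : (Set.univ.pi fun i => Set.Ioo (u i (c i)) (u i (c i + 1))) ⊆
      convexHull ℝ (Set.univ.pi fun i => {u i (c i), u i (c i + 1)}) := by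
    rw [convexHull_pi]
    refine Set.pi_mono fun i _ => ?_
    rw [convexHull_pair, segment_eq_Icc (hm i (lt_add_one _)).le]
    exact Set.Ioo_subset_Icc_self
  rw [hexFace_eq_image hv]
  refine (Set.image_mono h1).trans ?_
  rw [(pt v).image_convexHull]
  refine convexHull_min ?_ (convex_convexHull ℝ _)
  rintro _ ⟨y, hy, rfl⟩
  have : ∀ i, ∃ n : ℤ, (n = 0 ∨ n = 1) ∧ y i = u i (c i + n) := by
    intro i
    rcases hy i trivial with h | h
    · exact ⟨0, Or.inl rfl, by rw [add_zero]; exact h⟩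
    · exact ⟨1, Or.inr rfl, h⟩
  choose ε h2 h3 using this
  rw [show y = fun i => u i ((c + ε) i) from funext h3]
  exact node_add_mem_convexHull hv hm c ε h2

theorem corner_mem_closure (hv : 0 < dblArea v) (hm : ∀ i, StrictMono (u i)) (c : Fin 3 → ℤ)
    (k : Fin 6) : node v u (c + hexCorner k) ∈ closure (hexFace v u c) := by
  rw [hexFace_eq_image hv]
  refine image_closure_subset_closure_image continuous_pt ⟨_, ?_, rfl⟩
  rw [closure_pi_set]
  intro i _
  change u i (c i + hexCorner k i) ∈ closure (Set.Ioo (u i (c i)) (u i (c i + 1)))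
  rw [closure_Ioo (hm i (lt_add_one _)).ne]
  have : hexCorner k i = 0 ∨ hexCorner k i = 1 := by
    revert k i; decide
  rcases this with h | h <;> simp [h, (hm i).monotone (show c i ≤ c i + 1 by omega)]

/-- The hull lies between the open convex set `hexFace v u c` and its closure, and an open convex
set is the interior of its closure. -/
theorem hexFace_eq_interior (hv : 0 < dblArea v) (hm : ∀ i, StrictMono (u i)) (c : Fin 3 → ℤ) :
    hexFace v u c =
      interior (convexHull ℝ (Set.range fun k => node v u (c + hexCorner k))) := by
  refine Set.Subset.antisymm
    (interior_maximal (hexFace_subset_convexHull hv hm c) (isOpen_hexFace c)) ?_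
  have hc := convex_hexFace (u := u) hv c
  have h1 : convexHull ℝ (Set.range fun k => node v u (c + hexCorner k)) ⊆
      closure (hexFace v u c) :=
    convexHull_min (by rintro _ ⟨k, rfl⟩; exact corner_mem_closure hv hm c k) hc.closure
  refine (interior_mono h1).trans ?_
  rw [hc.interior_closure_eq_interior_of_nonempty_interior
    (by rw [(isOpen_hexFace c).interior_eq]; exact hexFace_nonempty hv hm c)]
  exact interior_subset

theorem convexIndependent_of_separated {ι E : Type*} [AddCommGroup E] [Module ℝ E] {p : ι → E}
    (h : ∀ i, ∃ f : E →ₗ[ℝ] ℝ, ∀ j ≠ i, f (p j) < f (p i)) : ConvexIndependent ℝ p := by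
  rw [convexIndependent_iff_notMem_convexHull_sdiff]
  intro i s hi
  obtain ⟨f, hf⟩ := h i
  have hsub : convexHull ℝ (p '' (s \ {i})) ⊆ {x | f x < f (p i)} := by
    refine convexHull_min ?_ (convex_halfSpace_lt f.isLinear _)
    rintro _ ⟨j, hj, rfl⟩
    exact hf j hj.2
  exact lt_irrefl (f (p i)) (hsub hi)

/-- A corner with one raised index is the only maximum of that coordinate; a corner with one index
not raised is the only minimum of that coordinate. -/
theorem convexIndependent_corners (hv : 0 < dblArea v) (hm : ∀ i, StrictMono (u i))
    (c : Fin 3 → ℤ) : ConvexIndependent ℝ fun k => node v u (c + hexCorner k) := by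
  have h0 := hm 0 (lt_add_one (c 0))
  have h1 := hm 1 (lt_add_one (c 1))
  have h2 := hm 2 (lt_add_one (c 2))
  refine convexIndependent_of_separated fun k => ?_
  refine ⟨(![coord v 0, -coord v 2, coord v 1, -coord v 0, coord v 2, -coord v 1] :
    Fin 6 → (Plane →ₗ[ℝ] ℝ)) k, fun j hj => ?_⟩
  fin_cases k <;> fin_cases j <;>
    simp [hexCorner, coord_node hv, Fin.sum_univ_three, -Matrix.add_cons] at hj ⊢ <;> linarith

theorem isHexagonalTiling_tilingGraph (hv : 0 < dblArea v) (h : IsGrid v u) :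
    (tilingGraph v u).IsHexagonalTiling where
  straight := by
    rintro e ⟨a, i, -, rfl⟩
    exact ⟨_, _, rfl⟩
  white_degree := by
    intro w hw
    obtain ⟨a, ha, rfl⟩ := (preimage_nodes hv h 0).subset hw
    exact ncard_white_edges hv h ha
  black_degree := by
    intro w hw
    obtain ⟨a, ha, rfl⟩ := (preimage_nodes hv h 1).subset hw
    exact ncard_black_edges hv h ha
  hexagon := by
    rw [planeFaces_tilingGraph hv h]
    rintro _ ⟨⟨c, hc⟩, rfl⟩
    refine ⟨_, convexIndependent_corners hv h.mono c, hexFace_eq_interior hv h.mono c, ?_⟩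
    rw [planeEdges_tilingGraph hv h]
    -- Since `c` has sum −1, corners with one raised index are white and those with two are black.
    -- Colors alternate around the hexagon, and each side raises one index of its white end.
    have key : ∀ k i j : _, ∑ i, hexCorner k i = 1 →
        hexCorner j = hexCorner k + Pi.single i 1 →
        (node v u (c + hexCorner k), node v u (c + hexCorner j)) ∈
        {q | ∃ a i, ∑ j, a j = 0 ∧ q = (node v u a, node v u (a + Pi.single i 1))} := by
      intro k i j hk hj
      refine ⟨c + hexCorner k, i, ?_, by rw [hj, add_assoc]⟩
      simp only [Pi.add_apply, Finset.sum_add_distrib]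
      omega
    intro k
    fin_cases k
    · exact Or.inl (key 0 1 1 (by decide) (by decide))
    · exact Or.inr (key 2 0 1 (by decide) (by decide))
    · exact Or.inl (key 2 2 3 (by decide) (by decide))
    · exact Or.inr (key 4 1 3 (by decide) (by decide))
    · exact Or.inl (key 4 0 5 (by decide) (by decide))
    · exact Or.inr (key 0 2 5 (by decide) (by decide))

/-! ### The faces on the two sides of an edge -/

theorem eventually_add_mul_lt {A B C : ℝ} (h : A < C) : ∀ᶠ ε : ℝ in 𝓝[>] 0, A + ε * B < C := by
  have hc : Filter.Tendsto (fun ε : ℝ => A + ε * B) (𝓝[>] 0) (𝓝 (A + 0 * B)) :=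
    (Continuous.tendsto (by fun_prop) 0).mono_left nhdsWithin_le_nhds
  exact hc.eventually_lt_const (by simpa using h)

theorem eventually_lt_add_mul {A B C : ℝ} (h : C < A) : ∀ᶠ ε : ℝ in 𝓝[>] 0, C < A + ε * B := by
  have hc : Filter.Tendsto (fun ε : ℝ => A + ε * B) (𝓝[>] 0) (𝓝 (A + 0 * B)) :=
    (Continuous.tendsto (by fun_prop) 0).mono_left nhdsWithin_le_nhds
  exact hc.eventually_const_lt (by simpa using h)

/-- Changing the time by the mean of the j-th and k-th coordinates of the displacement makes
coordinate j drop below its grid value and coordinate k rise above its own by the same amount.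
Coordinate i stays strictly inside, so only the index j decreases. -/
theorem eventually_mem_hexFace (hv : 0 < dblArea v) (hm : ∀ i, StrictMono (u i))
    (a : Fin 3 → ℤ) {i j k : Fin 3} (hij : i ≠ j) (hik : i ≠ k) (hjk : j ≠ k) {d : Plane}
    (hd : coord v j d < coord v k d) :
    ∀ᶠ ε : ℝ in 𝓝[>] 0, midpoint ℝ (node v u a) (node v u (a + Pi.single i 1)) + ε • d ∈
      hexFace v u (a - Pi.single j 1) := by
  obtain ⟨t, h1, h2⟩ := exists_time_lineMap hv u a i (2⁻¹ : ℝ)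
  have hmid : midpoint ℝ (node v u a) (node v u (a + Pi.single i 1)) =
      AffineMap.lineMap (node v u a) (node v u (a + Pi.single i 1)) (2⁻¹ : ℝ) := by
    simp [midpoint]
  rw [hmid]
  generalize (AffineMap.lineMap (node v u a) (node v u (a + Pi.single i 1)) (2⁻¹ : ℝ) : Plane) = x
    at *
  have hw := hm i (lt_add_one (a i))
  have e1 := eventually_lt_add_mul (A := coord v i x + t) (C := u i (a i))
    (B := coord v i d - (coord v j d + coord v k d) / 2) (by rw [h2]; linarith)
  have e2 := eventually_add_mul_lt (A := coord v i x + t) (C := u i (a i + 1))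
    (B := coord v i d - (coord v j d + coord v k d) / 2) (by rw [h2]; linarith)
  have e3 := eventually_lt_add_mul (A := coord v j x + t) (C := u j (a j - 1))
    (B := coord v j d - (coord v j d + coord v k d) / 2)
    (by rw [h1 j hij.symm]; exact hm j (by omega))
  have e4 := eventually_add_mul_lt (A := coord v k x + t) (C := u k (a k + 1))
    (B := coord v k d - (coord v j d + coord v k d) / 2)
    (by rw [h1 k hik.symm]; exact hm k (by omega))
  filter_upwards [e1, e2, e3, e4, self_mem_nhdsWithin] with ε f1 f2 f3 f4 hε
  have hε' : 0 < ε * ((coord v k d - coord v j d) / 2) := mul_pos hε (by linarith)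
  refine ⟨t - ε * ((coord v j d + coord v k d) / 2), fun l => ?_⟩
  have hl : coord v l (x + ε • d) + (t - ε * ((coord v j d + coord v k d) / 2)) =
      coord v l x + t + ε * (coord v l d - (coord v j d + coord v k d) / 2) := by
    rw [map_add, map_smul, smul_eq_mul]; ring
  rw [hl]
  have hcases : l = i ∨ l = j ∨ l = k := by
    clear * - hij hik hjk
    revert i j k l
    decide
  rcases hcases with rfl | rfl | rfl
  · simpa [hij] using ⟨f1, f2⟩
  · refine ⟨by simpa using f3, ?_⟩
    rw [h1 l hij.symm]
    simp
    linarith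
  · refine ⟨?_, by simpa [hjk.symm] using f4⟩
    rw [h1 l hik.symm]
    simp [hjk.symm]
    linarith

/-- The rotated edge vector is a positive multiple of (p, q), the vector `side v (i + 2) - side v (i
+ 1)`. The difference of the two coordinates is the pairing with the same vector, so it is a
positive multiple of p² + q². The factor is positive because the vertices are in counterclockwise
order. -/
theorem coord_rotLeft_lt (hv : 0 < dblArea v) (hm : ∀ i, StrictMono (u i)) (a : Fin 3 → ℤ)
    (i : Fin 3) :
    coord v (i + 1) (rotLeft (node v u a - node v u (a + Pi.single i 1))) <
      coord v (i + 2) (rotLeft (node v u a - node v u (a + Pi.single i 1))) := by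
  set w := u i (a i + 1) - u i (a i)
  have hw : 0 < w := sub_pos.2 (hm i (lt_add_one _))
  have hD : (0 : ℝ) < dblArea v := by exact_mod_cast hv
  have h1 : node v u a - node v u (a + Pi.single i 1) = pt v (Pi.single i (-w)) := by
    rw [node, node, ← map_sub]
    congr 1
    ext j
    by_cases hj : j = i
    · subst hj; simp [w]
    · simp [hj]
  set p : ℝ := ((side v (i + 2) 0 - side v (i + 1) 0 : ℤ) : ℝ) with hp
  set q : ℝ := ((side v (i + 2) 1 - side v (i + 1) 1 : ℤ) : ℝ) with hq
  have h2 : rotLeft (pt v (Pi.single i (-w))) = ![w / (3 * dblArea v) * p, w / (3 * dblArea v) * q] := by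
    ext j
    fin_cases j
    · simp [rotLeft, pt, hp, Pi.single_apply]
      ring
    · simp [rotLeft, pt, hq, Pi.single_apply]
      ring
  rw [h1, h2, ← sub_pos, coord_apply, coord_apply]
  have h3 : 0 < p ^ 2 + q ^ 2 := by
    by_contra hcon
    have hp0 : p = 0 := by nlinarith [sq_nonneg p, sq_nonneg q]
    have hq0 : q = 0 := by nlinarith [sq_nonneg p, sq_nonneg q]
    rw [hp, Int.cast_eq_zero] at hp0
    rw [hq, Int.cast_eq_zero] at hq0
    apply hv.ne'
    have hA : dblArea v = side v (i + 1) 0 * side v (i + 2) 1 -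
        side v (i + 1) 1 * side v (i + 2) 0 := by
      fin_cases i <;> simp [dblArea, side] <;> ring
    rw [hA, sub_eq_zero.1 hp0, sub_eq_zero.1 hq0]
    ring
  have h4 : 0 < w / (3 * dblArea v) * (p ^ 2 + q ^ 2) := by positivity
  convert h4 using 1
  simp [hp, hq]
  ring

theorem isPlaneTarget_hexFace (hv : 0 < dblArea v) (hm : ∀ i, StrictMono (u i)) (a : Fin 3 → ℤ)
    (i : Fin 3) : BicoloredGraph.IsPlaneTarget (node v u a, node v u (a + Pi.single i 1))
      (hexFace v u (a - Pi.single (i + 1) 1)) :=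
  eventually_mem_hexFace hv hm a (j := i + 1) (k := i + 2) (by simp) (by simp) (by simp)
    (coord_rotLeft_lt hv hm a i)

theorem isPlaneSource_hexFace (hv : 0 < dblArea v) (hm : ∀ i, StrictMono (u i)) (a : Fin 3 → ℤ)
    (i : Fin 3) : BicoloredGraph.IsPlaneSource (node v u a, node v u (a + Pi.single i 1))
      (hexFace v u (a - Pi.single (i + 2) 1)) := by
  have := eventually_mem_hexFace hv hm a (i := i) (j := i + 2) (k := i + 1) (by simp) (by simp)
    (by simp) (d := -rotLeft (node v u a - node v u (a + Pi.single i 1)))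
    (by simpa using coord_rotLeft_lt hv hm a i)
  simpa [BicoloredGraph.IsPlaneSource, sub_eq_add_neg] using this

end

section

variable {v : Fin 3 → Lat} {u : Fin 3 → ℤ → ℝ}

/-! ### Labels of faces -/

/-- The box of the grid that belongs to the label `a` of a face. -/
def boxIndex (a : Lat) : Fin 3 → ℤ := ![-a 1, a 0, a 1 - a 0 - 1]

theorem sum_boxIndex (a : Lat) : ∑ i, boxIndex a i = -1 := by
  simp [boxIndex, Fin.sum_univ_three]
  ring

theorem boxIndex_injective : Function.Injective boxIndex := by
  intro a b h
  have h0 := congrFun h 0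
  have h1 := congrFun h 1
  simp [boxIndex] at h0 h1
  ext i
  fin_cases i
  exacts [h1, h0]

theorem exists_boxIndex_eq {c : Fin 3 → ℤ} (hc : ∑ i, c i = -1) : ∃ a, boxIndex a = c := by
  refine ⟨![c 1, -c 0], ?_⟩
  rw [Fin.sum_univ_three] at hc
  ext i
  fin_cases i
  · simp [boxIndex]
  · simp [boxIndex]
  · simp [boxIndex]; omega

/-- This and `boxIndex_sub_step` dictate the form of `boxIndex`: its linear part sends `step i` to
e_(i+1) − e_(i+2) and turns ψ into `shift v`, while the constant −1 fixes the index sum. -/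
theorem boxIndex_add_psi (a m : Lat) : boxIndex (a + psi v m) = boxIndex a + shift v m := by
  ext i
  fin_cases i <;> simp [boxIndex, psi, shift, pairing, side] <;> ring

theorem boxIndex_sub_step (a : Lat) (i : Fin 3) :
    boxIndex (a - step i) = boxIndex a + Pi.single (i + 2) 1 - Pi.single (i + 1) 1 := by
  ext j
  fin_cases i <;> fin_cases j <;> simp [boxIndex, step, -Matrix.cons_add, -Matrix.cons_sub, -Matrix.sub_cons, -Matrix.add_cons] <;> ring

/-- The white end of the edge that is dual to the arrow with label `(a, i)`. -/
def whiteIndex (a : Lat) (i : Fin 3) : Fin 3 → ℤ := boxIndex a + Pi.single (i + 2) 1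

theorem sum_whiteIndex (a : Lat) (i : Fin 3) : ∑ j, whiteIndex a i j = 0 := by
  rw [whiteIndex, sum_add_single, sum_boxIndex]; rfl

theorem whiteIndex_injective (i : Fin 3) : Function.Injective fun a => whiteIndex a i :=
  fun _ _ h => boxIndex_injective (add_right_cancel h)

theorem exists_whiteIndex_eq (i : Fin 3) {c : Fin 3 → ℤ} (hc : ∑ i, c i = 0) :
    ∃ a, whiteIndex a i = c := by
  obtain ⟨a, ha⟩ := exists_boxIndex_eq (c := c + Pi.single (i + 2) (-1))
    (by rw [sum_add_single, hc]; rfl)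
  exact ⟨a, by rw [whiteIndex, ha]; simp [add_assoc, ← Pi.single_add]⟩

theorem whiteIndex_add_psi (a m : Lat) (i : Fin 3) :
    whiteIndex (a + psi v m) i = whiteIndex a i + shift v m := by
  rw [whiteIndex, boxIndex_add_psi, add_right_comm, whiteIndex]

/-- The edge that is dual to the arrow with label `(a, i)`. -/
def dualEdge (v : Fin 3 → Lat) (u : Fin 3 → ℤ → ℝ) (p : Lat × Fin 3) : Plane × Plane :=
  (node v u (whiteIndex p.1 p.2), node v u (whiteIndex p.1 p.2 + Pi.single p.2 1))

theorem dualEdge_injective (hv : 0 < dblArea v) (hm : ∀ i, StrictMono (u i)) :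
    Function.Injective (dualEdge v u) := by
  rintro ⟨a, i⟩ ⟨b, j⟩ h
  obtain ⟨h1, rfl⟩ := edge_pair_inj hv hm (by rw [sum_whiteIndex, sum_whiteIndex]) h
  exact congrArg (·, i) (whiteIndex_injective i h1)

theorem range_dualEdge (hv : 0 < dblArea v) (h : IsGrid v u) :
    Set.range (dualEdge v u) = (tilingGraph v u).planeEdges := by
  rw [planeEdges_tilingGraph hv h]
  ext q
  constructor
  · rintro ⟨⟨a, i⟩, rfl⟩
    exact ⟨_, i, sum_whiteIndex a i, rfl⟩
  · rintro ⟨c, i, hc, rfl⟩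
    obtain ⟨a, rfl⟩ := exists_whiteIndex_eq i hc
    exact ⟨(a, i), rfl⟩

theorem dualEdge_add_psi (hv : 0 < dblArea v) (h : IsGrid v u) (a : Lat) (i : Fin 3) (m : Lat) :
    dualEdge v u (a + psi v m, i) = dualEdge v u (a, i) + (toPlane m, toPlane m) := by
  simp only [dualEdge, whiteIndex_add_psi]
  rw [add_right_comm, node_add_shift hv h, node_add_shift hv h]
  rfl

/-- The black end of the edge that is dual to the arrow with label `(a, 0)`. -/
def blackIndex (a : Lat) : Fin 3 → ℤ := whiteIndex a 0 + Pi.single 0 1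

theorem sum_blackIndex (a : Lat) : ∑ j, blackIndex a j = 1 := by
  rw [blackIndex, sum_add_single, sum_whiteIndex]; rfl

theorem blackIndex_injective : Function.Injective blackIndex :=
  fun _ _ h => whiteIndex_injective 0 (add_right_cancel h)

theorem exists_blackIndex_eq {c : Fin 3 → ℤ} (hc : ∑ i, c i = 1) : ∃ a, blackIndex a = c := by
  obtain ⟨a, ha⟩ := exists_whiteIndex_eq 0 (c := c + Pi.single 0 (-1))
    (by rw [sum_add_single, hc]; rfl)
  exact ⟨a, by rw [blackIndex, ha]; simp [add_assoc, ← Pi.single_add]⟩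

theorem blackIndex_add_psi (a m : Lat) : blackIndex (a + psi v m) = blackIndex a + shift v m := by
  rw [blackIndex, whiteIndex_add_psi, add_right_comm, blackIndex]

theorem isPlaneSource_dualEdge (hv : 0 < dblArea v) (hm : ∀ i, StrictMono (u i)) (a : Lat)
    (i : Fin 3) :
    BicoloredGraph.IsPlaneSource (dualEdge v u (a, i)) (hexFace v u (boxIndex a)) := by
  have := isPlaneSource_hexFace (u := u) hv hm (whiteIndex a i) i
  rwa [show whiteIndex a i - Pi.single (i + 2) 1 = boxIndex a from add_sub_cancel_right _ _] at this

theorem isPlaneTarget_dualEdge (hv : 0 < dblArea v) (hm : ∀ i, StrictMono (u i)) (a : Lat)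
    (i : Fin 3) :
    BicoloredGraph.IsPlaneTarget (dualEdge v u (a, i)) (hexFace v u (boxIndex (a - step i))) := by
  have := isPlaneTarget_hexFace (u := u) hv hm (whiteIndex a i) i
  rwa [show whiteIndex a i - Pi.single (i + 1) 1 = boxIndex (a - step i) from
    (boxIndex_sub_step a i).symm] at this

theorem range_node_index {f : Lat → Fin 3 → ℤ} {s : ℤ} (hs : ∀ a, ∑ i, f a i = s)
    (hf : ∀ c, ∑ i, c i = s → ∃ a, f a = c) (hv : 0 < dblArea v) (h : IsGrid v u) :
    (Set.range fun a => node v u (f a)) =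
      proj ⁻¹' {p | ∃ a, ∑ i, a i = s ∧ p = proj (node v u a)} := by
  rw [preimage_nodes hv h]
  ext x
  constructor
  · rintro ⟨a, rfl⟩
    exact ⟨_, hs a, rfl⟩
  · rintro ⟨c, hc, rfl⟩
    obtain ⟨a, rfl⟩ := hf c hc
    exact ⟨a, rfl⟩

theorem node_index_injective {f : Lat → Fin 3 → ℤ} {s : ℤ} (hs : ∀ a, ∑ i, f a i = s)
    (hf : Function.Injective f) (hv : 0 < dblArea v) (h : IsGrid v u) :
    Function.Injective fun a => node v u (f a) :=
  fun a b hab => hf (node_injOn hv h.mono (by rw [hs, hs, sub_self]; decide) hab)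

/-- It remains to compare the quotient of the plane quiver with the McKay quiver. -/
theorem isDualToMcKayQuiver_of_iso (hv : 0 < dblArea v) (h : IsGrid v u)
    (φ : (tilingGraph v u).faces ≃ Irr (triangleGroup v))
    (η : (tilingGraph v u).edges ≃ McKayArrow (triangleGroup v))
    (hη : ∀ e : (tilingGraph v u).edges,
      BicoloredGraph.IsSource e.1 (φ.symm (η e).source).1 ∧
        BicoloredGraph.IsTarget e.1 (φ.symm (η e).target).1)
    (hφ : ∀ a (F : (tilingGraph v u).faces), torusFace v u (boxIndex a) ⊆ F.1 →
      Nonempty ((φ F).rep ≅ charRep (latChar v a))) :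
    IsDualToMcKayQuiver v (tilingGraph v u) := by
  refine ⟨fun a => hexFace v u (boxIndex a), dualEdge v u, fun a => node v u (whiteIndex a 0),
    fun a => node v u (blackIndex a), ⟨?_, ?_⟩, ⟨dualEdge_injective hv h.mono, range_dualEdge hv h⟩,
    ⟨node_index_injective (fun a => sum_whiteIndex a 0) (whiteIndex_injective 0) hv h,
      range_node_index (fun a => sum_whiteIndex a 0) (fun _ => exists_whiteIndex_eq 0) hv h⟩,
    ⟨node_index_injective sum_blackIndex blackIndex_injective hv h,
      range_node_index sum_blackIndex (fun _ => exists_blackIndex_eq) hv h⟩,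
    ?_, dualEdge_add_psi hv h, ?_, ?_,
    fun a i => ⟨isPlaneSource_dualEdge hv h.mono a i, isPlaneTarget_dualEdge hv h.mono a i⟩,
    ?_, ?_, φ, η, hη, hφ⟩
  · intro a b hab
    refine boxIndex_injective (hexFace_eq_of_inter (v := v) h.mono
      ((sum_boxIndex a).trans (sum_boxIndex b).symm) ?_)
    change hexFace v u (boxIndex a) = hexFace v u (boxIndex b) at hab
    rw [hab, Set.inter_self]
    exact hexFace_nonempty hv h.mono _
  · rw [planeFaces_tilingGraph hv h]
    ext F
    constructor
    · rintro ⟨a, rfl⟩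
      exact ⟨⟨_, sum_boxIndex a⟩, rfl⟩
    · rintro ⟨⟨c, hc⟩, rfl⟩
      obtain ⟨a, rfl⟩ := exists_boxIndex_eq hc
      exact ⟨a, rfl⟩
  · intro a m
    simp only [boxIndex_add_psi]
    exact hexFace_add_shift h _ m
  · intro a m
    simp only [whiteIndex_add_psi]
    exact node_add_shift hv h _ m
  · intro a m
    simp only [blackIndex_add_psi]
    exact node_add_shift hv h _ m
  · intro a
    refine ⟨rfl, congrArg (node v u) ?_, congrArg (node v u) ?_⟩ <;> ext j <;> fin_cases j <;>
      simp [whiteIndex, boxIndex, step,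
        -Matrix.cons_add, -Matrix.cons_sub, -Matrix.sub_cons, -Matrix.add_cons] <;> ring
  · intro a
    refine ⟨rfl, congrArg (node v u) ?_, congrArg (node v u) ?_⟩ <;> ext j <;> fin_cases j <;>
      simp [blackIndex, whiteIndex, boxIndex, step,
        -Matrix.cons_add, -Matrix.cons_sub, -Matrix.sub_cons, -Matrix.add_cons] <;> ring

/-! ### The quotient by translations -/

/-- Both targets are quotients of α by the same relation. Faces and irreducible representations are
compared through their labels in this way, and so are edges and arrows. -/
theorem exists_equiv_of_surjective {α β γ : Type*} {f : α → β} {g : α → γ}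
    (hf : Function.Surjective f) (hg : Function.Surjective g) (h : ∀ a b, f a = f b ↔ g a = g b) :
    ∃ φ : β ≃ γ, ∀ a, φ (f a) = g a := by
  have hk : Setoid.ker f = Setoid.ker g := Setoid.ext h
  refine ⟨(Setoid.quotientKerEquivOfSurjective f hf).symm.trans
    ((Quotient.congrRight fun a b => h a b).trans
      (Setoid.quotientKerEquivOfSurjective g hg)), fun a => ?_⟩
  have : (Setoid.quotientKerEquivOfSurjective f hf).symm (f a) = Quotient.mk _ a :=
    (Equiv.symm_apply_eq _).2 rfl
  rw [Equiv.trans_apply, this]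
  rfl

theorem torusFace_boxIndex_eq_iff (hv : 0 < dblArea v) (h : IsGrid v u) (a b : Lat) :
    torusFace v u (boxIndex a) = torusFace v u (boxIndex b) ↔ ∃ m, b = a + psi v m := by
  constructor
  · intro hab
    obtain ⟨m, hm⟩ := exists_shift_of_torusFace_inter h
      ((sum_boxIndex a).trans (sum_boxIndex b).symm)
      (by rw [hab, Set.inter_self]; exact (hexFace_nonempty hv h.mono _).image _)
    exact ⟨m, boxIndex_injective (by rw [hm, boxIndex_add_psi])⟩
  · rintro ⟨m, rfl⟩
    rw [boxIndex_add_psi, torusFace_add_shift h]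

/-- The edge on the torus with label `p`. -/
def torusEdge (v : Fin 3 → Lat) (u : Fin 3 → ℤ → ℝ) (p : Lat × Fin 3) : C(unitInterval, Torus) :=
  BicoloredGraph.segmentPath (dualEdge v u p).1 (dualEdge v u p).2

theorem torusEdge_eq_iff (hv : 0 < dblArea v) (h : IsGrid v u) (p q : Lat × Fin 3) :
    torusEdge v u p = torusEdge v u q ↔ (∃ m, q.1 = p.1 + psi v m) ∧ p.2 = q.2 := by
  obtain ⟨a, i⟩ := p
  obtain ⟨b, j⟩ := q
  rw [torusEdge, torusEdge, segmentPath_eq_iff]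
  constructor
  · rintro ⟨m, h1, h2⟩
    have he : dualEdge v u (b, j) = dualEdge v u (a + psi v m, i) := by
      rw [dualEdge_add_psi hv h]
      exact Prod.ext h1 h2
    obtain ⟨h3, h4⟩ := Prod.ext_iff.1 (dualEdge_injective hv h.mono he)
    exact ⟨⟨m, h3⟩, h4.symm⟩
  · rintro ⟨⟨m, h3⟩, h4⟩
    change b = a + psi v m at h3
    change i = j at h4
    subst h3 h4
    refine ⟨m, ?_, ?_⟩ <;> rw [dualEdge_add_psi hv h] <;> rfl

theorem isSource_torusEdge (hv : 0 < dblArea v) (hm : ∀ i, StrictMono (u i)) (p : Lat × Fin 3) :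
    BicoloredGraph.IsSource (torusEdge v u p) (torusFace v u (boxIndex p.1)) :=
  ⟨_, _, rfl, (isPlaneSource_dualEdge hv hm p.1 p.2).mono fun _ hε => ⟨_, hε, rfl⟩⟩

theorem isTarget_torusEdge (hv : 0 < dblArea v) (hm : ∀ i, StrictMono (u i)) (p : Lat × Fin 3) :
    BicoloredGraph.IsTarget (torusEdge v u p) (torusFace v u (boxIndex (p.1 - step p.2))) :=
  ⟨_, _, rfl, (isPlaneTarget_dualEdge hv hm p.1 p.2).mono fun _ hε => ⟨_, hε, rfl⟩⟩

theorem torusFace_mem_faces (hv : 0 < dblArea v) (h : IsGrid v u) (a : Lat) :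
    torusFace v u (boxIndex a) ∈ (tilingGraph v u).faces := by
  rw [faces_tilingGraph hv h]
  exact ⟨⟨_, sum_boxIndex a⟩, rfl⟩

theorem exists_torusFace_eq (hv : 0 < dblArea v) (h : IsGrid v u) {F : Set Torus}
    (hF : F ∈ (tilingGraph v u).faces) : ∃ a, torusFace v u (boxIndex a) = F := by
  rw [faces_tilingGraph hv h] at hF
  obtain ⟨⟨c, hc⟩, rfl⟩ := hF
  obtain ⟨a, rfl⟩ := exists_boxIndex_eq hc
  exact ⟨a, rfl⟩

theorem torusEdge_mem_edges (p : Lat × Fin 3) : torusEdge v u p ∈ (tilingGraph v u).edges :=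
  ⟨_, p.2, sum_whiteIndex p.1 p.2, rfl⟩

theorem exists_torusEdge_eq {e : C(unitInterval, Torus)} (he : e ∈ (tilingGraph v u).edges) :
    ∃ p, torusEdge v u p = e := by
  obtain ⟨c, i, hc, rfl⟩ := he
  obtain ⟨a, rfl⟩ := exists_whiteIndex_eq i hc
  exact ⟨(a, i), rfl⟩

end

section

/-! ### One-dimensional representations -/

section Characters

variable {H : Type} [Group H]

theorem charRep_character (χ : H →* ℂˣ) (g : H) : (charRep χ).character g = χ g := by
  have : (charRep χ).ρ g = ((χ g : ℂˣ) : ℂ) • (LinearMap.id : ℂ →ₗ[ℂ] ℂ) := by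
    ext; rfl
  change LinearMap.trace ℂ ℂ ((charRep χ).ρ g) = _
  rw [this]
  simp

/-- The summands are the values of the character χ/χ', and a nontrivial character sums to zero. -/
theorem sum_char_mul_inv [Fintype H] [DecidableEq (H →* ℂˣ)] (χ χ' : H →* ℂˣ) :
    ∑ g, ((χ g : ℂˣ) : ℂ) * ((χ' g⁻¹ : ℂˣ) : ℂ) = if χ = χ' then (Nat.card H : ℂ) else 0 := by
  have hsum : ∀ g, ((χ g : ℂˣ) : ℂ) * ((χ' g⁻¹ : ℂˣ) : ℂ) = (Units.coeHom ℂ).comp (χ / χ') g := by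
    intro g
    simp [div_eq_mul_inv]
  simp only [hsum]
  split_ifs with h
  · subst h
    simp
  · refine sum_hom_units_eq_zero _ fun h1 => h ?_
    ext g
    have h2 := DFunLike.congr_fun h1 g
    have h3 : χ g / χ' g = 1 := Units.ext h2
    rw [div_eq_one.1 h3]

theorem simple_charRep [Finite H] (χ : H →* ℂˣ) : Simple (charRep χ) := by
  have := Fintype.ofFinite H
  classical
  rw [FDRep.simple_iff_char_is_norm_one]
  simp only [charRep_character]
  rw [sum_char_mul_inv, if_pos rfl]

theorem charRep_iso_iff {χ χ' : H →* ℂˣ} : Nonempty (charRep χ ≅ charRep χ') ↔ χ = χ' := by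
  constructor
  · rintro ⟨i⟩
    ext g
    rw [← charRep_character, FDRep.char_iso i, charRep_character]
  · rintro rfl
    exact ⟨Iso.refl _⟩

end Characters

/-! ### Characters of the group of a triangle -/

variable {v : Fin 3 → Lat}

theorem latChar_apply (a : Lat) (g : triangleGroup v) :
    latChar v a g = coordChar v 0 g ^ a 0 * coordChar v 1 g ^ a 1 := rfl

theorem latChar_add (a b : Lat) : latChar v (a + b) = latChar v a * latChar v b := by
  ext1 g
  simp only [MonoidHom.mul_apply, latChar_apply, Pi.add_apply, zpow_add]
  exact mul_mul_mul_comm _ _ _ _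

theorem latChar_smul (a : Lat) (n : ℤ) (g : triangleGroup v) :
    latChar v (n • a) g = latChar v a g ^ n := by
  simp only [latChar_apply, mul_zpow, ← zpow_mul, Pi.smul_apply, smul_eq_mul, mul_comm n]

theorem coordChar_apply (i : Fin 3) (g : triangleGroup v) :
    ((coordChar v i g : ℂˣ) : ℂ) = g.1.1 i i := rfl

theorem matrix_eq_diagonal (g : triangleGroup v) :
    g.1.1 = Matrix.diagonal fun i => ((coordChar v i g : ℂˣ) : ℂ) := by
  obtain ⟨t, ht, -⟩ := g.2
  simp only [coordChar_apply]
  rw [ht]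
  simp

theorem prod_coordChar_zpow (g : triangleGroup v) (k : Fin 2) :
    ∏ i, coordChar v i g ^ v i k = 1 := by
  obtain ⟨t, ht, hk⟩ := g.2
  have : ∀ i, coordChar v i g = t i := by
    intro i
    ext
    rw [coordChar_apply, ht, Matrix.diagonal_apply_eq]
  simp only [this, hk]

theorem prod_coordChar (g : triangleGroup v) :
    coordChar v 0 g * coordChar v 1 g * coordChar v 2 g = 1 := by
  have h := g.1.2
  rw [matrix_eq_diagonal, Matrix.det_diagonal, Fin.prod_univ_three] at h
  ext
  simpa using h

theorem latChar_step (i : Fin 3) : latChar v (step i) = coordChar v i := by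
  ext1 g
  rw [latChar_apply]
  fin_cases i
  · simp [step]
  · simp [step]
  · have := prod_coordChar g
    simp only [step, Fin.reduceFinMk, Matrix.cons_val, Matrix.cons_val_zero, Matrix.cons_val_one,
      zpow_neg, zpow_one]
    rw [← mul_inv, inv_eq_iff_mul_eq_one, this]

theorem latChar_sub_step (a : Lat) (i : Fin 3) :
    latChar v (a - step i) = latChar v a * (coordChar v i)⁻¹ := by
  ext1 g
  rw [MonoidHom.mul_apply, MonoidHom.inv_apply, eq_mul_inv_iff_mul_eq, ← latChar_step,
    ← MonoidHom.mul_apply, ← latChar_add, sub_add_cancel]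

/-- After elimination of π₂ by the determinant condition, the equations of the group say that π₀ and
π₁ with exponents (v₀ − v₂)_k and (v₁ − v₂)_k multiply to 1. Raise these to the powers m_k and
multiply. -/
theorem latChar_psi (m : Lat) : latChar v (psi v m) = 1 := by
  ext1 g
  have h2 : coordChar v 2 g = (coordChar v 0 g)⁻¹ * (coordChar v 1 g)⁻¹ := by
    rw [← mul_inv, eq_inv_iff_mul_eq_one, mul_comm, prod_coordChar]
  have hk : ∀ k, coordChar v 0 g ^ (v 0 k - v 2 k) * coordChar v 1 g ^ (v 1 k - v 2 k) = 1 := by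
    intro k
    have := prod_coordChar_zpow g k
    rw [Fin.prod_univ_three, h2, mul_zpow, inv_zpow', inv_zpow'] at this
    rw [← this, sub_eq_add_neg, sub_eq_add_neg, zpow_add, zpow_add]
    exact mul_mul_mul_comm _ _ _ _
  have h0 := congrArg (· ^ m 0) (hk 0)
  have h1 := congrArg (· ^ m 1) (hk 1)
  simp only [mul_zpow, one_zpow, ← zpow_mul] at h0 h1
  rw [latChar_apply, MonoidHom.one_apply, psi]
  simp only [Fin.sum_univ_two, Matrix.cons_val_zero, Matrix.cons_val_one, zpow_add]
  rw [mul_mul_mul_comm, h0, h1, one_mul]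

/-- The witness is the adjugate matrix of ψ applied to a. It follows that `dblArea v` annihilates
all coordinate characters. -/
theorem exists_psi_eq (v : Fin 3 → Lat) (a : Lat) : ∃ m, psi v m = dblArea v • a := by
  refine ⟨![side v 1 1 * -a 1 + side v 0 1 * -a 0, side v 1 0 * a 1 + side v 0 0 * a 0], ?_⟩
  ext i
  fin_cases i <;> simp [psi, side, dblArea] <;> ring

theorem coordChar_pow_dblArea (i : Fin 3) (g : triangleGroup v) :
    coordChar v i g ^ dblArea v = 1 := by
  obtain ⟨m, hm⟩ := exists_psi_eq v (step i)
  rw [← latChar_step, ← latChar_smul, ← hm, latChar_psi, MonoidHom.one_apply]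

theorem triangleGroup_ext {g h : triangleGroup v} (h0 : coordChar v 0 g = coordChar v 0 h)
    (h1 : coordChar v 1 g = coordChar v 1 h) : g = h := by
  have hg := prod_coordChar g
  have hh := prod_coordChar h
  rw [h0, h1, ← hh, mul_right_inj] at hg
  apply Subtype.ext
  apply Subtype.ext
  rw [matrix_eq_diagonal, matrix_eq_diagonal]
  congr 1
  ext i
  fin_cases i
  exacts [congrArg _ h0, congrArg _ h1, congrArg _ hg]

theorem finite_triangleGroup (hv : 0 < dblArea v) : Finite (triangleGroup v) := by
  obtain ⟨D, hD⟩ := Int.eq_ofNat_of_zero_le hv.le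
  have : NeZero D := ⟨by omega⟩
  have hr : ∀ i (g : triangleGroup v), coordChar v i g ∈ rootsOfUnity D ℂ := by
    intro i g
    rw [mem_rootsOfUnity]
    have := coordChar_pow_dblArea i g
    rw [hD] at this
    simpa using this
  refine Finite.of_injective (β := rootsOfUnity D ℂ × rootsOfUnity D ℂ)
    (fun g => (⟨_, hr 0 g⟩, ⟨_, hr 1 g⟩)) fun g h hgh => ?_
  obtain ⟨h0, h1⟩ := Prod.ext_iff.1 hgh
  exact triangleGroup_ext (congrArg Subtype.val h0) (congrArg Subtype.val h1)

theorem exists_mem_triangleGroup (t₀ t₁ : ℂˣ)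
    (h : ∀ k, t₀ ^ (v 0 k - v 2 k) * t₁ ^ (v 1 k - v 2 k) = 1) :
    ∃ g : triangleGroup v, coordChar v 0 g = t₀ ∧ coordChar v 1 g = t₁ := by
  set t : Fin 3 → ℂˣ := ![t₀, t₁, t₀⁻¹ * t₁⁻¹]
  have hdet : (Matrix.diagonal fun i => (t i : ℂ)).det = 1 := by
    rw [Matrix.det_diagonal, Fin.prod_univ_three, ← Units.val_mul, ← Units.val_mul]
    simp only [t, Matrix.cons_val_zero, Matrix.cons_val_one, Matrix.cons_val]
    rw [← mul_inv, mul_inv_cancel, Units.val_one]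
  refine ⟨⟨⟨_, hdet⟩, t, rfl, fun k => ?_⟩, ?_, ?_⟩
  · rw [← h k, Fin.prod_univ_three, sub_eq_add_neg, sub_eq_add_neg, zpow_add, zpow_add]
    simp only [t, Matrix.cons_val_zero, Matrix.cons_val_one, Matrix.cons_val, mul_zpow, inv_zpow']
    exact mul_mul_mul_comm _ _ _ _
  · ext
    rw [coordChar_apply]
    simp [t]
  · ext
    rw [coordChar_apply]
    simp [t]

/-- Test the character on group elements with entries (ζ^α, ζ^β), where ζ is a primitive root of
unity of order `dblArea v`. Exponents taken from the adjugate of ψ give two divisibilities, whose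
quotients are the coordinates of m by Cramer's rule. -/
theorem latChar_eq_one_iff (hv : 0 < dblArea v) (a : Lat) :
    latChar v a = 1 ↔ ∃ m, a = psi v m := by
  refine ⟨fun h => ?_, fun ⟨m, hm⟩ => hm ▸ latChar_psi m⟩
  obtain ⟨D, hD⟩ := Int.eq_ofNat_of_zero_le hv.le
  have hD0 : D ≠ 0 := by omega
  have hζ := Complex.isPrimitiveRoot_exp D hD0
  set ζ : ℂˣ := (hζ.isUnit hD0).unit
  have hζ' : IsPrimitiveRoot ζ D := hζ.isUnit_unit hD0
  have key : ∀ α β : ℤ, (∀ k, dblArea v ∣ α * (v 0 k - v 2 k) + β * (v 1 k - v 2 k)) →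
      dblArea v ∣ α * a 0 + β * a 1 := by
    intro α β hk
    obtain ⟨g, h0, h1⟩ := exists_mem_triangleGroup (v := v) (ζ ^ α) (ζ ^ β) fun k => by
      rw [← zpow_mul, ← zpow_mul, ← zpow_add, hζ'.zpow_eq_one_iff_dvd, ← hD]
      exact hk k
    have := DFunLike.congr_fun h g
    rw [latChar_apply, h0, h1, MonoidHom.one_apply, ← zpow_mul, ← zpow_mul, ← zpow_add,
      hζ'.zpow_eq_one_iff_dvd, ← hD] at this
    exact this
  obtain ⟨m₀, hm₀⟩ := key (v 1 1 - v 2 1) (-(v 0 1 - v 2 1)) fun k => by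
    fin_cases k
    · exact ⟨1, by simp [dblArea]; ring⟩
    · exact ⟨0, by simp; ring⟩
  obtain ⟨m₁, hm₁⟩ := key (-(v 1 0 - v 2 0)) (v 0 0 - v 2 0) fun k => by
    fin_cases k
    · exact ⟨0, by simp; ring⟩
    · exact ⟨1, by simp [dblArea]; ring⟩
  have hA : dblArea v = (v 0 0 - v 2 0) * (v 1 1 - v 2 1) - (v 0 1 - v 2 1) * (v 1 0 - v 2 0) := by
    simp [dblArea]; ring
  refine ⟨![m₀, m₁], ?_⟩
  ext i
  apply mul_left_cancel₀ hv.ne'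
  fin_cases i
  · change dblArea v * a 0 = dblArea v * psi v ![m₀, m₁] 0
    simp only [psi, Fin.sum_univ_two, Matrix.cons_val_zero, Matrix.cons_val_one]
    linear_combination (v 0 0 - v 2 0) * hm₀ + (v 0 1 - v 2 1) * hm₁ + a 0 * hA
  · change dblArea v * a 1 = dblArea v * psi v ![m₀, m₁] 1
    simp only [psi, Fin.sum_univ_two, Matrix.cons_val_zero, Matrix.cons_val_one]
    linear_combination (v 1 0 - v 2 0) * hm₀ + (v 1 1 - v 2 1) * hm₁ + a 1 * hA

theorem latChar_eq_iff (hv : 0 < dblArea v) (a b : Lat) :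
    latChar v a = latChar v b ↔ ∃ m, b = a + psi v m := by
  have h : latChar v b = latChar v a * latChar v (b - a) := by
    rw [← latChar_add, add_sub_cancel]
  have h' : latChar v a = latChar v b ↔ latChar v (b - a) = 1 := by
    rw [h]
    constructor
    · intro h1
      ext1 g
      have h2 := DFunLike.congr_fun h1 g
      rw [MonoidHom.mul_apply] at h2
      exact left_eq_mul.1 h2
    · intro h1
      ext1 g
      rw [h1, MonoidHom.mul_apply, MonoidHom.one_apply, mul_one]
  rw [h', latChar_eq_one_iff hv]
  exact exists_congr fun m => sub_eq_iff_eq_add'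

theorem sum_pow_eq_zero {z : ℂ} {D : ℕ} (hz : z ^ D = 1) (h1 : z ≠ 1) :
    ∑ j ∈ Finset.range D, z ^ j = 0 := by
  have := geom_sum_mul z D
  rw [hz, sub_self] at this
  exact (mul_eq_zero.1 this).resolve_right (sub_ne_zero.2 h1)

/-- Suppose that X is none of these characters. Then its character is orthogonal to all π₀^i π₁^j
with 0 ≤ i, j < D, hence to their sum, which is D² at the identity and 0 elsewhere. So X has
dimension zero, which contradicts that its character has norm one. -/
theorem exists_iso_charRep (hv : 0 < dblArea v) (X : FDRep ℂ (triangleGroup v)) [Simple X] :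
    ∃ a, Nonempty (X ≅ charRep (latChar v a)) := by
  have := finite_triangleGroup hv
  have := Fintype.ofFinite (triangleGroup v)
  have hcard : (Nat.card (triangleGroup v) : ℂ) ≠ 0 := Nat.cast_ne_zero.2 Nat.card_pos.ne'
  have := invertibleOfNonzero hcard
  classical
  by_contra! hcon
  obtain ⟨D, hD⟩ := Int.eq_ofNat_of_zero_le hv.le
  have h1 : ∀ i j : ℕ, ∑ g, X.character g *
      (((coordChar v 0 g⁻¹ : ℂˣ) : ℂ) ^ i * ((coordChar v 1 g⁻¹ : ℂˣ) : ℂ) ^ j) = 0 := by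
    intro i j
    have := simple_charRep (latChar v ![(i : ℤ), (j : ℤ)])
    have h := FDRep.char_orthonormal X (charRep (latChar v ![(i : ℤ), (j : ℤ)]))
    rw [if_neg (by simpa using hcon _)] at h
    have h := (mul_eq_zero.1 h).resolve_left (inv_ne_zero hcard)
    simpa [charRep_character, latChar_apply] using h
  have h2 : ∑ g, X.character g * ((∑ i ∈ Finset.range D, ((coordChar v 0 g⁻¹ : ℂˣ) : ℂ) ^ i) *
      ∑ j ∈ Finset.range D, ((coordChar v 1 g⁻¹ : ℂˣ) : ℂ) ^ j) = 0 := by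
    simp only [Finset.sum_mul_sum]
    simp only [Finset.mul_sum]
    rw [Finset.sum_comm]
    refine Finset.sum_eq_zero fun i _ => ?_
    rw [Finset.sum_comm]
    exact Finset.sum_eq_zero fun j _ => h1 i j
  have hpow : ∀ i (g : triangleGroup v), ((coordChar v i g : ℂˣ) : ℂ) ^ D = 1 := by
    intro i g
    have := coordChar_pow_dblArea i g
    rw [hD] at this
    simpa using congrArg Units.val this
  -- For g ≠ 1 one of the two factors is a full geometric sum over a root of unity different from 1.
  rw [Finset.sum_eq_single 1] at h2
  · simp only [inv_one, map_one, Units.val_one, one_pow, Finset.sum_const, Finset.card_range,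
      FDRep.char_one] at h2
    have hD0 : (D : ℂ) ≠ 0 := Nat.cast_ne_zero.2 (by omega)
    have hX : Module.finrank ℂ X = 0 := by
      rcases mul_eq_zero.1 h2 with h | h
      · exact_mod_cast h
      · simp [hD0] at h
    have hsub : Subsingleton X := Module.finrank_zero_iff.1 hX
    have hch : ∀ g, X.character g = 0 := fun g => by
      rw [FDRep.character, Subsingleton.elim (X.ρ g) 0, map_zero]
    have h4 := (FDRep.simple_iff_char_is_norm_one X).1 inferInstance
    simp only [hch, zero_mul, Finset.sum_const_zero] at h4
    exact hcard h4.symm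
  · intro g _ hg
    have : coordChar v 0 g⁻¹ ≠ 1 ∨ coordChar v 1 g⁻¹ ≠ 1 := by
      by_contra! hcon
      refine hg (inv_eq_one.1 (triangleGroup_ext ?_ ?_))
      · rw [hcon.1, map_one]
      · rw [hcon.2, map_one]
    rcases this with h | h
    · rw [sum_pow_eq_zero (hpow 0 _) (by simpa using h), zero_mul, mul_zero]
    · rw [sum_pow_eq_zero (hpow 1 _) (by simpa using h), mul_zero, mul_zero]
  · simp

/-! ### The McKay quiver -/

theorem naturalRep_dual_character (g : triangleGroup v) :
    (FDRep.of (naturalRep (triangleGroup v)).dual).character g =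
      ∑ i, ((coordChar v i g⁻¹ : ℂˣ) : ℂ) := by
  have h : (FDRep.of (naturalRep (triangleGroup v)).dual).character g =
      (naturalRep (triangleGroup v)).dual.character g := rfl
  rw [h, Representation.char_dual, Representation.character]
  change LinearMap.trace ℂ (Fin 3 → ℂ) (Matrix.toLin' (g⁻¹).1.1) = _
  rw [matrix_eq_diagonal, Matrix.trace_toLin'_eq, Matrix.trace_diagonal]

/-- The dual natural representation has as character the sum of the inverse coordinate characters.
The tensor product therefore has as character the sum of the `latChar v (a - step i)`, and
orthogonality counts those equal to `latChar v b`. -/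
theorem mckayNumber_eq (hv : 0 < dblArea v) {σ τ : Irr (triangleGroup v)} {a b : Lat}
    (hσ : Nonempty (σ.rep ≅ charRep (latChar v a)))
    (hτ : Nonempty (τ.rep ≅ charRep (latChar v b))) :
    mckayNumber σ τ = Nat.card {i // latChar v (a - step i) = latChar v b} := by
  have := finite_triangleGroup hv
  have := Fintype.ofFinite (triangleGroup v)
  have hcard : (Nat.card (triangleGroup v) : ℂ) ≠ 0 := Nat.cast_ne_zero.2 Nat.card_pos.ne'
  have := invertibleOfNonzero hcard
  classical
  obtain ⟨iσ⟩ := hσ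
  obtain ⟨iτ⟩ := hτ
  have h := FDRep.scalar_product_char_eq_finrank_equivariant τ.rep
    (MonoidalCategoryStruct.tensorObj σ.rep (FDRep.of (naturalRep (triangleGroup v)).dual))
  have hsum : ∀ g : triangleGroup v,
      (MonoidalCategoryStruct.tensorObj σ.rep
        (FDRep.of (naturalRep (triangleGroup v)).dual)).character g * τ.rep.character g⁻¹ =
      ∑ i, ((latChar v (a - step i) g : ℂˣ) : ℂ) * ((latChar v b g⁻¹ : ℂˣ) : ℂ) := by
    intro g
    rw [FDRep.char_tensor, Pi.mul_apply, naturalRep_dual_character, FDRep.char_iso iσ,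
      FDRep.char_iso iτ, charRep_character, charRep_character, Finset.mul_sum, Finset.sum_mul]
    refine Finset.sum_congr rfl fun i _ => ?_
    rw [latChar_sub_step, MonoidHom.mul_apply, MonoidHom.inv_apply, map_inv, Units.val_mul]
  simp only [hsum] at h
  rw [Finset.sum_comm] at h
  simp only [sum_char_mul_inv] at h
  rw [← Finset.sum_filter, Finset.sum_const, nsmul_eq_mul, mul_comm, mul_assoc,
    mul_inv_cancel₀ hcard, mul_one] at h
  rw [Nat.card_eq_fintype_card, Fintype.card_subtype]
  exact (Nat.cast_injective h).symm

/-- The class of the character with label `a`. -/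
def classOf (hv : 0 < dblArea v) (a : Lat) : Irr (triangleGroup v) :=
  have := finite_triangleGroup hv
  Quotient.mk (irrSetoid (triangleGroup v)) ⟨charRep (latChar v a), simple_charRep _⟩

theorem classOf_rep_iso (hv : 0 < dblArea v) (a : Lat) :
    Nonempty ((classOf hv a).rep ≅ charRep (latChar v a)) :=
  Quotient.exact (s := irrSetoid (triangleGroup v)) (Quotient.out_eq (classOf hv a))

theorem classOf_eq_iff (hv : 0 < dblArea v) (a b : Lat) :
    classOf hv a = classOf hv b ↔ latChar v a = latChar v b := by
  rw [← charRep_iso_iff]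
  exact Quotient.eq (r := irrSetoid (triangleGroup v))

theorem classOf_surjective (hv : 0 < dblArea v) : Function.Surjective (classOf hv) := by
  intro σ
  obtain ⟨⟨X, hX⟩, rfl⟩ := Quotient.exists_rep (s := irrSetoid (triangleGroup v)) σ
  obtain ⟨a, ⟨i⟩⟩ := exists_iso_charRep hv X
  exact ⟨a, Quotient.sound (s := irrSetoid (triangleGroup v)) ⟨i.symm⟩⟩

theorem mckayNumber_classOf (hv : 0 < dblArea v) (a b : Lat) :
    mckayNumber (classOf hv a) (classOf hv b) =
      Nat.card {i // classOf hv (a - step i) = classOf hv b} := by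
  simp only [classOf_eq_iff]
  exact mckayNumber_eq hv (classOf_rep_iso hv a) (classOf_rep_iso hv b)

/-- For a fixed source, the three directions are distributed over the targets with fibres of size
`mckayNumber`. Arbitrary bijections on these fibres number the arrows. -/
theorem exists_mckayArrow_equiv (hv : 0 < dblArea v) :
    ∃ η : Irr (triangleGroup v) × Fin 3 ≃ McKayArrow (triangleGroup v), ∀ a i,
      (η (classOf hv a, i)).source = classOf hv a ∧
        (η (classOf hv a, i)).target = classOf hv (a - step i) := by
  choose lab hlab using classOf_surjective hv
  set tgt : Irr (triangleGroup v) → Fin 3 → Irr (triangleGroup v) :=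
    fun σ i => classOf hv (lab σ - step i) with htgt
  have htgt' : ∀ a i, tgt (classOf hv a) i = classOf hv (a - step i) := by
    intro a i
    have := hlab (classOf hv a)
    simp only [htgt]
    rw [classOf_eq_iff] at this ⊢
    rw [latChar_sub_step, latChar_sub_step, this]
  have hE : ∀ σ τ, Nonempty ({i // tgt σ i = τ} ≃ Fin (mckayNumber σ τ)) := by
    intro σ τ
    obtain ⟨b, rfl⟩ := classOf_surjective hv τ
    have h := mckayNumber_classOf hv (lab σ) b
    rw [hlab] at h
    rw [h]
    exact ⟨Finite.equivFin _⟩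
  let E : ∀ σ τ, {i // tgt σ i = τ} ≃ Fin (mckayNumber σ τ) := fun σ τ => (hE σ τ).some
  let η₀ : Irr (triangleGroup v) × Fin 3 → McKayArrow (triangleGroup v) :=
    fun p => ⟨p.1, tgt p.1 p.2, E p.1 _ ⟨p.2, rfl⟩⟩
  have aux : ∀ σ τ τ' (p : {i // tgt σ i = τ}) (q : {i // tgt σ i = τ'}), τ = τ' →
      HEq (E σ τ p) (E σ τ' q) → p.1 = q.1 := by
    rintro σ τ _ p q rfl h
    exact congrArg Subtype.val ((E σ τ).injective (eq_of_heq h))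
  have hη : Function.Bijective η₀ := by
    constructor
    · rintro ⟨σ, i⟩ ⟨σ', i'⟩ h
      obtain ⟨h1, h2, h3⟩ := McKayArrow.mk.inj h
      dsimp only at h1
      subst h1
      rw [show i = i' from aux _ _ _ _ _ h2 h3]
    · rintro ⟨σ, τ, k⟩
      obtain ⟨⟨i, rfl⟩, hk⟩ := (E σ τ).surjective k
      exact ⟨(σ, i), by simp only [η₀, hk]⟩
  exact ⟨Equiv.ofBijective η₀ hη, fun a i => ⟨rfl, htgt' a i⟩⟩

end

section

variable {v : Fin 3 → Lat} {u : Fin 3 → ℤ → ℝ}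

/-- Faces and irreducible representations are both the quotient of M₁ by ψ(M). Edges and McKay
arrows are both this quotient times the three directions. -/
theorem isDualToMcKayQuiver_tilingGraph (hv : 0 < dblArea v) (h : IsGrid v u) :
    IsDualToMcKayQuiver v (tilingGraph v u) := by
  obtain ⟨φ, hφ⟩ := exists_equiv_of_surjective
    (f := fun a : Lat => (⟨_, torusFace_mem_faces hv h a⟩ : (tilingGraph v u).faces))
    (g := classOf hv)
    (fun F => (exists_torusFace_eq hv h F.2).imp fun a ha => Subtype.ext ha)
    (classOf_surjective hv)
    (fun a b => by
      rw [Subtype.mk.injEq, torusFace_boxIndex_eq_iff hv h, classOf_eq_iff, latChar_eq_iff hv])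
  obtain ⟨κ, hκ⟩ := exists_equiv_of_surjective
    (f := fun p : Lat × Fin 3 => (⟨_, torusEdge_mem_edges p⟩ : (tilingGraph v u).edges))
    (g := fun p => (classOf hv p.1, p.2))
    (fun e => (exists_torusEdge_eq e.2).imp fun a ha => Subtype.ext ha)
    (fun ⟨σ, i⟩ => by
      obtain ⟨a, rfl⟩ := classOf_surjective hv σ
      exact ⟨(a, i), rfl⟩)
    (fun p q => by
      rw [Subtype.mk.injEq, torusEdge_eq_iff hv h, Prod.mk.injEq, classOf_eq_iff,
        latChar_eq_iff hv])
  obtain ⟨η, hη⟩ := exists_mckayArrow_equiv hv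
  have hφ' : ∀ a, (φ.symm (classOf hv a)).1 = torusFace v u (boxIndex a) := fun a => by
    rw [← hφ, Equiv.symm_apply_apply]
  refine isDualToMcKayQuiver_of_iso hv h φ (κ.trans η) ?_ ?_
  · rintro ⟨e, he⟩
    obtain ⟨p, rfl⟩ := exists_torusEdge_eq he
    rw [Equiv.trans_apply, hκ p, (hη _ _).1, (hη _ _).2, hφ', hφ']
    exact ⟨isSource_torusEdge hv h.mono p, isTarget_torusEdge hv h.mono p⟩
  · intro a F hF
    obtain ⟨b, hb⟩ := exists_torusFace_eq hv h F.2
    have hne : (torusFace v u (boxIndex a)).Nonempty := (hexFace_nonempty hv h.mono _).image _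
    rw [← hb] at hF
    -- Torus faces are equal or disjoint, so the inclusion already forces F to be the face with
    -- label a.
    obtain ⟨m, hm⟩ := exists_shift_of_torusFace_inter h
      ((sum_boxIndex a).trans (sum_boxIndex b).symm)
      (by rwa [Set.inter_eq_left.2 hF])
    have hab : torusFace v u (boxIndex a) = torusFace v u (boxIndex b) := by
      rw [hm, torusFace_add_shift h]
    have hFa : F = ⟨_, torusFace_mem_faces hv h a⟩ := Subtype.ext (hb.symm.trans hab.symm)
    rw [hFa, hφ a]
    exact classOf_rep_iso hv a

end

section

variable {v : Fin 3 → Lat} {u : Fin 3 → ℤ → ℝ}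

/-! ### The arrangement of a grid -/

/-- The slope of the lines of the `i`-th family. -/
def lineSlope (v : Fin 3 → Lat) (i : Fin 3) : Lat :=
  ![side v i 1 / mult v i, -(side v i 0 / mult v i)]

theorem mult_dvd (v : Fin 3 → Lat) (i : Fin 3) (j : Fin 2) : (mult v i : ℤ) ∣ side v i j := by
  fin_cases j
  exacts [Int.gcd_dvd_left .., Int.gcd_dvd_right ..]

theorem mult_mul_div (v : Fin 3 → Lat) (i : Fin 3) (j : Fin 2) :
    (mult v i : ℤ) * (side v i j / mult v i) = side v i j := Int.mul_ediv_cancel' (mult_dvd v i j)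

theorem mult_cast_pos (hv : 0 < dblArea v) (i : Fin 3) : (0 : ℝ) < mult v i :=
  Nat.cast_pos.2 (mult_pos hv i)

theorem isCoprime_side_div (hv : 0 < dblArea v) (i : Fin 3) :
    IsCoprime (side v i 0 / mult v i) (side v i 1 / mult v i) :=
  Int.isCoprime_iff_gcd_eq_one.2 (Int.gcd_ediv_gcd_ediv_gcd (mult_pos hv i))

theorem primitive_lineSlope (hv : 0 < dblArea v) (i : Fin 3) : Primitive (lineSlope v i) := by
  have := (isCoprime_side_div hv i).symm.neg_right
  simpa [Primitive, lineSlope] using this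

theorem cross_lineSlope (hv : 0 < dblArea v) (i : Fin 3) (x : Plane) :
    cross (lineSlope v i) x = coord v i x / mult v i := by
  have hk := (mult_cast_pos hv i).ne'
  have h0 : (mult v i : ℝ) * ((side v i 0 / mult v i : ℤ) : ℝ) = side v i 0 := by
    exact_mod_cast mult_mul_div v i 0
  have h1 : (mult v i : ℝ) * ((side v i 1 / mult v i : ℤ) : ℝ) = side v i 1 := by
    exact_mod_cast mult_mul_div v i 1
  rw [eq_div_iff hk, cross, coord_apply, ← h0, ← h1]
  simp [lineSlope]
  ring

/-- Two of the coordinates are linearly independent: some point has i-th coordinate 0 and j-th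
coordinate 1. -/
theorem lineSlope_injective (hv : 0 < dblArea v) : Function.Injective (lineSlope v) := by
  intro i j hij
  by_contra hne
  obtain ⟨y, hi, hj, hs⟩ : ∃ y : Fin 3 → ℝ, y i = 0 ∧ y j = 1 ∧ ∑ l, y l = 0 := by
    have : ∀ i j : Fin 3, i ≠ j → ∃ k, k ≠ i ∧ k ≠ j := by decide
    obtain ⟨k, hki, hkj⟩ := this i j hne
    refine ⟨Pi.single j 1 + Pi.single k (-1), by simp [hne, hki.symm], by simp [hkj.symm], ?_⟩
    simp [Finset.sum_add_distrib]
  have h1 := cross_lineSlope hv i (pt v y)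
  have h2 := cross_lineSlope hv j (pt v y)
  rw [← hij, h1, coord_pt_of_sum_eq_zero hv hs, coord_pt_of_sum_eq_zero hv hs, hi, hj, zero_div]
    at h2
  have := mult_cast_pos hv j
  exact (one_div_pos.2 this).ne h2

/-- The lines of the arrangement that is presented by a grid. -/
def gridLines (v : Fin 3 → Lat) (u : Fin 3 → ℤ → ℝ) : Set OrientedLine :=
  {L | ∃ i b, L.slope = lineSlope v i ∧ L.pos = ((u i b / mult v i : ℝ) : UnitAddCircle)}

/-- The line of the `i`-th family with the given value of the coordinate. -/
def lineOf (hv : 0 < dblArea v) (i : Fin 3) (c : ℝ) : OrientedLine :=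
  ⟨lineSlope v i, primitive_lineSlope hv i, ((c / mult v i : ℝ) : UnitAddCircle)⟩

theorem lineOf_mem_gridLines (hv : 0 < dblArea v) (i : Fin 3) (b : ℤ) :
    lineOf hv i (u i b) ∈ gridLines v u := ⟨i, b, rfl, rfl⟩

theorem proj_mem_carrier_iff (L : OrientedLine) (x : Plane) :
    proj x ∈ L.carrier ↔ ((cross L.slope x : ℝ) : UnitAddCircle) = L.pos := by
  have : ((cross L.slope x : ℝ) : UnitAddCircle) =
      L.slope 0 • proj x 1 - L.slope 1 • proj x 0 := by
    simp only [proj, ← AddCircle.coe_zsmul, ← AddCircle.coe_sub, cross, zsmul_eq_mul]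
  rw [this]
  rfl

theorem coe_div_mult_eq_iff (hv : 0 < dblArea v) (h : IsGrid v u) {i : Fin 3} {c : ℝ} {b : ℤ} :
    (∃ n : ℤ, c = u i b / mult v i + n) ↔ ∃ n : ℤ, c = u i (b + n * mult v i) / mult v i := by
  have hk := (mult_cast_pos hv i).ne'
  refine exists_congr fun n => ?_
  rw [h.periodic_mul, add_div, mul_div_cancel_right₀ _ hk]

/-- By quasi-periodicity, every real representative of the position of a line is given by some index
of the grid. -/
theorem exists_of_mem_gridLines (hv : 0 < dblArea v) (h : IsGrid v u) {L : OrientedLine}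
    (hL : L ∈ gridLines v u) {c : ℝ} (hc : (c : UnitAddCircle) = L.pos) :
    ∃ i b, L.slope = lineSlope v i ∧ c = u i b / mult v i := by
  obtain ⟨i, b, hs, hp⟩ := hL
  rw [hp, eq_comm, coe_unitAddCircle_eq_iff, coe_div_mult_eq_iff hv h] at hc
  obtain ⟨n, hn⟩ := hc
  exact ⟨i, _, hs, hn⟩

theorem proj_mem_lineOf_carrier (hv : 0 < dblArea v) {i : Fin 3} {x : Plane} :
    proj x ∈ (lineOf hv i (coord v i x)).carrier := by
  rw [proj_mem_carrier_iff]
  change ((cross (lineSlope v i) x : ℝ) : UnitAddCircle) = _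
  rw [cross_lineSlope hv]
  rfl

theorem planeUnion_gridLines (hv : 0 < dblArea v) (h : IsGrid v u) :
    planeUnion (gridLines v u) = {x | ∃ i b, coord v i x = u i b} := by
  ext x
  constructor
  · rintro ⟨L, hL, hx⟩
    rw [proj_mem_carrier_iff] at hx
    obtain ⟨i, b, hs, hb⟩ := exists_of_mem_gridLines hv h hL hx
    rw [hs, cross_lineSlope hv, div_left_inj' (mult_cast_pos hv i).ne'] at hb
    exact ⟨i, b, hb⟩
  · rintro ⟨i, b, hb⟩
    exact ⟨_, lineOf_mem_gridLines hv i b, hb ▸ proj_mem_lineOf_carrier hv⟩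

/-! ### The cells of the arrangement -/

/-- The points in the plane between consecutive lines of each family. -/
def region (v : Fin 3 → Lat) (u : Fin 3 → ℤ → ℝ) (a : Fin 3 → ℤ) : Set Plane :=
  {x | ∀ i, u i (a i) < coord v i x ∧ coord v i x < u i (a i + 1)}

/-- The closed version of `region`. -/
def closedRegion (v : Fin 3 → Lat) (u : Fin 3 → ℤ → ℝ) (a : Fin 3 → ℤ) : Set Plane :=
  {x | ∀ i, u i (a i) ≤ coord v i x ∧ coord v i x ≤ u i (a i + 1)}

theorem isOpen_region (a : Fin 3 → ℤ) : IsOpen (region v u a) := by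
  simp only [region, Set.ofPred_forall]
  exact isOpen_iInter_of_finite fun i =>
    (isOpen_lt continuous_const (continuous_coord i)).inter
      (isOpen_lt (continuous_coord i) continuous_const)

theorem isClosed_closedRegion (a : Fin 3 → ℤ) : IsClosed (closedRegion v u a) := by
  simp only [closedRegion, Set.ofPred_forall]
  exact isClosed_iInter fun i =>
    (isClosed_le continuous_const (continuous_coord i)).inter
      (isClosed_le (continuous_coord i) continuous_const)

theorem region_subset_closedRegion (a : Fin 3 → ℤ) : region v u a ⊆ closedRegion v u a :=
  fun _ hx i => ⟨(hx i).1.le, (hx i).2.le⟩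

theorem combo_mem_region {a : Fin 3 → ℤ} {x y : Plane} (hx : x ∈ region v u a)
    (hy : y ∈ closedRegion v u a) {s t : ℝ} (hs : 0 < s) (ht : 0 ≤ t) (hst : s + t = 1) :
    s • x + t • y ∈ region v u a := by
  intro i
  obtain ⟨h1, h2⟩ := hx i
  obtain ⟨h3, h4⟩ := hy i
  rw [map_add, map_smul, map_smul, smul_eq_mul, smul_eq_mul]
  obtain rfl : t = 1 - s := by linarith
  constructor <;> nlinarith

theorem convex_region (a : Fin 3 → ℤ) : Convex ℝ (region v u a) := by
  intro x hx y hy s t hs ht hst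
  rcases hs.eq_or_lt with rfl | hs
  · obtain rfl : t = 1 := by linarith
    simpa using hy
  · exact combo_mem_region hx (region_subset_closedRegion a hy) hs ht hst

theorem closure_region {a : Fin 3 → ℤ} (hne : (region v u a).Nonempty) :
    closure (region v u a) = closedRegion v u a := by
  refine Set.Subset.antisymm
    (closure_minimal (region_subset_closedRegion a) (isClosed_closedRegion a)) fun y hy => ?_
  obtain ⟨x, hx⟩ := hne
  refine closure_mono ?_ (segment_subset_closure_openSegment (right_mem_segment ℝ x y))
  rintro _ ⟨s, t, hs, ht, hst, rfl⟩
  exact combo_mem_region hx hy hs ht.le hst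

theorem frontier_region {a : Fin 3 → ℤ} (hne : (region v u a).Nonempty) :
    frontier (region v u a) = closedRegion v u a \ region v u a := by
  rw [frontier, closure_region hne, (isOpen_region a).interior_eq]

theorem region_eq_of_inter (hm : ∀ i, StrictMono (u i)) {a a' : Fin 3 → ℤ}
    (h : (region v u a ∩ region v u a').Nonempty) : a = a' := by
  obtain ⟨x, hx, hx'⟩ := h
  ext i
  have h1 := (hm i).lt_iff_lt.1 ((hx i).1.trans (hx' i).2)
  have h2 := (hm i).lt_iff_lt.1 ((hx' i).1.trans (hx i).2)
  omega

theorem compl_planeUnion_gridLines (hv : 0 < dblArea v) (h : IsGrid v u) :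
    (planeUnion (gridLines v u))ᶜ =
      ⋃ a : {a : Fin 3 → ℤ // (region v u a).Nonempty}, region v u a.1 := by
  ext x
  rw [planeUnion_gridLines hv h, Set.mem_iUnion]
  constructor
  · intro hx
    choose a ha1 ha2 using fun i => exists_floor h hv i (coord v i x)
    have hxa : x ∈ region v u a := fun i =>
      ⟨(ha1 i).lt_of_ne fun he => hx ⟨i, _, he.symm⟩, ha2 i⟩
    exact ⟨⟨a, x, hxa⟩, hxa⟩
  · rintro ⟨⟨a, ha⟩, hx⟩ ⟨i, b, hb⟩
    change x ∈ region v u a at hx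
    obtain ⟨h1, h2⟩ := hx i
    rw [hb] at h1 h2
    have h3 := (h.mono i).lt_iff_lt.1 h1
    have h4 := (h.mono i).lt_iff_lt.1 h2
    omega

theorem isCell_gridLines_iff (hv : 0 < dblArea v) (h : IsGrid v u) {C : Set Plane} :
    IsCell (gridLines v u) C ↔ ∃ a, (region v u a).Nonempty ∧ C = region v u a := by
  have := setOf_connectedComponentIn_eq_range (compl_planeUnion_gridLines hv h)
    (fun a => isOpen_region a.1) (fun a => (convex_region a.1).isPreconnected)
    (fun a a' haa => by rw [region_eq_of_inter h.mono haa]) (fun a => a.2)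
  have h2 := Set.ext_iff.1 this C
  constructor
  · intro hC
    obtain ⟨⟨a, ha⟩, rfl⟩ := h2.1 hC
    exact ⟨a, ha, rfl⟩
  · rintro ⟨a, ha, rfl⟩
    exact h2.2 ⟨⟨a, ha⟩, rfl⟩

/-- The segment of the line with index `a i` of the `i`-th family between consecutive lines of the
other families. -/
def gridEdge (v : Fin 3 → Lat) (u : Fin 3 → ℤ → ℝ) (a : Fin 3 → ℤ) (i : Fin 3) : Set Plane :=
  {x | coord v i x = u i (a i) ∧ ∀ j ≠ i, u j (a j) ≤ coord v j x ∧ coord v j x ≤ u j (a j + 1)}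

theorem lift_eq (hv : 0 < dblArea v) {L : OrientedLine} {i : Fin 3} {r : ℝ}
    (hs : L.slope = lineSlope v i) : L.lift (r / mult v i) = {x | coord v i x = r} := by
  ext x
  rw [OrientedLine.lift, Set.mem_ofPred_eq, hs, cross_lineSlope hv,
    div_left_inj' (mult_cast_pos hv i).ne']
  rfl

theorem frontier_inter_lower (hm : ∀ i, StrictMono (u i)) {a : Fin 3 → ℤ}
    (hne : (region v u a).Nonempty) (i : Fin 3) :
    frontier (region v u a) ∩ {x | coord v i x = u i (a i)} = gridEdge v u a i := by
  rw [frontier_region hne]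
  ext x
  constructor
  · rintro ⟨⟨h1, -⟩, h2⟩
    exact ⟨h2, fun j _ => h1 j⟩
  · rintro ⟨h1, h2⟩
    refine ⟨⟨fun j => ?_, fun hx => (hx i).1.ne' h1⟩, h1⟩
    by_cases hj : j = i
    · subst hj
      rw [h1]
      exact ⟨le_rfl, (hm j (lt_add_one _)).le⟩
    · exact h2 j hj

theorem frontier_inter_upper (hm : ∀ i, StrictMono (u i)) {a : Fin 3 → ℤ}
    (hne : (region v u a).Nonempty) (i : Fin 3) :
    frontier (region v u a) ∩ {x | coord v i x = u i (a i + 1)} =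
      gridEdge v u (a + Pi.single i 1) i := by
  rw [frontier_region hne]
  ext x
  constructor
  · rintro ⟨⟨h1, -⟩, h2⟩
    exact ⟨by simpa using h2, fun j hj => by simpa [hj] using h1 j⟩
  · rintro ⟨h1, h2⟩
    have h1 : coord v i x = u i (a i + 1) := by simpa using h1
    refine ⟨⟨fun j => ?_, fun hx => (hx i).2.ne h1⟩, h1⟩
    by_cases hj : j = i
    · subst hj
      rw [h1]
      exact ⟨(hm j (lt_add_one _)).le, le_rfl⟩
    · simpa [hj] using h2 j hj

theorem isCellEdge_lower (hv : 0 < dblArea v) (hm : ∀ i, StrictMono (u i)) {a : Fin 3 → ℤ}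
    (hne : (region v u a).Nonempty) {i : Fin 3} {L : OrientedLine} (hL : L ∈ gridLines v u)
    (hs : L.slope = lineSlope v i) (hc : ((u i (a i) / mult v i : ℝ) : UnitAddCircle) = L.pos)
    (he : (gridEdge v u a i).Nontrivial) :
    IsCellEdge (gridLines v u) (region v u a) L (u i (a i) / mult v i) (gridEdge v u a i) :=
  ⟨hL, hc, by rw [lift_eq hv hs, frontier_inter_lower hm hne], he⟩

theorem isCellEdge_upper (hv : 0 < dblArea v) (hm : ∀ i, StrictMono (u i)) {a : Fin 3 → ℤ}
    (hne : (region v u a).Nonempty) {i : Fin 3} {L : OrientedLine} (hL : L ∈ gridLines v u)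
    (hs : L.slope = lineSlope v i)
    (hc : ((u i (a i + 1) / mult v i : ℝ) : UnitAddCircle) = L.pos)
    (he : (gridEdge v u (a + Pi.single i 1) i).Nontrivial) :
    IsCellEdge (gridLines v u) (region v u a) L (u i (a i + 1) / mult v i)
      (gridEdge v u (a + Pi.single i 1) i) :=
  ⟨hL, hc, by rw [lift_eq hv hs, frontier_inter_upper hm hne], he⟩

/-- No index lies strictly between a i and a i + 1, so a line of the i-th family that touches the
cell is one of its two bounding lines. -/
theorem cellEdge_cases (hv : 0 < dblArea v) (h : IsGrid v u) {a : Fin 3 → ℤ}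
    (hne : (region v u a).Nonempty) {L : OrientedLine} {c : ℝ} {e : Set Plane}
    (he : IsCellEdge (gridLines v u) (region v u a) L c e) :
    ∃ i, L.slope = lineSlope v i ∧ ((c = u i (a i) / mult v i ∧ e = gridEdge v u a i) ∨
      (c = u i (a i + 1) / mult v i ∧ e = gridEdge v u (a + Pi.single i 1) i)) := by
  obtain ⟨hL, hc, rfl, hnt⟩ := he
  obtain ⟨i, b, hs, rfl⟩ := exists_of_mem_gridLines hv h hL hc
  refine ⟨i, hs, ?_⟩
  rw [lift_eq hv hs] at hnt ⊢
  obtain ⟨x, hx, hxb⟩ := hnt.nonempty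
  rw [frontier_region hne] at hx
  obtain ⟨h1, h2⟩ := hx.1 i
  rw [show coord v i x = u i b from hxb] at h1 h2
  have h3 := (h.mono i).le_iff_le.1 h1
  have h4 := (h.mono i).le_iff_le.1 h2
  rcases h3.eq_or_lt with h5 | h5
  · left
    rw [← h5]
    exact ⟨rfl, frontier_inter_lower h.mono hne i⟩
  · right
    obtain rfl : b = a i + 1 := by omega
    exact ⟨rfl, frontier_inter_upper h.mono hne i⟩

/-! ### Existence of points with given coordinates -/

/-- Take the point of the segment from l to r where the sum, affine in the parameter, vanishes.
Degenerate coordinates with l i = r i are allowed, so that the lemma serves edges as well as cells.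
-/
theorem exists_between_sum_zero {l r : Fin 3 → ℝ} (hle : ∀ i, l i ≤ r i) (hl : ∑ i, l i < 0)
    (hr : 0 < ∑ i, r i) : ∃ y : Fin 3 → ℝ, ∑ i, y i = 0 ∧ (∀ i, l i ≤ y i ∧ y i ≤ r i) ∧
      ∀ i, l i < r i → l i < y i ∧ y i < r i := by
  set s : ℝ := -(∑ i, l i) / (∑ i, r i - ∑ i, l i)
  have hd : 0 < ∑ i, r i - ∑ i, l i := by linarith
  have hs0 : 0 < s := div_pos (by linarith) hd
  have hs1 : s < 1 := (div_lt_one hd).2 (by linarith)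
  refine ⟨fun i => l i + s * (r i - l i), ?_, fun i => ?_, fun i hi => ?_⟩
  · rw [Finset.sum_add_distrib, ← Finset.mul_sum, Finset.sum_sub_distrib, div_mul_cancel₀ _ hd.ne']
    ring
  · have := hle i
    constructor <;> nlinarith
  · constructor <;> nlinarith

/-- The sum of the values of the three sequences. -/
def height (u : Fin 3 → ℤ → ℝ) (a : Fin 3 → ℤ) : ℝ := ∑ i, u i (a i)

/-- An open box meets the plane of sum zero if and only if its lowest corner is below the plane and
its highest corner above. -/
theorem region_nonempty_iff (hv : 0 < dblArea v) (hm : ∀ i, StrictMono (u i)) {a : Fin 3 → ℤ} :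
    (region v u a).Nonempty ↔ height u a < 0 ∧ 0 < height u (a + 1) := by
  constructor
  · rintro ⟨x, hx⟩
    have hs := sum_coord (v := v) x
    constructor
    · rw [← hs]
      exact Finset.sum_lt_sum_of_nonempty Finset.univ_nonempty fun i _ => (hx i).1
    · rw [← hs]
      exact Finset.sum_lt_sum_of_nonempty Finset.univ_nonempty fun i _ => (hx i).2
  · rintro ⟨h1, h2⟩
    have hlt : ∀ i, u i (a i) < u i ((a + 1) i) := fun i => hm i (lt_add_one _)
    obtain ⟨y, hy, -, hy2⟩ := exists_between_sum_zero (fun i => (hlt i).le) h1 h2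
    exact ⟨pt v y, fun i => by
      rw [coord_pt_of_sum_eq_zero hv hy]; exact hy2 i (hlt i)⟩

/-- The edge is the section of a box that is collapsed in direction i; the extreme corners of this
box are a and a + 1 − e_i. -/
theorem sum_le_of_gridEdge_nonempty {a : Fin 3 → ℤ} {i : Fin 3}
    (he : (gridEdge v u a i).Nonempty) :
    height u a ≤ 0 ∧ 0 ≤ height u (a + 1 + Pi.single i (-1)) := by
  obtain ⟨x, h1, h2⟩ := he
  have hs := sum_coord (v := v) x
  constructor
  · rw [← hs]
    refine Finset.sum_le_sum fun j _ => ?_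
    by_cases hj : j = i
    · subst hj; exact h1.ge
    · exact (h2 j hj).1
  · rw [← hs]
    refine Finset.sum_le_sum fun j _ => ?_
    by_cases hj : j = i
    · subst hj; rw [h1]; simp
    · simpa [hj] using (h2 j hj).2

theorem exists_mem_gridEdge (hv : 0 < dblArea v) (hm : ∀ i, StrictMono (u i)) {a : Fin 3 → ℤ}
    {i : Fin 3} (h1 : height u a < 0) (h2 : 0 < height u (a + 1 + Pi.single i (-1))) :
    ∃ x, coord v i x = u i (a i) ∧
      ∀ j ≠ i, u j (a j) < coord v j x ∧ coord v j x < u j (a j + 1) := by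
  have hlt : ∀ j, u j (a j) ≤ u j ((a + 1 + (Pi.single i (-1) : Fin 3 → ℤ)) j) := by
    intro j
    refine (hm j).monotone ?_
    by_cases hj : j = i
    · subst hj; simp
    · simp [hj]
  obtain ⟨y, hy, hy1, hy2⟩ := exists_between_sum_zero hlt h1 h2
  refine ⟨pt v y, ?_, fun j hj => ?_⟩
  · rw [coord_pt_of_sum_eq_zero hv hy]
    have := hy1 i
    simp at this
    linarith
  · rw [coord_pt_of_sum_eq_zero hv hy]
    have := hy2 j ((hm j) (by simp [hj]))
    simpa [hj] using this

theorem gridEdge_nontrivial (hv : 0 < dblArea v) (hm : ∀ i, StrictMono (u i)) {a : Fin 3 → ℤ}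
    {i : Fin 3} (h1 : height u a < 0) (h2 : 0 < height u (a + 1 + Pi.single i (-1))) :
    (gridEdge v u a i).Nontrivial := by
  obtain ⟨x, hx, hx'⟩ := exists_mem_gridEdge hv hm h1 h2
  obtain ⟨-, h3⟩ := hx' (i + 1) (by simp)
  obtain ⟨h4, -⟩ := hx' (i + 2) (by simp)
  -- A second point of the edge: raise coordinate i + 1 and lower coordinate i + 2 by half of the
  -- smaller margin.
  obtain ⟨δ, hδ0, hδ1, hδ2⟩ : ∃ δ > 0, coord v (i + 1) x + δ < u (i + 1) (a (i + 1) + 1) ∧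
      u (i + 2) (a (i + 2)) < coord v (i + 2) x - δ := by
    refine ⟨min (u (i + 1) (a (i + 1) + 1) - coord v (i + 1) x)
      (coord v (i + 2) x - u (i + 2) (a (i + 2))) / 2, ?_, ?_, ?_⟩
    · have := lt_min (sub_pos.2 h3) (sub_pos.2 h4)
      linarith
    · have := min_le_left (u (i + 1) (a (i + 1) + 1) - coord v (i + 1) x)
        (coord v (i + 2) x - u (i + 2) (a (i + 2)))
      linarith
    · have := min_le_right (u (i + 1) (a (i + 1) + 1) - coord v (i + 1) x)
        (coord v (i + 2) x - u (i + 2) (a (i + 2)))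
      linarith
  set d : Fin 3 → ℝ := Pi.single (i + 1) δ + Pi.single (i + 2) (-δ) with hd
  have hds : ∑ j, d j = 0 := by simp [hd, Finset.sum_add_distrib]
  refine ⟨x, ⟨hx, fun j hj => ⟨(hx' j hj).1.le, (hx' j hj).2.le⟩⟩, x + pt v d, ⟨?_, ?_⟩, ?_⟩
  · rw [map_add, coord_pt_of_sum_eq_zero hv hds, hx]
    simp [hd]
  · intro j hj
    rw [map_add, coord_pt_of_sum_eq_zero hv hds]
    have hcases : ∀ i j : Fin 3, j ≠ i → j = i + 1 ∨ j = i + 2 := by decide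
    obtain ⟨h5, h6⟩ := hx' j hj
    rcases hcases i j hj with rfl | rfl
    · have : d (i + 1) = δ := by simp [hd]
      rw [this]
      constructor <;> linarith
    · have : d (i + 2) = -δ := by simp [hd]
      rw [this]
      constructor <;> linarith
  · intro he
    have h5 := congrArg (coord v (i + 1)) he
    rw [map_add, coord_pt_of_sum_eq_zero hv hds] at h5
    have : d (i + 1) = δ := by simp [hd]
    linarith

end

section

variable {v : Fin 3 → Lat} {u : Fin 3 → ℤ → ℝ}

/-! ### Admissible grids -/

/-- The sign of the height depends only on the sum of the indices, and changes after `H`. -/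
def HeightCut (u : Fin 3 → ℤ → ℝ) (H : ℤ) : Prop :=
  ∀ a : Fin 3 → ℤ, (∑ i, a i = H → height u a < 0) ∧ (∑ i, a i = H + 1 → 0 < height u a)

theorem height_mono (hm : ∀ i, StrictMono (u i)) {a b : Fin 3 → ℤ} (h : ∀ i, a i ≤ b i) :
    height u a ≤ height u b := Finset.sum_le_sum fun i _ => (hm i).monotone (h i)

theorem height_add_single_lt (hm : ∀ i, StrictMono (u i)) (a : Fin 3 → ℤ) (i : Fin 3) :
    height u a < height u (a + Pi.single i 1) := by
  refine Finset.sum_lt_sum (fun j _ => (hm j).monotone ?_) ⟨i, Finset.mem_univ i, hm i (by simp)⟩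
  by_cases hj : j = i
  · subst hj; simp
  · simp [hj]

namespace HeightCut

variable {H : ℤ}

theorem neg (h : HeightCut u H) (hm : ∀ i, StrictMono (u i)) {a : Fin 3 → ℤ}
    (ha : ∑ i, a i ≤ H) : height u a < 0 := by
  refine (height_mono hm (b := a + Pi.single 0 (H - ∑ i, a i)) fun i => ?_).trans_lt
    ((h _).1 (by rw [sum_add_single]; ring))
  by_cases hi : i = 0
  · subst hi; simpa using ha
  · simp [hi]

theorem pos (h : HeightCut u H) (hm : ∀ i, StrictMono (u i)) {a : Fin 3 → ℤ}
    (ha : H + 1 ≤ ∑ i, a i) : 0 < height u a := by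
  refine ((h _).2 (by rw [sum_add_single]; ring)).trans_le
    (height_mono hm (a := a + Pi.single 0 (H + 1 - ∑ i, a i)) fun i => ?_)
  by_cases hi : i = 0
  · subst hi; simpa using ha
  · simp [hi]

theorem height_ne_zero (h : HeightCut u H) (hm : ∀ i, StrictMono (u i)) (a : Fin 3 → ℤ) :
    height u a ≠ 0 := by
  rcases le_or_gt (∑ i, a i) H with h1 | h1
  · exact (h.neg hm h1).ne
  · exact (h.pos hm h1).ne'

end HeightCut

theorem sum_add_one (a : Fin 3 → ℤ) : ∑ i, (a + 1) i = ∑ i, a i + 3 := by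
  simp [Finset.sum_add_distrib]

theorem lt_cross_iff (hv : 0 < dblArea v) {L : OrientedLine} {i : Fin 3} {r : ℝ} {x : Plane}
    (hs : L.slope = lineSlope v i) : r / mult v i < cross L.slope x ↔ r < coord v i x := by
  rw [hs, cross_lineSlope hv, div_lt_div_iff_of_pos_right (mult_cast_pos hv i)]

theorem cross_lt_iff (hv : 0 < dblArea v) {L : OrientedLine} {i : Fin 3} {r : ℝ} {x : Plane}
    (hs : L.slope = lineSlope v i) : cross L.slope x < r / mult v i ↔ coord v i x < r := by
  rw [hs, cross_lineSlope hv, div_lt_div_iff_of_pos_right (mult_cast_pos hv i)]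

/-- The two signs say that the plane cuts the upper face of the box in direction i. The cell then
has an edge there and lies to the right of its line. -/
theorem upper_edge_not_white (hv : 0 < dblArea v) (h : IsGrid v u) {a : Fin 3 → ℤ} {i : Fin 3}
    (h1 : height u (a + Pi.single i 1) < 0) (h2 : 0 < height u (a + 1)) :
    ¬IsWhite (gridLines v u) (region v u a) := by
  have hne := (region_nonempty_iff hv h.mono).2 ⟨(height_add_single_lt h.mono a i).trans h1, h2⟩
  have he : (gridEdge v u (a + Pi.single i 1) i).Nontrivial :=
    gridEdge_nontrivial hv h.mono h1
      (by simpa [add_right_comm _ (1 : Fin 3 → ℤ), add_assoc, ← Pi.single_add] using h2)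
  intro hw
  obtain ⟨x, hx⟩ := hne
  have := hw.2 _ _ _ (isCellEdge_upper hv h.mono ⟨x, hx⟩ (lineOf_mem_gridLines hv i (a i + 1))
    rfl rfl he) x hx
  rw [lt_cross_iff hv rfl] at this
  exact this.not_gt (hx i).2

theorem lower_edge_not_black (hv : 0 < dblArea v) (h : IsGrid v u) {a : Fin 3 → ℤ} {i : Fin 3}
    (h1 : height u a < 0) (h2 : 0 < height u (a + 1 + Pi.single i (-1))) :
    ¬IsBlack (gridLines v u) (region v u a) := by
  have h3 := height_add_single_lt h.mono (a + 1 + Pi.single i (-1)) i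
  have hne := (region_nonempty_iff hv h.mono).2
    ⟨h1, h2.trans (by simpa [add_assoc, ← Pi.single_add] using h3)⟩
  have he : (gridEdge v u a i).Nontrivial := gridEdge_nontrivial hv h.mono h1 h2
  intro hw
  obtain ⟨x, hx⟩ := hne
  have := hw.2 _ _ _ (isCellEdge_lower hv h.mono ⟨x, hx⟩ (lineOf_mem_gridLines hv i (a i))
    rfl rfl he) x hx
  rw [cross_lt_iff hv rfl] at this
  exact this.not_gt (hx i).1

/-- An edge on the upper side in direction i would need `height u (a + Pi.single i 1)` to be at most
0, so only lower edges occur. -/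
theorem isWhite_region (hv : 0 < dblArea v) (h : IsGrid v u) {a : Fin 3 → ℤ}
    (h1 : height u a < 0) (h2 : ∀ i, 0 < height u (a + Pi.single i 1)) :
    IsWhite (gridLines v u) (region v u a) := by
  have h3 : 0 < height u (a + 1) := (h2 0).trans_le (height_mono h.mono fun i => by
    by_cases hi : i = 0
    · subst hi; simp
    · simp [hi])
  have hne := (region_nonempty_iff hv h.mono).2 ⟨h1, h3⟩
  refine ⟨(isCell_gridLines_iff hv h).2 ⟨a, hne, rfl⟩, fun L c e he x hx => ?_⟩
  have hnt := he.2.2.2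
  obtain ⟨i, hs, ⟨rfl, rfl⟩ | ⟨rfl, rfl⟩⟩ := cellEdge_cases hv h hne he
  · rw [lt_cross_iff hv hs]
    exact (hx i).1
  · exact absurd (sum_le_of_gridEdge_nonempty hnt.nonempty).1 (h2 i).not_ge

theorem isBlack_region (hv : 0 < dblArea v) (h : IsGrid v u) {a : Fin 3 → ℤ}
    (h1 : 0 < height u (a + 1)) (h2 : ∀ i, height u (a + 1 + Pi.single i (-1)) < 0) :
    IsBlack (gridLines v u) (region v u a) := by
  have h3 : height u a < 0 := (height_mono h.mono fun i => by
    by_cases hi : i = 0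
    · subst hi; simp
    · simp [hi]).trans_lt (h2 0)
  have hne := (region_nonempty_iff hv h.mono).2 ⟨h3, h1⟩
  refine ⟨(isCell_gridLines_iff hv h).2 ⟨a, hne, rfl⟩, fun L c e he x hx => ?_⟩
  have hnt := he.2.2.2
  obtain ⟨i, hs, ⟨rfl, rfl⟩ | ⟨rfl, rfl⟩⟩ := cellEdge_cases hv h hne he
  · exact absurd (sum_le_of_gridEdge_nonempty hnt.nonempty).2 (h2 i).not_ge
  · rw [cross_lt_iff hv hs]
    exact (hx i).2

/-- The corners a and a + 1 have index sums that differ by 3 and must lie on opposite sides of the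
cut. Of the three remaining sums, H belongs to white cells, H − 2 to black ones and H − 1 to
uncolored ones. -/
theorem HeightCut.sum_cases {H : ℤ} (hH : HeightCut u H) (hv : 0 < dblArea v) (h : IsGrid v u)
    {a : Fin 3 → ℤ} (hne : (region v u a).Nonempty) : H - 2 ≤ ∑ i, a i ∧ ∑ i, a i ≤ H := by
  obtain ⟨h1, h2⟩ := (region_nonempty_iff hv h.mono).1 hne
  constructor <;> by_contra! hcon
  · exact h2.not_gt (hH.neg h.mono (by rw [sum_add_one]; omega))
  · exact h1.not_gt (hH.pos h.mono (by omega))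

theorem HeightCut.isWhite_iff {H : ℤ} (hH : HeightCut u H) (hv : 0 < dblArea v) (h : IsGrid v u)
    {C : Set Plane} :
    IsWhite (gridLines v u) C ↔ ∃ a, ∑ i, a i = H ∧ C = region v u a := by
  constructor
  · intro hC
    obtain ⟨a, hne, rfl⟩ := (isCell_gridLines_iff hv h).1 hC.1
    refine ⟨a, ?_, rfl⟩
    obtain ⟨h1, h2⟩ := hH.sum_cases hv h hne
    by_contra hcon
    refine upper_edge_not_white (i := 0) hv h (hH.neg h.mono ?_) (hH.pos h.mono ?_) hC
    · rw [sum_add_single]; omega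
    · rw [sum_add_one]; omega
  · rintro ⟨a, ha, rfl⟩
    exact isWhite_region hv h (hH.neg h.mono ha.le)
      fun i => hH.pos h.mono (by rw [sum_add_single]; omega)

theorem HeightCut.isBlack_iff {H : ℤ} (hH : HeightCut u H) (hv : 0 < dblArea v) (h : IsGrid v u)
    {C : Set Plane} :
    IsBlack (gridLines v u) C ↔ ∃ a, ∑ i, a i = H - 2 ∧ C = region v u a := by
  constructor
  · intro hC
    obtain ⟨a, hne, rfl⟩ := (isCell_gridLines_iff hv h).1 hC.1
    refine ⟨a, ?_, rfl⟩
    obtain ⟨h1, h2⟩ := hH.sum_cases hv h hne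
    by_contra hcon
    refine lower_edge_not_black (i := 0) hv h (hH.neg h.mono h2) (hH.pos h.mono ?_) hC
    rw [sum_add_single, sum_add_one]; omega
  · rintro ⟨a, ha, rfl⟩
    exact isBlack_region hv h (hH.pos h.mono (by rw [sum_add_one]; omega))
      fun i => hH.neg h.mono (by rw [sum_add_single, sum_add_one]; omega)

/-- Crossing an edge changes the index sum by one, so beyond an edge of an uncolored cell lies a
black cell (at a lower edge) or a white one (at an upper edge). -/
theorem HeightCut.isAdmissible {H : ℤ} (hH : HeightCut u H) (hv : 0 < dblArea v)
    (h : IsGrid v u) : IsAdmissible (gridLines v u) := by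
  intro C L c e hC he
  obtain ⟨a, hne, rfl⟩ := (isCell_gridLines_iff hv h).1 hC
  obtain ⟨h1, h2⟩ := hH.sum_cases hv h hne
  by_cases hw : ∑ i, a i = H
  · exact ⟨_, Or.inl ((hH.isWhite_iff hv h).2 ⟨a, hw, rfl⟩), he⟩
  by_cases hb : ∑ i, a i = H - 2
  · exact ⟨_, Or.inr ((hH.isBlack_iff hv h).2 ⟨a, hb, rfl⟩), he⟩
  have hL := he.1
  have hc := he.2.1
  have hnt := he.2.2.2
  obtain ⟨i, hs, ⟨rfl, rfl⟩ | ⟨rfl, rfl⟩⟩ := cellEdge_cases hv h hne he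
  · obtain ⟨b, rfl⟩ : ∃ b, a = b + Pi.single i 1 :=
      ⟨a + Pi.single i (-1), by simp [add_assoc, ← Pi.single_add]⟩
    have hbs : ∑ j, b j = H - 2 := by
      rw [sum_add_single] at h1 h2 hw hb; omega
    have hB := (hH.isBlack_iff hv h).2 ⟨b, hbs, rfl⟩
    have hbne : (region v u b).Nonempty := (region_nonempty_iff hv h.mono).2
      ⟨hH.neg h.mono (by omega), hH.pos h.mono (by rw [sum_add_one]; omega)⟩
    refine ⟨_, Or.inr hB, ?_⟩
    have hi : (b + (Pi.single i 1 : Fin 3 → ℤ)) i = b i + 1 := by simp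
    rw [hi] at hc ⊢
    exact isCellEdge_upper hv h.mono hbne hL hs hc hnt
  · have has : ∑ j, (a + (Pi.single i 1 : Fin 3 → ℤ)) j = H := by
      rw [sum_add_single]; omega
    have hW := (hH.isWhite_iff hv h).2 ⟨_, has, rfl⟩
    have hbne : (region v u (a + Pi.single i 1)).Nonempty := (region_nonempty_iff hv h.mono).2
      ⟨hH.neg h.mono has.le, hH.pos h.mono (by rw [sum_add_one]; omega)⟩
    refine ⟨_, Or.inl hW, ?_⟩
    have hi : (a + (Pi.single i 1 : Fin 3 → ℤ)) i = a i + 1 := by simp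
    rw [← hi] at hc ⊢
    exact isCellEdge_lower hv h.mono hbne hL hs hc hnt

/-- In an admissible arrangement, the cell to the left of both lines through a vertex is white. -/
theorem height_pos_of_isAdmissible (hv : 0 < dblArea v) (h : IsGrid v u)
    (h0 : ∀ a, height u a ≠ 0) (hA : IsAdmissible (gridLines v u)) {a : Fin 3 → ℤ} {k : Fin 3}
    (h1 : height u a < 0) (h2 : 0 < height u (a + Pi.single k 1)) (l : Fin 3) :
    0 < height u (a + Pi.single l 1) := by
  have hle : ∀ i, i ≠ k → height u (a + Pi.single k 1) ≤ height u (a + 1 + Pi.single i (-1)) := by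
    intro i hik
    refine height_mono h.mono fun j => ?_
    by_cases hj : j = k
    · subst hj; simp [hik.symm]
    · by_cases hji : j = i
      · subst hji; simp [hj]
      · simp [hj, hji]
  have hle' : height u (a + Pi.single k 1) ≤ height u (a + 1) := by
    refine height_mono h.mono fun j => ?_
    by_cases hj : j = k
    · subst hj; simp
    · simp [hj]
  have hne := (region_nonempty_iff hv h.mono).2 ⟨h1, h2.trans_le hle'⟩
  -- The cell has lower edges in both directions other than k. Whiteness will be deduced from the
  -- edge in direction i, the second direction j being used to exclude the cell across it.
  set i := k + 1
  set j := k + 2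
  have hik : i ≠ k := by simp [i]
  have hjk : j ≠ k := by simp [j]
  have hij : i ≠ j := by simp [i, j]
  have h3 := h2.trans_le (hle i hik)
  have he := isCellEdge_lower hv h.mono hne (lineOf_mem_gridLines hv i (a i)) rfl rfl
    (gridEdge_nontrivial hv h.mono h1 h3)
  -- The colored cell at this edge is the given one or its neighbour a − e_i; the point x inside the
  -- edge pins down its other indices.
  obtain ⟨C', hcol, he'⟩ := hA _ _ _ _ ((isCell_gridLines_iff hv h).2 ⟨a, hne, rfl⟩) he
  have hC' : IsCell (gridLines v u) C' := hcol.elim And.left And.left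
  obtain ⟨a', hne', rfl⟩ := (isCell_gridLines_iff hv h).1 hC'
  obtain ⟨x, hx1, hx2⟩ := exists_mem_gridEdge hv h.mono h1 h3
  have hxe : x ∈ gridEdge v u a i := ⟨hx1, fun j hj => ⟨(hx2 j hj).1.le, (hx2 j hj).2.le⟩⟩
  have hother : ∀ j ≠ i, ∀ b : Fin 3 → ℤ, x ∈ gridEdge v u b i → b j = a j := by
    intro j hj b hb
    obtain ⟨h4, h5⟩ := hb.2 j hj
    obtain ⟨h6, h7⟩ := hx2 j hj
    have h8 := (h.mono j).lt_iff_lt.1 (h4.trans_lt h7)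
    have h9 := (h.mono j).lt_iff_lt.1 (h6.trans_le h5)
    omega
  have hmi := (mult_cast_pos hv i).ne'
  obtain ⟨i', hs, hcase⟩ := cellEdge_cases hv h hne' he'
  obtain rfl : i = i' := lineSlope_injective hv hs
  rcases hcase with ⟨hc, hee⟩ | ⟨hc, hee⟩
  · rw [div_left_inj' hmi] at hc
    have hai := (h.mono i).injective hc
    obtain rfl : a' = a := by
      ext l
      by_cases hl : l = i
      · rw [hl, hai]
      · exact hother l hl _ (hee ▸ hxe)
    have hW : IsWhite (gridLines v u) (region v u a') :=
      hcol.resolve_right (lower_edge_not_black hv h h1 h3)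
    by_contra! hcon
    exact upper_edge_not_white hv h (hcon.lt_of_ne (h0 _)) (h2.trans_le hle') hW
  · rw [div_left_inj' hmi] at hc
    have hai := (h.mono i).injective hc
    have haa : a = a' + Pi.single i 1 := by
      ext l
      by_cases hl : l = i
      · rw [hl, hai]; simp
      · exact (hother l hl _ (hee ▸ hxe)).symm
    exfalso
    subst haa
    rcases hcol with hW | hB
    · obtain ⟨y, hy⟩ := hne'
      have := hW.2 _ _ _ he' y hy
      rw [lt_cross_iff hv rfl] at this
      exact this.not_gt (by simpa using (hy i).2)
    -- The neighbour also has a lower edge in direction j, because a' + 1 − e_j is a + e_k, which is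
    -- above the plane. So it cannot be black either.
    · refine lower_edge_not_black (i := j) hv h
        ((height_add_single_lt h.mono a' i).trans h1) (h2.trans_le ?_) hB
      refine height_mono h.mono fun l => ?_
      have hcases : ∀ k l : Fin 3, l = k ∨ l = k + 1 ∨ l = k + 2 := by decide
      rcases hcases k l with rfl | rfl | rfl
      · simp [i, j]
      · simp [i, j]
      · simp [i, j]

/-- `W` indexes white cells: a is below the plane and all three upper neighbours are above. It is
closed under the moves a ↦ a + e_l − e_m, which act transitively on the triples of given sum, so one
white cell settles a whole level. -/
theorem exists_heightCut (hv : 0 < dblArea v) (h : IsGrid v u) (h0 : ∀ a, height u a ≠ 0)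
    (hA : IsAdmissible (gridLines v u)) : ∃ H, HeightCut u H := by
  set W : Set (Fin 3 → ℤ) := {a | height u a < 0 ∧ ∀ l, 0 < height u (a + Pi.single l 1)}
  have hW : ∀ a k, height u a < 0 → 0 < height u (a + Pi.single k 1) → a ∈ W :=
    fun a k h1 h2 => ⟨h1, height_pos_of_isAdmissible hv h h0 hA h1 h2⟩
  have hstep : ∀ a ∈ W, ∀ l m, a + Pi.single l 1 + Pi.single m (-1) ∈ W := by
    intro a ha l m
    have hb : a + Pi.single l 1 + Pi.single m (-1) + Pi.single m 1 = a + Pi.single l 1 := by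
      simp [add_assoc, ← Pi.single_add]
    rcases (h0 (a + Pi.single l 1 + Pi.single m (-1))).lt_or_gt with h1 | h1
    · exact hW _ m h1 (by rw [hb]; exact ha.2 l)
    -- If a + e_l − e_m were above the plane, then a − e_m, below it, would be in `W`, and its upper
    -- neighbour a would be above.
    · exfalso
      have hc : a + Pi.single m (-1) + Pi.single m 1 = a := by
        simp [add_assoc, ← Pi.single_add]
      have h2 : height u (a + Pi.single m (-1)) < 0 := by
        have := height_add_single_lt h.mono (a + Pi.single m (-1)) m
        rw [hc] at this
        exact this.trans ha.1
      have h3 := (hW _ l h2 (by rwa [add_right_comm])).2 m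
      rw [hc] at h3
      exact h3.not_gt ha.1
  have hline : ∀ l m (n : ℤ), ∀ a ∈ W, a + Pi.single l n + Pi.single m (-n) ∈ W := by
    intro l m n a ha
    induction n using Int.induction_on with
    | zero => simpa using ha
    | succ n ih =>
      convert hstep _ ih l m using 1
      rw [neg_add, Pi.single_add, Pi.single_add]
      abel
    | pred n ih =>
      convert hstep _ ih m l using 1
      rw [neg_sub, sub_eq_add_neg, sub_eq_add_neg, Pi.single_add, Pi.single_add]
      abel
  -- The third axis supplies one element of `W`: along it the height changes sign between n and n +
  -- 1.
  obtain ⟨n, hn1, hn2⟩ := exists_floor h hv 2 (-(u 0 0 + u 1 0))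
  have hh : ∀ n, height u (Pi.single 2 n) = u 0 0 + u 1 0 + u 2 n := by
    intro n; simp [height, Fin.sum_univ_three]
  have ha : Pi.single 2 n ∈ W := by
    refine hW _ 2 ((by rw [hh]; linarith : height u (Pi.single 2 n) ≤ 0).lt_of_ne (h0 _)) ?_
    rw [← Pi.single_add, hh]
    linarith
  have hall : ∀ b : Fin 3 → ℤ, ∑ i, b i = n → b ∈ W := by
    intro b hb
    have := hline 1 2 (b 1) _ (hline 0 2 (b 0) _ ha)
    convert this using 1
    rw [Fin.sum_univ_three] at hb
    ext i
    fin_cases i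
    · simp
    · simp
    · simp; omega
  refine ⟨n, fun b => ⟨fun hb => (hall b hb).1, fun hb => ?_⟩⟩
  have h1 := (hall (b + Pi.single 0 (-1)) (by rw [sum_add_single, hb]; ring)).2 0
  simpa [add_assoc, ← Pi.single_add] using h1

end

section

open MeasureTheory

variable {v : Fin 3 → Lat} {u : Fin 3 → ℤ → ℝ}

/-! ### Centers of gravity -/

/-- The linear map of order three that permutes the coordinates cyclically. -/
def cycle (v : Fin 3 → Lat) : Plane →ₗ[ℝ] Plane :=
  pt v ∘ₗ LinearMap.pi fun i => coord v (i + 1)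

theorem coord_cycle (hv : 0 < dblArea v) (i : Fin 3) (x : Plane) :
    coord v i (cycle v x) = coord v (i + 1) x := by
  refine coord_pt_of_sum_eq_zero hv ?_ i
  rw [← sum_coord (v := v) x]
  exact Equiv.sum_comp (Equiv.addRight (1 : Fin 3)) fun i => coord v i x

theorem cycle_cycle_cycle (hv : 0 < dblArea v) : cycle v ∘ₗ cycle v ∘ₗ cycle v = LinearMap.id := by
  refine LinearMap.ext fun x => plane_ext hv fun i => ?_
  rw [LinearMap.comp_apply, LinearMap.comp_apply, coord_cycle hv, coord_cycle hv, coord_cycle hv,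
    LinearMap.id_apply]
  congr 1
  fin_cases i <;> rfl

theorem det_cycle (hv : 0 < dblArea v) : LinearMap.det (cycle v) = 1 := by
  have h := congrArg LinearMap.det (cycle_cycle_cycle hv)
  rw [LinearMap.det_comp, LinearMap.det_comp, LinearMap.det_id] at h
  nlinarith [sq_nonneg (LinearMap.det (cycle v)), sq_nonneg (LinearMap.det (cycle v) + 1)]

/-- Change of variables under a volume-preserving affine map that preserves s. Openness and
boundedness make the volume positive and finite, so the average is meaningful. -/
theorem centroid_eq_of_invariant {s : Set Plane} (hs : IsOpen s) (hne : s.Nonempty)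
    (hb : Bornology.IsBounded s) {T : Plane →ₗ[ℝ] Plane} (hT : LinearMap.det T = 1) (w : Plane)
    (hinv : ∀ x, T x + w ∈ s ↔ x ∈ s) : T (centroid s) + w = centroid s := by
  have hmp : MeasurePreserving (fun x => T x + w) volume volume := by
    have h1 : MeasurePreserving T volume volume :=
      ⟨T.continuous_of_finiteDimensional.measurable, by
        rw [Real.map_linearMap_volume_pi_eq_smul_volume_pi (by rw [hT]; exact one_ne_zero), hT]
        simp⟩
    exact (measurePreserving_add_right volume w).comp h1
  have hemb : MeasurableEmbedding fun x => T x + w := by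
    refine Continuous.measurableEmbedding
      (T.continuous_of_finiteDimensional.add continuous_const) fun x y hxy => ?_
    have hu : IsUnit T := by
      rw [LinearMap.isUnit_iff_isUnit_det, hT]; exact isUnit_one
    exact ((Module.End.isUnit_iff T).1 hu).1 (add_right_cancel hxy)
  have hfin : volume s ≠ ⊤ := hb.measure_lt_top.ne
  have hpos : volume.real s ≠ 0 :=
    (ENNReal.toReal_pos (hs.measure_pos volume hne).ne' hfin).ne'
  have hint : IntegrableOn (fun x : Plane => x) s volume :=
    (continuousOn_id.integrableOn_compact hb.isCompact_closure).mono_set subset_closure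
  have key := hmp.setIntegral_preimage_emb hemb (fun x => x) s
  rw [show (fun x => T x + w) ⁻¹' s = s from Set.ext hinv] at key
  have hintT : IntegrableOn (fun x : Plane => T x) s volume :=
    (T.continuous_of_finiteDimensional.continuousOn.integrableOn_compact
      hb.isCompact_closure).mono_set subset_closure
  have hcomm : ∫ x in s, T x = T (∫ x in s, x) :=
    (LinearMap.toContinuousLinearMap T).integral_comp_comm hint
  rw [integral_add hintT (integrableOn_const hfin), hcomm, setIntegral_const] at key
  rw [centroid, setAverage_eq, map_smul]
  conv_rhs => rw [← key]
  rw [smul_add, inv_smul_smul₀ hpos]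

/-- The affine map that permutes the coordinates cyclically, measured from c, has `pt v c` as its
only fixed point. -/
theorem centroid_eq_pt (hv : 0 < dblArea v) {s : Set Plane} (hs : IsOpen s) (hne : s.Nonempty)
    (hb : Bornology.IsBounded s) (c : Fin 3 → ℝ)
    (hinv : ∀ x x', (∀ i, coord v i x' - c i = coord v (i + 1) x - c (i + 1)) →
      (x' ∈ s ↔ x ∈ s)) : centroid s = pt v c := by
  have hw : ∑ i, (c i - c (i + 1)) = 0 := by
    rw [Finset.sum_sub_distrib, sub_eq_zero]
    exact (Equiv.sum_comp (Equiv.addRight (1 : Fin 3)) c).symm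
  have h := centroid_eq_of_invariant hs hne hb (det_cycle hv) (pt v fun i => c i - c (i + 1))
    fun x => hinv x _ fun i => by
      rw [map_add, coord_cycle hv, coord_pt_of_sum_eq_zero hv hw]
      ring
  have hc : ∀ i, coord v (i + 1) (centroid s) + (c i - c (i + 1)) = coord v i (centroid s) := by
    intro i
    conv_rhs => rw [← h]
    rw [map_add, coord_cycle hv, coord_pt_of_sum_eq_zero hv hw]
  have h0 := hc 0
  have h1 := hc 1
  simp only [zero_add, Fin.reduceAdd] at h0 h1
  refine ((pt_eq_iff hv).2 ⟨c 0 - coord v 0 (centroid s), fun i => ?_⟩).symm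
  fin_cases i <;> simp only [Fin.zero_eta, Fin.mk_one, Fin.reduceFinMk] <;> linarith

theorem isBounded_region (hv : 0 < dblArea v) (a : Fin 3 → ℤ) :
    Bornology.IsBounded (region v u a) := by
  refine ((isCompact_Icc (a := fun i => u i (a i)) (b := fun i => u i (a i + 1))).image
    (continuous_pt (v := v))).isBounded.subset fun x hx => ?_
  refine ⟨fun i => coord v i x, ⟨fun i => (hx i).1.le, fun i => (hx i).2.le⟩, ?_⟩
  simpa using pt_coord_add hv x 0

theorem exists_eq_add_single {a b : Fin 3 → ℤ} (h : ∀ i, a i ≤ b i)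
    (hs : ∑ i, b i = ∑ i, a i + 1) : ∃ l, b = a + Pi.single l 1 := by
  obtain ⟨l, -, hl⟩ := Finset.exists_lt_of_sum_lt (s := Finset.univ) (f := a) (g := b) (by omega)
  refine ⟨l, ?_⟩
  have h1 : ∑ i, (b i - (a + (Pi.single l 1 : Fin 3 → ℤ)) i) = 0 := by
    rw [Finset.sum_sub_distrib, sum_add_single, hs, sub_self]
  rw [Finset.sum_eq_zero_iff_of_nonneg] at h1
  · ext i
    exact sub_eq_zero.1 (h1 i (Finset.mem_univ i))
  · intro i _
    by_cases hi : i = l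
    · subst hi; simp; omega
    · simpa [hi] using h i

/-! ### Colored cells are triangles, centered at projected nodes -/

namespace HeightCut

variable {H : ℤ}

/-- If coordinate i reached the next grid value, the point would dominate a + e_i, of positive
height, although its coordinates have sum zero. So the lower bounds alone define a white cell, which
makes it invariant under cyclic permutation. -/
theorem coord_lt_of_lt (hH : HeightCut u H) (hm : ∀ i, StrictMono (u i)) {a : Fin 3 → ℤ}
    (ha : ∑ i, a i = H) {x : Plane} (hx : ∀ i, u i (a i) ≤ coord v i x) (i : Fin 3) :
    coord v i x < u i (a i + 1) := by
  have h1 := hH.pos hm (a := a + Pi.single i 1) (by rw [sum_add_single, ha])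
  have h2 := sum_coord (v := v) x
  have h3 : ∀ j, j ≠ i → u j ((a + (Pi.single i 1 : Fin 3 → ℤ)) j) ≤ coord v j x := by
    intro j hj
    simpa [hj] using hx j
  by_contra! hcon
  refine h1.not_ge ?_
  rw [← h2]
  refine Finset.sum_le_sum fun j _ => ?_
  by_cases hj : j = i
  · subst hj; simpa using hcon
  · exact h3 j hj

theorem lt_coord_of_lt (hH : HeightCut u H) (hm : ∀ i, StrictMono (u i)) {a : Fin 3 → ℤ}
    (ha : ∑ i, a i = H - 2) {x : Plane} (hx : ∀ i, coord v i x ≤ u i (a i + 1)) (i : Fin 3) :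
    u i (a i) < coord v i x := by
  have h1 := hH.neg hm (a := a + 1 + Pi.single i (-1))
    (by rw [sum_add_single, sum_add_one, ha]; omega)
  have h2 := sum_coord (v := v) x
  by_contra! hcon
  refine h1.not_ge ?_
  rw [← h2]
  refine Finset.sum_le_sum fun j _ => ?_
  by_cases hj : j = i
  · subst hj; simpa using hcon
  · simpa [hj] using hx j

theorem region_nonempty (hH : HeightCut u H) (hv : 0 < dblArea v) (hm : ∀ i, StrictMono (u i))
    {a : Fin 3 → ℤ} (h1 : H - 2 ≤ ∑ i, a i) (h2 : ∑ i, a i ≤ H) : (region v u a).Nonempty :=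
  (region_nonempty_iff hv hm).2
    ⟨hH.neg hm h2, hH.pos hm (by rw [sum_add_one]; omega)⟩

theorem centroid_white (hH : HeightCut u H) (hv : 0 < dblArea v) (hm : ∀ i, StrictMono (u i))
    {a : Fin 3 → ℤ} (ha : ∑ i, a i = H) : centroid (region v u a) = node v u a := by
  refine centroid_eq_pt hv (isOpen_region a) (hH.region_nonempty hv hm (by omega) ha.le)
    (isBounded_region hv a) _ fun x x' h => ?_
  have hreg : ∀ x, x ∈ region v u a ↔ ∀ i, 0 < coord v i x - u i (a i) := fun x =>
    ⟨fun hx i => sub_pos.2 (hx i).1, fun hx i => ⟨sub_pos.1 (hx i),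
      hH.coord_lt_of_lt hm ha (fun i => (sub_pos.1 (hx i)).le) i⟩⟩
  rw [hreg, hreg]
  simp only [h]
  exact (Equiv.addRight (1 : Fin 3)).forall_congr_right (q := fun i => 0 < coord v i x - u i (a i))

theorem centroid_black (hH : HeightCut u H) (hv : 0 < dblArea v) (hm : ∀ i, StrictMono (u i))
    {a : Fin 3 → ℤ} (ha : ∑ i, a i = H - 2) :
    centroid (region v u a) = node v u (a + 1) := by
  refine centroid_eq_pt hv (isOpen_region a) (hH.region_nonempty hv hm ha.ge (by omega))
    (isBounded_region hv a) _ fun x x' h => ?_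
  have hreg : ∀ x, x ∈ region v u a ↔ ∀ i, coord v i x - u i (a i + 1) < 0 := fun x =>
    ⟨fun hx i => sub_neg.2 (hx i).2, fun hx i => ⟨
      hH.lt_coord_of_lt hm ha (fun i => (sub_neg.1 (hx i)).le) i, sub_neg.1 (hx i)⟩⟩
  rw [hreg, hreg]
  simp only [Pi.add_apply, Pi.one_apply] at h
  simp only [h]
  exact (Equiv.addRight (1 : Fin 3)).forall_congr_right
    (q := fun i => coord v i x - u i (a i + 1) < 0)

/-! ### The graph of the arrangement of a grid -/

/-- Give all coordinates except the l-th their grid values at a; sum zero makes the l-th equal to `u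
l (a l) - height u a`. The two lines through this point are the lower lines of the white cell and
the upper lines of the black one. -/
theorem exists_vertex (hH : HeightCut u 0) (hv : 0 < dblArea v) (hm : ∀ i, StrictMono (u i))
    {a : Fin 3 → ℤ} (ha : ∑ i, a i = 0) (l : Fin 3) : ∃ x, IsVertex (gridLines v u) x ∧
      x ∈ frontier (region v u a) ∧ x ∈ frontier (region v u (a + Pi.single l 1 - 1)) := by
  set y : Fin 3 → ℝ := (fun i => u i (a i)) + Pi.single l (-height u a) with hy
  have hys : ∑ i, y i = 0 := by
    simp [hy, Finset.sum_add_distrib, height]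
  have hc := coord_pt_of_sum_eq_zero hv hys
  set x := pt v y
  have hneg := hH.neg hm ha.le
  have hne : ∀ j, j ≠ l → coord v j x = u j (a j) := fun j hj => by rw [hc, hy]; simp [hj]
  have hl : u l (a l) < coord v l x := by rw [hc, hy]; simpa using hneg
  have hlo : ∀ j, u j (a j) ≤ coord v j x := by
    intro j
    by_cases hj : j = l
    · subst hj; exact hl.le
    · exact (hne j hj).ge
  have hup := hH.coord_lt_of_lt (v := v) hm ha hlo
  have hne1 : l + 1 ≠ l := by simp
  have hne2 : l + 2 ≠ l := by simp
  have hsum : ∑ i, (a + (Pi.single l 1 : Fin 3 → ℤ) - 1) i = -2 := by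
    simp [Finset.sum_sub_distrib, Finset.sum_add_distrib, ha]
  refine ⟨x, ⟨lineOf hv (l + 1) (u (l + 1) (a (l + 1))), lineOf_mem_gridLines hv _ _,
    lineOf hv (l + 2) (u (l + 2) (a (l + 2))), lineOf_mem_gridLines hv _ _, fun he => ?_,
    hne _ hne1 ▸ proj_mem_lineOf_carrier hv, hne _ hne2 ▸ proj_mem_lineOf_carrier hv⟩, ?_, ?_⟩
  · have := lineSlope_injective hv (congrArg OrientedLine.slope he)
    simp at this
  · rw [frontier_region (hH.region_nonempty hv hm (by omega) ha.le)]
    exact ⟨fun i => ⟨hlo i, (hup i).le⟩, fun h => (h (l + 1)).1.ne' (hne _ hne1)⟩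
  · rw [frontier_region (hH.region_nonempty hv hm (by omega) (by omega))]
    have hupper : ∀ j, coord v j x ≤ u j ((a + (Pi.single l 1 : Fin 3 → ℤ) - 1) j + 1) := by
      intro j
      by_cases hj : j = l
      · subst hj; simpa using (hup j).le
      · simpa [hj] using (hne j hj).le
    refine ⟨fun i => ⟨(hH.lt_coord_of_lt (v := v) hm (by omega) hupper i).le, hupper i⟩,
      fun h => (h (l + 1)).2.ne ?_⟩
    simpa using hne _ hne1

/-- At a common boundary point of a white cell a and a black cell a', the lower bounds of one and
the upper bounds of the other give a ≤ a' + 1 entrywise. The sums are 0 and 1, so the highest corner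
a' + 1 of the black box is a neighbour of a in the grid. -/
theorem dimer_gridLines (hH : HeightCut u 0) (hv : 0 < dblArea v) (h : IsGrid v u) :
    dimer (gridLines v u) = tilingGraph v u := by
  have hm := h.mono
  ext p
  · constructor
    · rintro ⟨C, hC, rfl⟩
      obtain ⟨a, ha, rfl⟩ := (hH.isWhite_iff hv h).1 hC
      exact ⟨a, ha, by rw [hH.centroid_white hv hm ha]⟩
    · rintro ⟨a, ha, rfl⟩
      exact ⟨_, (hH.isWhite_iff hv h).2 ⟨a, ha, rfl⟩, by rw [hH.centroid_white hv hm ha]⟩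
  · constructor
    · rintro ⟨C, hC, rfl⟩
      obtain ⟨a, ha, rfl⟩ := (hH.isBlack_iff hv h).1 hC
      exact ⟨a + 1, by rw [sum_add_one, ha]; rfl, by rw [hH.centroid_black hv hm ha]⟩
    · rintro ⟨b, hb, rfl⟩
      have ha : ∑ i, (b - 1) i = 0 - 2 := by
        have := sum_add_one (b - 1)
        rw [sub_add_cancel] at this
        omega
      exact ⟨_, (hH.isBlack_iff hv h).2 ⟨_, ha, rfl⟩, by
        rw [hH.centroid_black hv hm ha, sub_add_cancel]⟩
  · constructor
    · rintro ⟨C, C', x, hC, hC', -, hx, hx', rfl⟩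
      obtain ⟨a, ha, rfl⟩ := (hH.isWhite_iff hv h).1 hC
      obtain ⟨a', ha', rfl⟩ := (hH.isBlack_iff hv h).1 hC'
      rw [frontier_region (hH.region_nonempty hv hm (by omega) (by omega))] at hx hx'
      obtain ⟨l, hl⟩ := exists_eq_add_single (a := a) (b := a' + 1)
        (fun i => (hm i).le_iff_le.1 ((hx.1 i).1.trans (hx'.1 i).2))
        (by rw [sum_add_one, ha, ha']; rfl)
      exact ⟨a, l, ha, by rw [hH.centroid_white hv hm ha, hH.centroid_black hv hm ha', hl]⟩
    · rintro ⟨a, l, ha, rfl⟩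
      obtain ⟨x, hx, hxa, hxb⟩ := hH.exists_vertex hv hm ha l
      have hb : ∑ i, (a + (Pi.single l 1 : Fin 3 → ℤ) - 1) i = 0 - 2 := by
        simp [Finset.sum_sub_distrib, Finset.sum_add_distrib, ha]
      exact ⟨_, _, x, (hH.isWhite_iff hv h).2 ⟨a, ha, rfl⟩,
        (hH.isBlack_iff hv h).2 ⟨_, hb, rfl⟩, hx, hxa, hxb, by
          rw [hH.centroid_white hv hm ha, hH.centroid_black hv hm hb, sub_add_cancel]⟩

end HeightCut

end

section

variable {v : Fin 3 → Lat} {u : Fin 3 → ℤ → ℝ}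

/-! ### The edges of the triangle -/

/-- The lattice triangle, as a subset of the plane. -/
abbrev triangle (v : Fin 3 → Lat) : Set Plane := convexHull ℝ (Set.range fun i => toPlane (v i))

/-- The primitive direction of a side of the triangle. -/
def sideDir (v : Fin 3 → Lat) (i : Fin 3) : Lat := fun j => side v i j / mult v i

theorem mult_mul_sideDir (v : Fin 3 → Lat) (i : Fin 3) (j : Fin 2) :
    (mult v i : ℤ) * sideDir v i j = side v i j := mult_mul_div v i j

theorem primitive_sideDir (hv : 0 < dblArea v) (i : Fin 3) : Primitive (sideDir v i) :=
  isCoprime_side_div hv i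

/-- The oriented area of lattice vectors. -/
def latCross (m n : Lat) : ℤ := m 0 * n 1 - m 1 * n 0

theorem cross_toPlane (m n : Lat) : cross m (toPlane n) = latCross m n := by
  simp [cross, latCross, toPlane]

theorem toPlane_sub (m n : Lat) : toPlane (m - n) = toPlane m - toPlane n := by
  ext i; simp [toPlane]

theorem latCross_side (v : Fin 3 → Lat) (i : Fin 3) :
    latCross (side v i) (v i - v (i + 1)) = dblArea v := by
  fin_cases i <;> simp [latCross, side, dblArea] <;> ring

theorem exists_eq_zsmul {m n : Lat} (hm : Primitive m) (h : latCross m n = 0) :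
    ∃ r : ℤ, n = r • m := by
  obtain ⟨a, b, hab⟩ := hm
  rw [latCross] at h
  refine ⟨a * n 0 + b * n 1, ?_⟩
  ext j
  fin_cases j
  · simp
    linear_combination (-(n 0)) * hab - b * h
  · simp
    linear_combination (-(n 1)) * hab + a * h

theorem Primitive.ne_zero {m : Lat} (hm : Primitive m) : m ≠ 0 := by
  rintro rfl
  obtain ⟨a, b, hab⟩ := hm
  simp at hab

theorem cross_sub (m : Lat) (x y : Plane) : cross m (x - y) = cross m x - cross m y := by
  simp [cross]; ring

theorem cross_sum {ι : Type*} [Fintype ι] (m : Lat) (w : ι → ℝ) (f : ι → Plane) :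
    cross m (∑ i, w i • f i) = ∑ i, w i * cross m (f i) := by
  simp only [cross, Finset.sum_apply, Pi.smul_apply, smul_eq_mul, Finset.mul_sum,
    ← Finset.sum_sub_distrib]
  exact Finset.sum_congr rfl fun i _ => by ring

theorem exists_weights {x : Plane} (hx : x ∈ triangle v) :
    ∃ w : Fin 3 → ℝ, (∀ i, 0 ≤ w i) ∧ ∑ i, w i = 1 ∧ x = ∑ i, w i • toPlane (v i) := by
  refine convexHull_min (t := {x | ∃ w : Fin 3 → ℝ, (∀ i, 0 ≤ w i) ∧ ∑ i, w i = 1 ∧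
    x = ∑ i, w i • toPlane (v i)}) ?_ ?_ hx
  · rintro _ ⟨i, rfl⟩
    refine ⟨Pi.single i 1, fun j => ?_, by simp, ?_⟩
    · by_cases hj : j = i
      · subst hj; simp
      · simp [hj]
    · simp [Pi.single_apply]
  · rintro _ ⟨w, hw, hw1, rfl⟩ _ ⟨w', hw', hw1', rfl⟩ s t hs ht hst
    refine ⟨fun i => s * w i + t * w' i, fun i =>
      add_nonneg (mul_nonneg hs (hw i)) (mul_nonneg ht (hw' i)), ?_, ?_⟩
    · rw [Finset.sum_add_distrib, ← Finset.mul_sum, ← Finset.mul_sum, hw1, hw1', mul_one, mul_one,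
        hst]
    · simp only [add_smul, Finset.sum_add_distrib, Finset.smul_sum, mul_smul]

theorem cross_sub_eq_sum {m : Lat} {p x : Plane} {w : Fin 3 → ℝ} (hw : ∑ i, w i = 1)
    (hx : x = ∑ i, w i • toPlane (v i)) :
    cross m (x - p) = ∑ i, w i * cross m (toPlane (v i) - p) := by
  simp only [cross_sub, mul_sub, Finset.sum_sub_distrib, ← Finset.sum_mul, hw, one_mul]
  rw [hx, cross_sum]

theorem toPlane_mem_triangle (hv : 0 < dblArea v) {i : Fin 3} {r : ℕ} (hr : r ≤ mult v i) :
    toPlane (v (i + 1) + (r : ℤ) • sideDir v i) ∈ triangle v := by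
  have hk := mult_cast_pos hv i
  have hmem : ∀ j, toPlane (v j) ∈ triangle v := fun j => subset_convexHull ℝ _ ⟨j, rfl⟩
  refine (convex_convexHull ℝ _).segment_subset (hmem (i + 1)) (hmem (i + 2)) ?_
  rw [segment_eq_image']
  refine ⟨r / mult v i, ⟨by positivity, (div_le_one hk).2 (by exact_mod_cast hr)⟩, ?_⟩
  ext j
  have h1 : (mult v i : ℝ) * (sideDir v i j : ℝ) = v (i + 2) j - v (i + 1) j := by
    have := mult_mul_sideDir v i j
    rw [side, Pi.sub_apply] at this
    exact_mod_cast this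
  simp only [toPlane, Pi.add_apply, Pi.smul_apply, Pi.sub_apply, smul_eq_mul, Int.cast_add,
    Int.cast_mul, Int.cast_natCast]
  rw [← h1]
  field_simp

theorem cross_side_nonneg (hv : 0 < dblArea v) {x : Plane} (hx : x ∈ triangle v) (i : Fin 3) :
    0 ≤ cross (side v i) (x - toPlane (v (i + 1))) := by
  obtain ⟨w, hw, hw1, hx⟩ := exists_weights hx
  rw [cross_sub_eq_sum hw1 hx]
  refine Finset.sum_nonneg fun j _ => mul_nonneg (hw j) ?_
  rw [← toPlane_sub, cross_toPlane, Int.cast_nonneg_iff]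
  have hcases : ∀ i j : Fin 3, j = i ∨ j = i + 1 ∨ j = i + 2 := by decide
  rcases hcases i j with rfl | rfl | rfl
  · rw [latCross_side]; exact hv.le
  · simp [latCross]
  · simp [latCross, side, mul_comm]

theorem latCross_side_nonneg {n : Lat} (hv : 0 < dblArea v) (hn : toPlane n ∈ triangle v)
    (i : Fin 3) : 0 ≤ latCross (side v i) (n - v (i + 1)) := by
  have := cross_side_nonneg hv hn i
  rw [← toPlane_sub, cross_toPlane] at this
  exact_mod_cast this

theorem latCross_side_succ (v : Fin 3 → Lat) (i : Fin 3) :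
    latCross (side v i) (side v (i + 1)) = dblArea v := by
  fin_cases i <;> simp [latCross, side, dblArea] <;> ring

/-- The edges of the lattice triangle, which subdivide its sides. -/
def triangleEdge (hv : 0 < dblArea v) (p : Σ i, Fin (mult v i)) : PolygonEdge (triangle v) where
  start := v (p.1 + 1) + ((p.2 : ℕ) : ℤ) • sideDir v p.1
  dir := sideDir v p.1
  primitive := primitive_sideDir hv p.1
  start_mem := toPlane_mem_triangle hv p.2.2.le
  end_mem := by
    have := toPlane_mem_triangle hv (Nat.succ_le_of_lt p.2.2)
    rwa [Nat.cast_succ, add_smul, one_smul, ← add_assoc] at this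
  left := by
    intro x hx
    obtain ⟨i, r⟩ := p
    refine nonneg_of_mul_nonneg_right ?_ (mult_cast_pos hv i)
    refine (cross_side_nonneg hv hx i).trans_eq ?_
    simp only [cross, ← mult_mul_sideDir]
    simp [toPlane]
    ring

theorem normal_triangleEdge (hv : 0 < dblArea v) (p : Σ i, Fin (mult v i)) :
    (triangleEdge hv p).normal = lineSlope v p.1 := rfl

theorem triangleEdge_injective (hv : 0 < dblArea v) : Function.Injective (triangleEdge hv) := by
  rintro ⟨i, r⟩ ⟨j, s⟩ h
  obtain rfl : i = j := lineSlope_injective hv (congrArg PolygonEdge.normal h)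
  have h1 : v (i + 1) + ((r : ℕ) : ℤ) • sideDir v i = v (i + 1) + ((s : ℕ) : ℤ) • sideDir v i :=
    congrArg PolygonEdge.start h
  have h2 := smul_left_injective ℤ (primitive_sideDir hv i).ne_zero (add_left_cancel h1)
  rw [Sigma.mk.injEq]
  exact ⟨rfl, heq_of_eq (Fin.ext (by exact_mod_cast h2))⟩

/-- The ends of the edge lie on a supporting line, so their barycentric weights are carried by
vertices on that line. With at most one such vertex, both ends would coincide with it. -/
theorem exists_vertices_on_edge (e : PolygonEdge (triangle v)) :
    ∃ i, latCross e.dir (v (i + 1) - e.start) = 0 ∧ latCross e.dir (v (i + 2) - e.start) = 0 := by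
  have hpos : ∀ j, 0 ≤ cross e.dir (toPlane (v j) - toPlane e.start) := fun j =>
    e.left _ (subset_convexHull ℝ _ ⟨j, rfl⟩)
  have key : ∀ x ∈ triangle v, cross e.dir (x - toPlane e.start) = 0 →
      ∃ w : Fin 3 → ℝ, ∑ i, w i = 1 ∧ x = ∑ i, w i • toPlane (v i) ∧
        ∀ i, w i = 0 ∨ latCross e.dir (v i - e.start) = 0 := by
    intro x hx h0
    obtain ⟨w, hw, hw1, hx⟩ := exists_weights hx
    rw [cross_sub_eq_sum hw1 hx,
      Finset.sum_eq_zero_iff_of_nonneg fun i _ => mul_nonneg (hw i) (hpos i)] at h0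
    refine ⟨w, hw1, hx, fun i => ?_⟩
    have := h0 i (Finset.mem_univ i)
    rwa [mul_eq_zero, ← toPlane_sub, cross_toPlane, Int.cast_eq_zero] at this
  obtain ⟨w, hw1, hx, hw⟩ := key _ e.start_mem (by simp [cross])
  obtain ⟨w', hw1', hx', hw'⟩ := key _ e.end_mem (by
    rw [← toPlane_sub, cross_toPlane]; simp [latCross]; ring)
  by_contra! hcon
  obtain ⟨k, hk⟩ : ∃ k, ∀ i, i ≠ k → latCross e.dir (v i - e.start) ≠ 0 := by
    by_contra! hall
    obtain ⟨i, -, hi⟩ := hall 0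
    obtain ⟨j, hij, hj⟩ := hall i
    have hcases : ∀ i j : Fin 3, j ≠ i → ∃ l, (i = l + 1 ∧ j = l + 2) ∨ (j = l + 1 ∧ i = l + 2) := by
      decide
    obtain ⟨l, ⟨rfl, rfl⟩ | ⟨rfl, rfl⟩⟩ := hcases i j hij
    · exact hcon l hi hj
    · exact hcon l hj hi
  have hsingle : ∀ (x : Plane) (w : Fin 3 → ℝ), ∑ i, w i = 1 → x = ∑ i, w i • toPlane (v i) →
      (∀ i, w i = 0 ∨ latCross e.dir (v i - e.start) = 0) → x = toPlane (v k) := by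
    rintro x w h1 rfl h
    have hz : ∀ i, i ≠ k → w i = 0 := fun i hi => (h i).resolve_right (hk i hi)
    rw [Finset.sum_eq_single k (fun i _ hi => hz i hi) (by simp)] at h1
    rw [Finset.sum_eq_single k (fun i _ hi => by rw [hz i hi, zero_smul]) (by simp), h1, one_smul]
  have h1 := (hsingle _ w hw1 hx hw).trans (hsingle _ w' hw1' hx' hw').symm
  have h2 := toPlane_injective h1
  exact e.primitive.ne_zero (by simpa using h2.symm)

/-- The supporting line contains side i, which is n times the direction of the edge, and n > 0
because the third vertex is on the left. The start is v(i+1) plus r times the direction; the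
inequalities of the other two sides at the two ends give 0 ≤ r and r + 1 ≤ n. -/
theorem triangleEdge_surjective (hv : 0 < dblArea v) : Function.Surjective (triangleEdge hv) := by
  intro e
  obtain ⟨i, h1, h2⟩ := exists_vertices_on_edge e
  have hside : latCross e.dir (side v i) = 0 := by
    simp only [latCross, side, Pi.sub_apply] at h1 h2 ⊢
    linarith
  obtain ⟨n, hn⟩ := exists_eq_zsmul e.primitive hside
  have hgi : (0 : ℤ) ≤ latCross e.dir (v i - e.start) := by
    have := e.left _ (subset_convexHull ℝ _ ⟨i, rfl⟩)
    rw [← toPlane_sub, cross_toPlane] at this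
    exact_mod_cast this
  have hD : n * latCross e.dir (v i - e.start) = dblArea v := by
    rw [← latCross_side v i, hn]
    simp only [latCross, Pi.sub_apply, Pi.smul_apply, smul_eq_mul] at h1 ⊢
    linear_combination n * h1
  have hnpos : 0 < n := by
    by_contra! hcon
    have := mul_nonpos_of_nonpos_of_nonneg hcon hgi
    omega
  have hmult : (mult v i : ℤ) = n := by
    have h3 : Int.gcd (e.dir 0) (e.dir 1) = 1 := Int.isCoprime_iff_gcd_eq_one.1 e.primitive
    rw [mult, hn]
    simp only [Pi.smul_apply, smul_eq_mul]
    rw [Int.gcd_mul_left, h3, mul_one]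
    omega
  have hdir : e.dir = sideDir v i := by
    ext j
    have h3 := mult_mul_sideDir v i j
    rw [hmult, hn, Pi.smul_apply, smul_eq_mul] at h3
    exact (mul_left_cancel₀ hnpos.ne' h3).symm
  obtain ⟨r, hr⟩ := exists_eq_zsmul (n := e.start - v (i + 1)) e.primitive (by
    simp only [latCross, Pi.sub_apply] at h1 ⊢
    linarith)
  have hstart : e.start = v (i + 1) + r • sideDir v i := by rw [← hdir, ← hr]; simp
  have hr0 : 0 ≤ r := by
    have h3 := latCross_side_nonneg hv e.start_mem (i + 2)
    have h4 := latCross_side_succ v (i + 2)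
    have e1 : ∀ i : Fin 3, i + 2 + 1 = i := by decide
    rw [e1] at h3 h4
    have h5 : latCross (side v (i + 2)) (e.start - v i) * n = r * dblArea v := by
      have e2 : side v (i + 2) = v (i + 1) - v i := by
        have e3 : ∀ i : Fin 3, i + 2 + 2 = i + 1 := by decide
        rw [side, e1, e3]
      rw [← h4, hn, show e.start = v (i + 1) + r • e.dir by rw [← hr]; simp, e2]
      simp [latCross]
      ring
    have h6 := mul_nonneg h3 hnpos.le
    rw [h5] at h6
    exact nonneg_of_mul_nonneg_left h6 hv
  have hrn : r + 1 ≤ n := by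
    have h3 := latCross_side_nonneg hv e.end_mem (i + 1)
    have h4 := latCross_side_succ v i
    have e1 : i + 1 + 1 = i + 2 := by rw [add_assoc]; rfl
    rw [e1] at h3
    have h5 : latCross (side v (i + 1)) (e.start + e.dir - v (i + 2)) * n =
        (n - (r + 1)) * dblArea v := by
      have e2 : v (i + 2) = v (i + 1) + n • e.dir := by rw [← hn, side]; simp
      rw [← h4, hn, show e.start = v (i + 1) + r • e.dir by rw [← hr]; simp, e2]
      simp [latCross]
      ring
    have h6 := mul_nonneg h3 hnpos.le
    rw [h5] at h6
    have := nonneg_of_mul_nonneg_left h6 hv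
    omega
  refine ⟨⟨i, ⟨r.toNat, by omega⟩⟩, PolygonEdge.ext ?_ hdir.symm⟩
  rw [hstart]
  simp [triangleEdge, hr0]

/-- The edges of a lattice triangle are the primitive segments of its three sides. -/
def triangleEdgeEquiv (hv : 0 < dblArea v) : (Σ i, Fin (mult v i)) ≃ PolygonEdge (triangle v) :=
  Equiv.ofBijective (triangleEdge hv) ⟨triangleEdge_injective hv, triangleEdge_surjective hv⟩

end

section

variable {v : Fin 3 → Lat} {u : Fin 3 → ℤ → ℝ}

/-! ### Simple arrangements of grids -/

theorem eq_lineOf_of_mem (hv : 0 < dblArea v) (h : IsGrid v u) {L : OrientedLine}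
    (hL : L ∈ gridLines v u) {x : Plane} (hx : proj x ∈ L.carrier) :
    ∃ i b, coord v i x = u i b ∧ L = lineOf hv i (coord v i x) := by
  rw [proj_mem_carrier_iff] at hx
  obtain ⟨i, b, hs, hb⟩ := exists_of_mem_gridLines hv h hL hx
  rw [hs, cross_lineSlope hv] at hb hx
  exact ⟨i, b, (div_left_inj' (mult_cast_pos hv i).ne').1 hb, OrientedLine.ext hs hx.symm⟩

/-- Distinct lines of one family do not meet, so a triple point lies on one line of each family. Its
coordinates are three grid values with sum zero. -/
theorem isSimple_gridLines_iff (hv : 0 < dblArea v) (h : IsGrid v u) :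
    IsSimple (gridLines v u) ↔ ∀ a, height u a ≠ 0 := by
  constructor
  · intro hs a ha
    set x := pt v fun i => u i (a i)
    have hx : ∀ i, coord v i x = u i (a i) := coord_pt_of_sum_eq_zero hv ha
    have hne : ∀ i j, i ≠ j → lineOf hv i (u i (a i)) ≠ lineOf hv j (u j (a j)) :=
      fun i j hij he => hij (lineSlope_injective hv (congrArg OrientedLine.slope he))
    have hmem : ∀ i, proj x ∈ (lineOf hv i (u i (a i))).carrier := fun i =>
      hx i ▸ proj_mem_lineOf_carrier hv
    have := hs _ (lineOf_mem_gridLines hv 0 (a 0)) _ (lineOf_mem_gridLines hv 1 (a 1)) _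
      (lineOf_mem_gridLines hv 2 (a 2)) (hne _ _ (by decide)) (hne _ _ (by decide))
      (hne _ _ (by decide))
    exact Set.eq_empty_iff_forall_notMem.1 this (proj x) ⟨⟨hmem 0, hmem 1⟩, hmem 2⟩
  · intro h0 L₁ h₁ L₂ h₂ L₃ h₃ h₁₂ h₁₃ h₂₃
    refine Set.eq_empty_iff_forall_notMem.2 ?_
    rintro p ⟨⟨hp₁, hp₂⟩, hp₃⟩
    obtain ⟨x, rfl⟩ := proj_surjective p
    obtain ⟨i, b₁, hi, rfl⟩ := eq_lineOf_of_mem hv h h₁ hp₁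
    obtain ⟨j, b₂, hj, rfl⟩ := eq_lineOf_of_mem hv h h₂ hp₂
    obtain ⟨k, b₃, hk, rfl⟩ := eq_lineOf_of_mem hv h h₃ hp₃
    have hij : i ≠ j := by rintro rfl; exact h₁₂ rfl
    have hik : i ≠ k := by rintro rfl; exact h₁₃ rfl
    have hjk : j ≠ k := by rintro rfl; exact h₂₃ rfl
    have hall : ∀ i j k : Fin 3, i ≠ j → i ≠ k → j ≠ k → ∀ l, l = i ∨ l = j ∨ l = k := by decide
    have hex : ∀ l, ∃ b, coord v l x = u l b := by
      intro l
      rcases hall i j k hij hik hjk l with rfl | rfl | rfl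
      exacts [⟨_, hi⟩, ⟨_, hj⟩, ⟨_, hk⟩]
    choose a ha using hex
    refine h0 a ?_
    rw [height, ← sum_coord (v := v) x]
    exact Finset.sum_congr rfl fun i _ => (ha i).symm

theorem isAdmissible_gridLines_iff (hv : 0 < dblArea v) (h : IsGrid v u)
    (hs : IsSimple (gridLines v u)) : IsAdmissible (gridLines v u) ↔ ∃ H, HeightCut u H :=
  ⟨exists_heightCut hv h ((isSimple_gridLines_iff hv h).1 hs), fun ⟨_, hH⟩ =>
    hH.isAdmissible hv h⟩

/-! ### Grids from finitely many values -/

/-- The periodic extension of the values of one period. -/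
def gridOf (hv : 0 < dblArea v) (w : (Σ i, Fin (mult v i)) → ℝ) (i : Fin 3) (b : ℤ) : ℝ :=
  w ⟨i, ⟨(b % mult v i).toNat, by
    have := mult_pos hv i
    have := Int.emod_lt_of_pos b (Int.natCast_pos.2 this)
    omega⟩⟩ + ((b / mult v i : ℤ) : ℝ) * mult v i

theorem gridOf_add_mul (hv : 0 < dblArea v) (w : (Σ i, Fin (mult v i)) → ℝ) (i : Fin 3)
    (r : Fin (mult v i)) (n : ℤ) :
    gridOf hv w i (((r : ℕ) : ℤ) + n * mult v i) = w ⟨i, r⟩ + n * mult v i := by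
  have hk : (mult v i : ℤ) ≠ 0 := by have := mult_pos hv i; omega
  have h1 : (((r : ℕ) : ℤ) + n * mult v i) % mult v i = (r : ℕ) := by
    rw [Int.add_mul_emod_self_right]
    exact_mod_cast Nat.mod_eq_of_lt r.2
  have h2 : (((r : ℕ) : ℤ) + n * mult v i) / mult v i = n := by
    rw [Int.add_mul_ediv_right _ _ hk]
    rw [show ((r : ℕ) : ℤ) / mult v i = 0 by exact_mod_cast Nat.div_eq_of_lt r.2, zero_add]
  simp only [gridOf, h1, h2, Int.toNat_natCast]

theorem gridOf_natCast (hv : 0 < dblArea v) (w : (Σ i, Fin (mult v i)) → ℝ) (i : Fin 3)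
    (r : Fin (mult v i)) : gridOf hv w i ((r : ℕ) : ℤ) = w ⟨i, r⟩ := by
  simpa using gridOf_add_mul hv w i r 0

theorem exists_eq_add_mul (hv : 0 < dblArea v) (i : Fin 3) (b : ℤ) :
    ∃ (r : Fin (mult v i)) (n : ℤ), b = ((r : ℕ) : ℤ) + n * mult v i := by
  have hk := mult_pos hv i
  have h1 := Int.emod_lt_of_pos b (Int.natCast_pos.2 hk)
  have h2 := Int.emod_nonneg b (Int.natCast_pos.2 hk).ne'
  refine ⟨⟨(b % mult v i).toNat, by omega⟩, b / mult v i, ?_⟩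
  rw [Int.toNat_of_nonneg h2, mul_comm, Int.emod_add_mul_ediv]

theorem gridOf_periodic (hv : 0 < dblArea v) (w : (Σ i, Fin (mult v i)) → ℝ) (i : Fin 3) (b n : ℤ) :
    gridOf hv w i (b + n * mult v i) = gridOf hv w i b + n * mult v i := by
  obtain ⟨r, m, rfl⟩ := exists_eq_add_mul hv i b
  rw [add_assoc, ← add_mul, gridOf_add_mul, gridOf_add_mul]
  push_cast
  ring

theorem continuous_gridOf (hv : 0 < dblArea v) (i : Fin 3) (b : ℤ) :
    Continuous fun w => gridOf hv w i b := by
  unfold gridOf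
  fun_prop

theorem continuous_height_gridOf (hv : 0 < dblArea v) (a : Fin 3 → ℤ) :
    Continuous fun w => height (gridOf hv w) a :=
  continuous_finsetSum _ fun i _ => continuous_gridOf hv i (a i)

theorem isGrid_gridOf (hv : 0 < dblArea v) {w : (Σ i, Fin (mult v i)) → ℝ}
    (hw : ∀ i (r : Fin (mult v i)), gridOf hv w i ((r : ℕ) : ℤ) < gridOf hv w i ((r : ℕ) + 1)) :
    IsGrid v (gridOf hv w) where
  mono i := by
    refine strictMono_int_of_lt_succ fun b => ?_
    obtain ⟨r, n, rfl⟩ := exists_eq_add_mul hv i b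
    rw [add_right_comm, gridOf_periodic, gridOf_periodic]
    exact add_lt_add_left (hw i r) _
  periodic i a := by simpa using gridOf_periodic hv w i a 1

theorem IsGrid.gridOf_eq (h : IsGrid v u) (hv : 0 < dblArea v) :
    gridOf hv (fun e => u e.1 ((e.2 : ℕ) : ℤ)) = u := by
  ext i b
  obtain ⟨r, n, rfl⟩ := exists_eq_add_mul hv i b
  rw [gridOf_add_mul, h.periodic_mul]

/-! ### Positions -/

/-- The positions of lines with the given coordinate values. -/
def positions (hv : 0 < dblArea v) (w : (Σ i, Fin (mult v i)) → ℝ) (e : PolygonEdge (triangle v)) :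
    UnitAddCircle :=
  ((w ((triangleEdgeEquiv hv).symm e) / mult v ((triangleEdgeEquiv hv).symm e).1 : ℝ) :
    UnitAddCircle)

theorem positions_triangleEdge (hv : 0 < dblArea v) (w : (Σ i, Fin (mult v i)) → ℝ)
    (p : Σ i, Fin (mult v i)) :
    positions hv w (triangleEdge hv p) = ((w p / mult v p.1 : ℝ) : UnitAddCircle) := by
  have : (triangleEdgeEquiv hv).symm (triangleEdge hv p) = p :=
    (triangleEdgeEquiv hv).symm_apply_apply p
  rw [positions, this]

theorem continuous_positions (hv : 0 < dblArea v) : Continuous (positions hv) :=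
  continuous_pi fun e => (AddCircle.continuous_mk' (1 : ℝ)).comp (by fun_prop)

theorem finite_polygonEdge (hv : 0 < dblArea v) : Finite (PolygonEdge (triangle v)) :=
  Finite.of_equiv _ (triangleEdgeEquiv hv)

/-- A product of rescaled quotient maps. Openness carries statements that hold near a real lift over
to nearby positions on the torus. -/
theorem isOpenMap_positions (hv : 0 < dblArea v) : IsOpenMap (positions hv) := by
  have := finite_polygonEdge hv
  let φ : ((Σ i, Fin (mult v i)) → ℝ) ≃ₜ (PolygonEdge (triangle v) → ℝ) :=
    Homeomorph.piCongrLeft (Y := fun _ => ℝ) (triangleEdgeEquiv hv)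
  have h1 : IsOpenMap fun (y : PolygonEdge (triangle v) → ℝ) e =>
      ((y e / mult v ((triangleEdgeEquiv hv).symm e).1 : ℝ) : UnitAddCircle) :=
    IsOpenMap.piMap (f := fun e (y : ℝ) =>
        ((y / mult v ((triangleEdgeEquiv hv).symm e).1 : ℝ) : UnitAddCircle))
      (fun e => by
        simp only [div_eq_mul_inv]
        exact (QuotientAddGroup.isOpenMap_coe (G := ℝ)).comp
          (Homeomorph.mulRight₀ _ (inv_ne_zero (mult_cast_pos hv _).ne')).isOpenMap)
      (by simp)
  convert h1.comp φ.isOpenMap using 1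
  ext w e
  obtain ⟨p, rfl⟩ := (triangleEdgeEquiv hv).surjective e
  have : φ w (triangleEdgeEquiv hv p) = w p :=
    Equiv.piCongrLeft_apply_apply (fun _ => ℝ) (triangleEdgeEquiv hv) w p
  rw [positions, Function.comp_apply, this, Equiv.symm_apply_apply]

/-- The positions attached to the edges of one side come in any order, whereas a grid is increasing.
The permutations account for this and do not change the set of lines. -/
theorem range_line_positions (hv : 0 < dblArea v) (w : (Σ i, Fin (mult v i)) → ℝ)
    (σ : ∀ i, Equiv.Perm (Fin (mult v i))) :
    Set.range (fun e : PolygonEdge (triangle v) => e.line (positions hv w e)) =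
      gridLines v (gridOf hv (w ∘ Equiv.sigmaCongrRight σ)) := by
  ext L
  constructor
  · rintro ⟨e, rfl⟩
    obtain ⟨⟨i, r⟩, rfl⟩ := triangleEdge_surjective hv e
    refine ⟨i, (((σ i).symm r : ℕ) : ℤ), normal_triangleEdge hv _, ?_⟩
    rw [gridOf_natCast]
    simp [PolygonEdge.line, positions_triangleEdge]
  · rintro ⟨i, b, hs, hp⟩
    obtain ⟨r, n, rfl⟩ := exists_eq_add_mul hv i b
    refine ⟨triangleEdge hv ⟨i, σ i r⟩, OrientedLine.ext hs.symm ?_⟩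
    rw [hp]
    change positions hv w _ = _
    rw [positions_triangleEdge, gridOf_add_mul, coe_unitAddCircle_eq_iff]
    refine ⟨n, ?_⟩
    rw [add_div, mul_div_cancel_right₀ _ (mult_cast_pos hv i).ne']
    rfl

theorem injective_line_positions (hv : 0 < dblArea v) {w : (Σ i, Fin (mult v i)) → ℝ}
    (hw : IsGrid v (gridOf hv w)) :
    Function.Injective fun e : PolygonEdge (triangle v) => e.line (positions hv w e) := by
  intro e e' he
  obtain ⟨⟨i, r⟩, rfl⟩ := triangleEdge_surjective hv e
  obtain ⟨⟨j, s⟩, rfl⟩ := triangleEdge_surjective hv e'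
  obtain rfl : i = j := lineSlope_injective hv (congrArg OrientedLine.slope he)
  have h1 : positions hv w (triangleEdge hv ⟨i, r⟩) = positions hv w (triangleEdge hv ⟨i, s⟩) :=
    congrArg OrientedLine.pos he
  rw [positions_triangleEdge, positions_triangleEdge, coe_unitAddCircle_eq_iff] at h1
  obtain ⟨n, hn⟩ := h1
  have h2 : gridOf hv w i ((s : ℕ) : ℤ) = gridOf hv w i (((r : ℕ) : ℤ) + n * mult v i) := by
    rw [gridOf_natCast, gridOf_add_mul]
    field_simp [(mult_cast_pos hv i).ne'] at hn
    rw [hn]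
    ring
  have h3 := (hw.mono i).injective h2
  have hr := r.2
  have hs := s.2
  have hn0 : n = 0 := by
    rcases lt_trichotomy n 0 with h | h | h
    · nlinarith
    · exact h
    · nlinarith
  rw [hn0, zero_mul, add_zero] at h3
  rw [Fin.ext (by exact_mod_cast h3.symm : (r : ℕ) = s)]

/-- Lift the positions to [0,1), sort each family and scale by `mult v i`. Injectivity gives strict
increase within a period; the last value is less than the first of the next period because all lifts
are less than 1. -/
theorem exists_positions (hv : 0 < dblArea v) {c : PolygonEdge (triangle v) → UnitAddCircle}
    (hc : Function.Injective fun e : PolygonEdge (triangle v) => e.line (c e)) :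
    ∃ (w : (Σ i, Fin (mult v i)) → ℝ) (σ : ∀ i, Equiv.Perm (Fin (mult v i))),
      c = positions hv w ∧ IsGrid v (gridOf hv (w ∘ Equiv.sigmaCongrRight σ)) := by
  have hex : ∀ x : UnitAddCircle, ∃ y : ℝ, (0 ≤ y ∧ y < 1) ∧ (y : UnitAddCircle) = x := by
    intro x
    obtain ⟨y, rfl⟩ := QuotientAddGroup.mk_surjective x
    refine ⟨Int.fract y, ⟨Int.fract_nonneg y, Int.fract_lt_one y⟩, ?_⟩
    exact (coe_unitAddCircle_eq_iff).2 ⟨⌊y⌋, (Int.fract_add_floor y).symm⟩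
  choose l hl hlc using hex
  set f : ∀ i, Fin (mult v i) → ℝ := fun i r => l (c (triangleEdge hv ⟨i, r⟩))
  have hf : ∀ i, Function.Injective (f i) := by
    intro i r s hrs
    have h1 : c (triangleEdge hv ⟨i, r⟩) = c (triangleEdge hv ⟨i, s⟩) := by
      rw [← hlc (c _), ← hlc (c (triangleEdge hv ⟨i, s⟩))]
      exact congrArg _ hrs
    have h2 := triangleEdge_injective hv (hc (OrientedLine.ext (by rfl) h1 :
      (triangleEdge hv ⟨i, r⟩).line (c (triangleEdge hv ⟨i, r⟩)) =
      (triangleEdge hv ⟨i, s⟩).line (c (triangleEdge hv ⟨i, s⟩))))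
    simpa using h2
  refine ⟨fun p => mult v p.1 * f p.1 p.2, fun i => Tuple.sort (f i), ?_, isGrid_gridOf hv ?_⟩
  · ext e
    obtain ⟨⟨i, r⟩, rfl⟩ := triangleEdge_surjective hv e
    rw [positions_triangleEdge, mul_div_cancel_left₀ _ (mult_cast_pos hv i).ne']
    exact (hlc _).symm
  · intro i r
    have hk := mult_cast_pos hv i
    rw [gridOf_natCast]
    by_cases hr : (r : ℕ) + 1 < mult v i
    · have := gridOf_natCast hv ((fun p : (Σ i, Fin (mult v i)) => mult v p.1 * f p.1 p.2) ∘
        Equiv.sigmaCongrRight fun i => Tuple.sort (f i)) i ⟨(r : ℕ) + 1, hr⟩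
      rw [Nat.cast_add_one] at this
      rw [this]
      refine mul_lt_mul_of_pos_left ?_ hk
      refine ((Tuple.monotone_sort (f i)).strictMono_of_injective
        ((hf i).comp (Tuple.sort (f i)).injective)) ?_
      exact Fin.lt_def.2 (Nat.lt_succ_self _)
    · have hr' : (r : ℕ) + 1 = mult v i := by have := r.2; omega
      have := gridOf_add_mul hv ((fun p : (Σ i, Fin (mult v i)) => mult v p.1 * f p.1 p.2) ∘
        Equiv.sigmaCongrRight fun i => Tuple.sort (f i)) i ⟨0, mult_pos hv i⟩ 1
      rw [show ((r : ℕ) : ℤ) + 1 = ((0 : ℕ) : ℤ) + 1 * mult v i by push_cast; omega,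
        this]
      have h1 : ∀ s, f i s < 1 := fun s => (hl _).2
      have h2 : ∀ s, 0 ≤ f i s := fun s => (hl _).1
      have h3 := h1 (Tuple.sort (f i) r)
      have h4 := h2 (Tuple.sort (f i) ⟨0, mult_pos hv i⟩)
      change (mult v i : ℝ) * f i (Tuple.sort (f i) r) <
        mult v i * f i (Tuple.sort (f i) ⟨0, mult_pos hv i⟩) + (1 : ℤ) * mult v i
      push_cast
      nlinarith

end

section

variable {v : Fin 3 → Lat} {u : Fin 3 → ℤ → ℝ}

/-! ### Admissibility is locally constant -/

/-- The product K of the three multiplicities is a common period. Shifting the indices by n K adds K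
times the sum of n, that is 0, to the height. -/
theorem height_add_period (hv : 0 < dblArea v) (w : (Σ i, Fin (mult v i)) → ℝ) (a n : Fin 3 → ℤ)
    (hn : ∑ i, n i = 0) :
    height (gridOf hv w) (fun i => a i + n i * ((∏ j, mult v j : ℕ) : ℤ)) =
      height (gridOf hv w) a := by
  have h1 : ∀ i, gridOf hv w i (a i + n i * ((∏ j, mult v j : ℕ) : ℤ)) =
      gridOf hv w i (a i) + n i * ((∏ j, mult v j : ℕ) : ℝ) := by
    intro i
    obtain ⟨c, hc⟩ := Finset.dvd_prod_of_mem (mult v) (Finset.mem_univ i)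
    rw [hc, mul_comm (mult v i), Nat.cast_mul, ← mul_assoc, gridOf_periodic]
    push_cast
    ring
  have h2 : ((∑ i, n i : ℤ) : ℝ) = 0 := by rw [hn, Int.cast_zero]
  push_cast at h2
  simp only [height, h1, Finset.sum_add_distrib, ← Finset.sum_mul]
  rw [h2, zero_mul, add_zero]

/-- Reduction of two indices modulo K leaves finitely many heights for each index sum, so
`HeightCut` becomes a finite system of strict inequalities. -/
theorem exists_height_eq (hv : 0 < dblArea v) (a : Fin 3 → ℤ) :
    ∃ p ∈ Finset.range (∏ j, mult v j), ∃ q ∈ Finset.range (∏ j, mult v j),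
      ∀ w, height (gridOf hv w) a = height (gridOf hv w) ![p, q, ∑ i, a i - p - q] := by
  have hK : (0 : ℤ) < ((∏ j, mult v j : ℕ) : ℤ) :=
    Int.natCast_pos.2 (Finset.prod_pos fun i _ => mult_pos hv i)
  set K : ℤ := ((∏ j, mult v j : ℕ) : ℤ)
  have hnn : ∀ b : ℤ, 0 ≤ b % K := fun b => Int.emod_nonneg b hK.ne'
  have hlt : ∀ b : ℤ, b % K < K := fun b => Int.emod_lt_of_pos b hK
  refine ⟨(a 0 % K).toNat, ?_, (a 1 % K).toNat, ?_, fun w => ?_⟩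
  · rw [Finset.mem_range]; have := hlt (a 0); have := hnn (a 0); omega
  · rw [Finset.mem_range]; have := hlt (a 1); have := hnn (a 1); omega
  · have hp : height (gridOf hv w) (fun i => a i + ![-(a 0 / K), -(a 1 / K), a 0 / K + a 1 / K] i * K)
        = height (gridOf hv w) a :=
      height_add_period hv w a _ (by simp [Fin.sum_univ_three]; ring)
    rw [Int.toNat_of_nonneg (hnn _), Int.toNat_of_nonneg (hnn _), ← hp]
    clear_value K
    congr 1
    have h0 := Int.emod_add_mul_ediv (a 0) K
    have h1 := Int.emod_add_mul_ediv (a 1) K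
    ext i
    fin_cases i
    · simp; linarith
    · simp; linarith
    · simp [Fin.sum_univ_three]; linarith

open Filter in
theorem HeightCut.eventually (hv : 0 < dblArea v) {w₀ : (Σ i, Fin (mult v i)) → ℝ} {H : ℤ}
    (hH : HeightCut (gridOf hv w₀) H) : ∀ᶠ w in 𝓝 w₀, HeightCut (gridOf hv w) H := by
  set K := ∏ j, mult v j
  have h1 : ∀ᶠ w in 𝓝 w₀, ∀ p ∈ Finset.range K, ∀ q ∈ Finset.range K,
      height (gridOf hv w) ![p, q, H - p - q] < 0 ∧
      0 < height (gridOf hv w) ![p, q, H + 1 - p - q] := by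
    refine (eventually_all_finset _).2 fun p _ => (eventually_all_finset _).2 fun q _ => ?_
    exact ((continuous_height_gridOf hv _).tendsto _ |>.eventually_lt_const
        ((hH _).1 (by simp [Fin.sum_univ_three]))).and
      ((continuous_height_gridOf hv _).tendsto _ |>.eventually_const_lt
        ((hH _).2 (by simp [Fin.sum_univ_three])))
  filter_upwards [h1] with w hw a
  obtain ⟨p, hp, q, hq, ha⟩ := exists_height_eq hv a
  constructor
  · intro h
    rw [ha, h]
    exact (hw p hp q hq).1
  · intro h
    rw [ha, h]
    exact (hw p hp q hq).2

open Filter in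
theorem eventually_isGrid (hv : 0 < dblArea v) {w₀ : (Σ i, Fin (mult v i)) → ℝ}
    (h : IsGrid v (gridOf hv w₀)) : ∀ᶠ w in 𝓝 w₀, IsGrid v (gridOf hv w) := by
  have h1 : ∀ᶠ w in 𝓝 w₀, ∀ i (r : Fin (mult v i)),
      gridOf hv w i ((r : ℕ) : ℤ) < gridOf hv w i ((r : ℕ) + 1) :=
    eventually_all.2 fun i => eventually_all.2 fun r =>
      (continuous_gridOf hv i _).continuousAt.eventually_lt (continuous_gridOf hv i _).continuousAt
        (h.mono i (lt_add_one _))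
  exact h1.mono fun w hw => isGrid_gridOf hv hw

open Filter in
-- The sign change on the third axis, stable under perturbation, leaves b as the only possible cut.
-- As no height vanishes, the cut b is violated by a strict inequality at a single a, which also
-- persists.
theorem eventually_not_heightCut (hv : 0 < dblArea v) {w₀ : (Σ i, Fin (mult v i)) → ℝ}
    (h : IsGrid v (gridOf hv w₀)) (h0 : ∀ a, height (gridOf hv w₀) a ≠ 0)
    (hn : ¬∃ H, HeightCut (gridOf hv w₀) H) :
    ∀ᶠ w in 𝓝 w₀, ¬∃ H, HeightCut (gridOf hv w) H := by
  have hneg : ∀ a, height (gridOf hv w₀) a < 0 → ∀ᶠ w in 𝓝 w₀, height (gridOf hv w) a < 0 :=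
    fun a ha => ((continuous_height_gridOf hv a).tendsto _).eventually_lt_const ha
  have hpos : ∀ a, 0 < height (gridOf hv w₀) a → ∀ᶠ w in 𝓝 w₀, 0 < height (gridOf hv w) a :=
    fun a ha => ((continuous_height_gridOf hv a).tendsto _).eventually_const_lt ha
  obtain ⟨b, hb1, hb2⟩ := exists_floor h hv 2 (-(gridOf hv w₀ 0 0 + gridOf hv w₀ 1 0))
  have ha1 : height (gridOf hv w₀) ![0, 0, b] < 0 := by
    refine lt_of_le_of_ne ?_ (h0 _)
    simp [height, Fin.sum_univ_three]
    linarith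
  have ha2 : 0 < height (gridOf hv w₀) ![0, 0, b + 1] := by
    simp [height, Fin.sum_univ_three]
    linarith
  obtain ⟨a, ha⟩ : ∃ a : Fin 3 → ℤ, ¬((∑ i, a i = b → height (gridOf hv w₀) a < 0) ∧
      (∑ i, a i = b + 1 → 0 < height (gridOf hv w₀) a)) := by
    by_contra! hcon
    exact hn ⟨b, fun a => hcon a⟩
  have hviol : ∀ᶠ w in 𝓝 w₀, ¬HeightCut (gridOf hv w) b := by
    rw [not_and_or] at ha
    push Not at ha
    rcases ha with ⟨hs, hle⟩ | ⟨hs, hle⟩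
    · filter_upwards [hpos a (hle.lt_of_ne (h0 a).symm)] with w hw hH
      exact hw.not_gt ((hH a).1 hs)
    · filter_upwards [hneg a (hle.lt_of_ne (h0 a))] with w hw hH
      exact hw.not_gt ((hH a).2 hs)
  filter_upwards [hviol, hneg _ ha1, hpos _ ha2, eventually_isGrid hv h] with w h1 h2 h3 h4
  rintro ⟨H, hH⟩
  have h5 : b ≤ H := by
    by_contra! hcon
    exact h2.not_gt (hH.pos h4.mono (by simp [Fin.sum_univ_three]; omega))
  have h6 : H ≤ b := by
    by_contra! hcon
    exact h3.not_gt (hH.neg h4.mono (by simp [Fin.sum_univ_three]; omega))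
  exact h1 (le_antisymm h5 h6 ▸ hH)

open Filter in
-- Openness of `positions` gives nearby positions lifts near `w₀`, and the one permutation `σ` that
-- sorts `w₀` still sorts them.
theorem eventually_isAdmissible_iff (hv : 0 < dblArea v) (c₀ : SimplePosition (triangle v)) :
    ∀ᶠ c in 𝓝 c₀, (IsAdmissible c.arrangement.lines ↔ IsAdmissible c₀.arrangement.lines) := by
  obtain ⟨w₀, σ, hc, hg⟩ := exists_positions hv c₀.2.1
  have hlines : ∀ (c : SimplePosition (triangle v)) w, c.1 = positions hv w →
      c.arrangement.lines = gridLines v (gridOf hv (w ∘ Equiv.sigmaCongrRight σ)) := by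
    intro c w hw
    rw [← range_line_positions hv w σ, ← hw]
    rfl
  have hs := c₀.arrangement.simple
  have h0 := hs
  rw [hlines c₀ w₀ hc, isSimple_gridLines_iff hv hg] at h0
  have hev : ∀ᶠ w in 𝓝 (w₀ ∘ Equiv.sigmaCongrRight σ), IsGrid v (gridOf hv w) ∧
      ((∃ H, HeightCut (gridOf hv w) H) ↔
        ∃ H, HeightCut (gridOf hv (w₀ ∘ Equiv.sigmaCongrRight σ)) H) := by
    refine (eventually_isGrid hv hg).and ?_
    by_cases hH : ∃ H, HeightCut (gridOf hv (w₀ ∘ Equiv.sigmaCongrRight σ)) H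
    · obtain ⟨H, hH⟩ := hH
      exact (hH.eventually hv).mono fun w hw => iff_of_true ⟨H, hw⟩ ⟨H, hH⟩
    · exact (eventually_not_heightCut hv hg h0 hH).mono fun w hw => iff_of_false hw hH
  have hcont : Continuous fun w : (Σ i, Fin (mult v i)) → ℝ => w ∘ Equiv.sigmaCongrRight σ := by
    fun_prop
  have himage := (isOpenMap_positions hv).image_mem_nhds (hcont.continuousAt.eventually hev)
  rw [← hc] at himage
  have hval : Continuous (Subtype.val : SimplePosition (triangle v) → _) := continuous_subtype_val
  filter_upwards [hval.continuousAt.eventually himage] with c hcm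
  obtain ⟨w, ⟨hw1, hw2⟩, hw⟩ := hcm
  have hsc := c.arrangement.simple
  rw [hlines c w hw.symm] at hsc ⊢
  rw [hlines c₀ w₀ hc] at hs ⊢
  rw [isAdmissible_gridLines_iff hv hw1 hsc, isAdmissible_gridLines_iff hv hg hs, hw2]

theorem isClopen_setOf_isAdmissible (hv : 0 < dblArea v) :
    IsClopen {A : SimpleArrangement (triangle v) | IsAdmissible A.lines} := by
  constructor
  · rw [← isOpen_compl_iff, isOpen_coinduced, isOpen_iff_mem_nhds]
    intro c hc
    filter_upwards [eventually_isAdmissible_iff hv c] with c' hc' hA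
    exact hc (hc'.1 hA)
  · rw [isOpen_coinduced, isOpen_iff_mem_nhds]
    intro c hc
    filter_upwards [eventually_isAdmissible_iff hv c] with c' hc'
    exact hc'.2 hc

theorem isAdmissible_of_joined (hv : 0 < dblArea v) {A B : SimpleArrangement (triangle v)}
    (hAB : Joined A B) (hA : IsAdmissible A.lines) : IsAdmissible B.lines :=
  (isClopen_setOf_isAdmissible hv).connectedComponent_subset hA
    (pathComponent_subset_component A hAB)

/-! ### The component of the admissible arrangements -/

theorem SimpleArrangement.ext_lines {Δ : Set Plane} {A B : SimpleArrangement Δ}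
    (h : A.lines = B.lines) : A = B := by
  cases A; cases B; cases h; rfl

theorem exists_arrangement_eq {Δ : Set Plane} (A : SimpleArrangement Δ) :
    ∃ c : SimplePosition Δ, c.arrangement = A := by
  obtain ⟨L, hL⟩ := A.associated
  have hline : ∀ e : PolygonEdge Δ, e.line (L e).1.pos = (L e).1 := fun e =>
    OrientedLine.ext (hL e).symm rfl
  have hrange : (Set.range fun e : PolygonEdge Δ => e.line (L e).1.pos) = A.lines := by
    simp only [hline]
    rw [Set.range_comp' Subtype.val L, L.surjective.range_eq, Set.image_univ, Subtype.range_coe]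
  refine ⟨⟨fun e => (L e).1.pos, ?_, ?_⟩, SimpleArrangement.ext_lines hrange⟩
  · simp only [hline]
    exact Subtype.val_injective.comp L.injective
  · rw [hrange]
    exact A.simple

theorem IsGrid.range_line (h : IsGrid v u) (hv : 0 < dblArea v) :
    (Set.range fun e : PolygonEdge (triangle v) =>
      e.line (positions hv (fun p => u p.1 ((p.2 : ℕ) : ℤ)) e)) = gridLines v u := by
  have := range_line_positions hv (fun p => u p.1 ((p.2 : ℕ) : ℤ)) fun _ => Equiv.refl _
  rw [this]
  exact congrArg (gridLines v) (h.gridOf_eq hv)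

/-- The positions of the lines of a grid. -/
def gridPosition (hv : 0 < dblArea v) (h : IsGrid v u) (h0 : ∀ a, height u a ≠ 0) :
    SimplePosition (triangle v) :=
  ⟨positions hv fun p => u p.1 ((p.2 : ℕ) : ℤ),
    injective_line_positions hv (by rwa [h.gridOf_eq hv]),
    by rw [h.range_line hv]; exact (isSimple_gridLines_iff hv h).2 h0⟩

theorem lines_gridPosition (hv : 0 < dblArea v) (h : IsGrid v u) (h0 : ∀ a, height u a ≠ 0) :
    (gridPosition hv h h0).arrangement.lines = gridLines v u := h.range_line hv

/-- Shifting the indices of family 0 by H leaves the lines unchanged and moves the cut to 0. -/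
theorem exists_heightCut_zero (hv : 0 < dblArea v) {A : SimpleArrangement (triangle v)}
    (hA : IsAdmissible A.lines) : ∃ u, IsGrid v u ∧ HeightCut u 0 ∧ A.lines = gridLines v u := by
  obtain ⟨c, rfl⟩ := exists_arrangement_eq A
  obtain ⟨w, σ, hc, h⟩ := exists_positions hv c.2.1
  have hlines : c.arrangement.lines = gridLines v (gridOf hv (w ∘ Equiv.sigmaCongrRight σ)) := by
    rw [← range_line_positions hv w σ, ← hc]
    rfl
  have hs := c.arrangement.simple
  rw [hlines] at hs hA ⊢
  generalize gridOf hv (w ∘ Equiv.sigmaCongrRight σ) = u at *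
  obtain ⟨H, hH⟩ := (isAdmissible_gridLines_iff hv h hs).1 hA
  refine ⟨fun i b => u i (b + (Pi.single 0 H : Fin 3 → ℤ) i), ⟨fun i => ?_, fun i a => ?_⟩,
    fun a => ?_, ?_⟩
  · exact (h.mono i).comp (strictMono_id.add_const _)
  · rw [add_right_comm, h.periodic]
  · have h1 := hH (a + Pi.single 0 H)
    rw [sum_add_single] at h1
    exact ⟨fun h => h1.1 (by rw [h, zero_add]), fun h => h1.2 (by rw [h]; ring)⟩
  · ext L
    constructor
    · rintro ⟨i, b, hs, hp⟩
      exact ⟨i, b - (Pi.single 0 H : Fin 3 → ℤ) i, hs, by rw [hp]; simp⟩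
    · rintro ⟨i, b, hs, hp⟩
      exact ⟨i, _, hs, hp⟩

/-! ### Convexity of the admissible grids -/

theorem IsGrid.combo {u' : Fin 3 → ℤ → ℝ} (h : IsGrid v u) (h' : IsGrid v u') {t : ℝ} (h0 : 0 ≤ t)
    (h1 : t ≤ 1) : IsGrid v fun i b => (1 - t) * u i b + t * u' i b where
  mono i a b hab := by
    have h2 := h.mono i hab
    have h3 := h'.mono i hab
    change (1 - t) * u i a + t * u' i a < (1 - t) * u i b + t * u' i b
    rcases h0.eq_or_lt with rfl | h0
    · linarith
    · nlinarith
  periodic i a := by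
    rw [h.periodic, h'.periodic]
    ring

theorem height_combo {u' : Fin 3 → ℤ → ℝ} (t : ℝ) (a : Fin 3 → ℤ) :
    height (fun i b => (1 - t) * u i b + t * u' i b) a = (1 - t) * height u a + t * height u' a := by
  rw [height, Finset.sum_add_distrib, ← Finset.mul_sum, ← Finset.mul_sum]
  rfl

theorem HeightCut.combo {u' : Fin 3 → ℤ → ℝ} {H : ℤ} (h : HeightCut u H) (h' : HeightCut u' H)
    {t : ℝ} (h0 : 0 ≤ t) (h1 : t ≤ 1) : HeightCut (fun i b => (1 - t) * u i b + t * u' i b) H := by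
  intro a
  rw [height_combo]
  constructor
  · intro ha
    have h2 := (h a).1 ha
    have h3 := (h' a).1 ha
    rcases h0.eq_or_lt with rfl | h0
    · linarith
    · nlinarith
  · intro ha
    have h2 := (h a).2 ha
    have h3 := (h' a).2 ha
    rcases h0.eq_or_lt with rfl | h0
    · linarith
    · nlinarith

/-- Interpolate linearly between two grids that have both been normalized to cut 0. Heights are
affine along the way and keep their signs, so the arrangements stay simple. -/
theorem joined_of_isAdmissible (hv : 0 < dblArea v) {A B : SimpleArrangement (triangle v)}
    (hA : IsAdmissible A.lines) (hB : IsAdmissible B.lines) : Joined A B := by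
  obtain ⟨u, hu, hH, hAu⟩ := exists_heightCut_zero hv hA
  obtain ⟨u', hu', hH', hBu⟩ := exists_heightCut_zero hv hB
  have hg := fun t : unitInterval => hu.combo hu' t.2.1 t.2.2
  have hh := fun t : unitInterval => (hH.combo hH' t.2.1 t.2.2).height_ne_zero (hg t).mono
  have hcont : Continuous fun t : unitInterval => gridPosition hv (hg t) (hh t) :=
    Continuous.subtype_mk ((continuous_positions hv).comp (by fun_prop)) _
  refine ⟨⟨⟨fun t => (gridPosition hv (hg t) (hh t)).arrangement,
    (show Continuous (SimplePosition.arrangement (Δ := triangle v)) from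
      continuous_coinduced_rng).comp hcont⟩, ?_, ?_⟩⟩
  · refine SimpleArrangement.ext_lines ((lines_gridPosition hv (hg 0) (hh 0)).trans ?_)
    simp [hAu]
  · refine SimpleArrangement.ext_lines ((lines_gridPosition hv (hg 1) (hh 1)).trans ?_)
    simp [hBu]

theorem exists_isAdmissible (hv : 0 < dblArea v) :
    ∃ A : SimpleArrangement (triangle v), IsAdmissible A.lines := by
  -- Three offsets of 1/6 make the height an integer minus 1/2, so it changes sign exactly between
  -- index sums 0 and 1.
  have h : IsGrid v fun _ b => (b : ℝ) - 1 / 6 :=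
    ⟨fun i a b hab => sub_lt_sub_right (Int.cast_lt.2 hab) _, fun i a => by push_cast; ring⟩
  have hH : HeightCut (fun _ b => (b : ℝ) - 1 / 6) 0 := by
    intro a
    have h1 : height (fun _ b => (b : ℝ) - 1 / 6) a = ((∑ i, a i : ℤ) : ℝ) - 1 / 2 := by
      simp [height, Fin.sum_univ_three]
      ring
    rw [h1]
    constructor <;> intro ha <;> rw [ha] <;> norm_num
  refine ⟨(gridPosition hv h (hH.height_ne_zero h.mono)).arrangement, ?_⟩
  rw [lines_gridPosition]
  exact hH.isAdmissible hv h

end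

end HananyVegh

end

/-- Let `Δ` be a lattice triangle, with vertices listed counterclockwise. For every choice of
representatives of the components of the space of simple arrangements, the linear Hanany–Vegh
algorithm outputs exactly one graph. -/
theorem theorem1p2 (v : Fin 3 → Fin 2 → ℤ)
    (hv : 0 < (v 1 0 - v 0 0) * (v 2 1 - v 0 1) - (v 1 1 - v 0 1) * (v 2 0 - v 0 0))
    (V : Set (HananyVegh.SimpleArrangement
      (convexHull ℝ (Set.range fun i => HananyVegh.toPlane (v i)))))
    (hV : HananyVegh.IsRepresentative V) :
    ∃ G : HananyVegh.BicoloredGraph, HananyVegh.output V = {G} ∧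
      G.IsDimerModel ∧ G.IsHexagonalTiling ∧ HananyVegh.IsDualToMcKayQuiver v G := by
  obtain ⟨A₀, hA₀⟩ := HananyVegh.exists_isAdmissible (v := v) hv
  obtain ⟨⟨A, hAV⟩, hA⟩ := hV.2 (Quotient.mk _ A₀)
  have hAadm := HananyVegh.isAdmissible_of_joined hv (Quotient.exact hA).symm hA₀
  obtain ⟨u, hu, hH, hlines⟩ := HananyVegh.exists_heightCut_zero hv hAadm
  refine ⟨HananyVegh.tilingGraph v u, ?_, HananyVegh.isDimerModel_tilingGraph hv hu,
    HananyVegh.isHexagonalTiling_tilingGraph hv hu, HananyVegh.isDualToMcKayQuiver_tilingGraph hv hu⟩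
  have hdimer : HananyVegh.dimer A.lines = HananyVegh.tilingGraph v u := by
    rw [hlines, hH.dimer_gridLines hv hu]
  ext G
  constructor
  · rintro ⟨B, hBV, hB, rfl⟩
    -- Two admissible representatives lie in the same path component, which contains only one
    -- element of `V`.
    have hBA : (⟨B, hBV⟩ : V) = ⟨A, hAV⟩ :=
      hV.1 (Quotient.sound (HananyVegh.joined_of_isAdmissible hv hB hAadm))
    obtain rfl : B = A := congrArg Subtype.val hBA
    exact hdimer
  · rintro rfl
    exact ⟨A, hAV, hAadm, hdimer.symm⟩
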